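/- **Setting.** Let $\lambda$ be an infinite cardinal and $(K,\preceq)$ an abstract elementary class (AEC); $K_\mu$ is the class of models in $K$ of cardinality $\mu$. An embedding $f:M\to N$ means an embedding with $f[M]\preceq N$. For $M\preceq N$ and $a\in N$, $tp(a,M,N)$ denotes the Galois type: the class of $(N,a)$ under the equivalence relation generated by "$(N_1,a_1)$ and $(N_2,a_2)$ are identified by embeddings $f_1,f_2$ over $M$ into a common model of $K$, with $f_1(a_1)=f_2(a_2)$". $S(M)$ is the set of Galois types over $M$; $M\prec N$ means $M\preceq N$ and $M\neq N$. $(K,\preceq)$ is *$(\lambda,\lambda^+)$-tame* if for every $M\in K_{\lambda^+}$ and $p,q\in S(M)$: if $p\restriction N=q\restriction N$ for every $N\in K_\lambda$ with $N\preceq M$, then $p=q$. **Frames.** Let $\mathfrak s=(K,\preceq,S^{bs},\mathrm{dnf})$, where $S^{bs}$ assigns to each $M\in K_\lambda$ a set $S^{bs}(M)\subseteq S(M)$ ("basic types") and $\mathrm{dnf}$ is a set of quadruples $(M_0,M_1,a,M_3)$. A type $p\in S(M_1)$ *does not fork over $M_0$* if $p=tp(a,M_1,N)$ for some $N,a$ with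 $\mathrm{dnf}(M_0,M_1,a,N)$. $\mathfrak s$ is a *good (non-forking) $\lambda$-frame* if: 1. $LST(K,\preceq)\le\lambda$; $K_\lambda$ has joint embedding, amalgamation and no $\preceq$-maximal model. 2. (a) Every type in $S^{bs}(M)$ is $tp(a,M,N)$ for some $N\in K_\lambda$, $M\prec N$, $a\in N\setminus M$. (b) $S^{bs}$ respects isomorphisms. (c) *Density:* if $M\prec N$ are in $K_\lambda$, there is $a\in N\setminus M$ with $tp(a,M,N)\in S^{bs}(M)$. (d) *Basic stability:* $|S^{bs}(M)|\le\lambda$ for $M\in K_\lambda$. 3. (a) If $\mathrm{dnf}(M_0,M_1,a,M_3)$ then $M_0\preceq M_1\preceq M_3$ are in $K_\lambda$, $a\in M_3\setminus M_1$, and $tp(a,M_n,M_3)\in S^{bs}(M_n)$ for $n=0,1$; $\mathrm{dnf}$ respects isomorphisms. (b) *Monotonicity:* for models in $K_\lambda$ with $M_0\preceq M_0^*\preceq M_1^*\preceq M_1\preceq M_3\preceq M_3^*$ and $M_1^*\cup\{a\}\subseteq M_3^{**}\preceq M_3^*$, $\mathrm{dnf}(M_0,M_1,a,M_3)$ implies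 $\mathrm{dnf}(M_0^*,M_1^*,a,M_3^{**})$. (c) *Local character:* if $\delta<\lambda^+$ is a limit ordinal, $\langle M_\alpha:\alpha\le\delta+1\rangle$ is $\preceq$-increasing continuous in $K_\lambda$ and $tp(a,M_\delta,M_{\delta+1})\in S^{bs}(M_\delta)$, then this type does not fork over $M_\alpha$ for some $\alpha<\delta$. (d) *Uniqueness:* if $M\preceq N$ are in $K_\lambda$, $p,q\in S^{bs}(N)$ do not fork over $M$ and $p\restriction M=q\restriction M$, then $p=q$. (e) *Symmetry:* if $M_0\preceq M_1\preceq M_3$ are in $K_\lambda$, $a_1\in M_1$, $tp(a_1,M_0,M_3)\in S^{bs}(M_0)$ and $tp(a_2,M_1,M_3)$ does not fork over $M_0$, then there are $M_2,M_3^*\in K_\lambda$ with $a_2\in M_2$, $M_0\preceq M_2\preceq M_3^*$, $M_3\preceq M_3^*$, and $tp(a_1,M_2,M_3^*)$ does not fork over $M_0$. (f) *Extension:* if $M\prec N$ are in $K_\lambda$ and $p\in S^{bs}(M)$, some $q\in S^{bs}(N)$ does not fork over $M$ and satisfies $q\restriction M=p$. (g) *Continuity:* if $\delta<\lambda^+$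 is a limit ordinal, $\langle M_\alpha:\alpha\le\delta\rangle$ is $\preceq$-increasing continuous in $K_\lambda$, $p\in S(M_\delta)$ and $p\restriction M_\alpha$ does not fork over $M_0$ for all $\alpha<\delta$, then $p\in S^{bs}(M_\delta)$ and $p$ does not fork over $M_0$. $\mathfrak s$ is a *semi-good $\lambda$-frame* if it satisfies the same axioms with (2)(d) weakened to $|S^{bs}(M)|\le\lambda^+$ for every $M\in K_\lambda$. **The lifted frame.** For models $M_0\preceq M_1\preceq M_2$ of cardinality $\ge\lambda$ and $a\in M_2\setminus M_1$, let $\mathrm{dnf}^{\ge\lambda}(M_0,M_1,a,M_2)$ mean that there is $N_0\in K_\lambda$, $N_0\preceq M_0$, such that for every $N\in K_\lambda$ with $N_0\subseteq N\preceq M_1$, $tp(a,N,M_2)$ does not fork over $N_0$ (in the sense of $\mathfrak s$). A type $p \in S(M)$ over $M\in K_{\lambda^+}$ is *basic* if for some $N\in K_\lambda$, $N\preceq M$, it is of the form $p=tp(a,M,M_2)$ with $\mathrm{dnf}^{\ge\lambda}(N,M,a,M_2)$. Let $\mathfrak s^+=(K,\preceq,S^{bs}_{\lambda^+},\mathrm{dnf}_{\lambda^+})$,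 where $S^{bs}_{\lambda^+}(M)$ is the set of basic types over $M\in K_{\lambda^+}$ and $\mathrm{dnf}_{\lambda^+}$ is the restriction of $\mathrm{dnf}^{\ge\lambda}$ to quadruples of models in $K_{\lambda^+}$. **Theorem.** Suppose $\mathfrak s$ is a semi-good $\lambda$-frame, $K_{\lambda^+}$ has the amalgamation property, and $(K,\preceq)$ is $(\lambda,\lambda^+)$-tame. If $\mathfrak s^+$ satisfies symmetry (axiom (3)(e) with $\lambda^+$ in place of $\lambda$), then $\mathfrak s^+$ is a good non-forking $\lambda^+$-frame. -/

import Mathlib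

open FirstOrder Cardinal Order

universe u

namespace NonForking

/-! ### Models, abstract elementary classes -/

/-- A model: a structure for the vocabulary `L` whose underlying set is a set of set theory, so that
models may literally be included in, and unions of, one another. -/
structure Model (L : FirstOrder.Language.{u, u}) where
  carrier : ZFSet.{u}
  [str : L.Structure carrier]

attribute [instance] Model.str

variable {L : FirstOrder.Language.{u, u}}

/-- The cardinality `‖M‖`. -/
noncomputable def Model.card (M : Model L) : Cardinal.{u} := M.carrier.card

/-- `M ⊆ N`: the inclusion map is defined and is an embedding of structures. -/
def Model.Sub (M N : Model L) : Prop :=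
  ∃ i : M.carrier ↪[L] N.carrier, ∀ x, (i x : ZFSet.{u}) = x

/-- For an isomorphism `f : N → N'` and a substructure `M` of `N`: `M' = f[M]`. -/
def IsImage {N N' : Model L} (f : N.carrier ≃[L] N'.carrier) (M M' : Model L) : Prop :=
  M'.Sub N' ∧ ∀ y : N'.carrier, (y : ZFSet.{u}) ∈ M'.carrier ↔
    ∃ x : N.carrier, (x : ZFSet.{u}) ∈ M.carrier ∧ f x = y

/-- `N = ⋃ {M α : α < δ}` as structures. -/
def IsUnion (M : Ordinal.{u} → Model L) (δ : Ordinal.{u}) (N : Model L) : Prop :=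
  (∀ α < δ, (M α).Sub N) ∧ ∀ x ∈ N.carrier, ∃ α < δ, x ∈ (M α).carrier

/-- `⟨M α : α < θ⟩` is increasing with respect to the relation `le`, and continuous. -/
def IncreasingContinuous (le : Model L → Model L → Prop) (M : Ordinal.{u} → Model L)
    (θ : Ordinal.{u}) : Prop :=
  (∀ α β, α ≤ β → β < θ → le (M α) (M β)) ∧
    ∀ γ < θ, IsSuccLimit γ → IsUnion M γ (M γ)

/-- `κ` bounds the Löwenheim-Skolem-Tarski number of `(K, ⪯)`. -/
def LSTBound (mem : Model L → Prop) (le : Model L → Model L → Prop) (κ : Cardinal.{u}) : Prop :=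
  ∀ N, mem N → ∀ A : ZFSet.{u}, A ⊆ N.carrier →
    ∃ M, le M N ∧ A ⊆ M.carrier ∧ M.card ≤ κ + A.card

variable (L) in
/-- An abstract elementary class `(K, ⪯)` in the vocabulary `L`. -/
structure AEC where
  /-- membership in `K` -/
  mem : Model L → Prop
  /-- the relation `⪯` on `K` -/
  le : Model L → Model L → Prop
  mem_iso : ∀ M N : Model L, mem M → Nonempty (M.carrier ≃[L] N.carrier) → mem N
  le_iso : ∀ (M₀ M₁ N₀ N₁ : Model L) (f : M₁.carrier ≃[L] N₁.carrier),
    le M₀ M₁ → IsImage f M₀ N₀ → le N₀ N₁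
  mem_of_le : ∀ M N, le M N → mem M ∧ mem N
  sub_of_le : ∀ M N, le M N → M.Sub N
  refl : ∀ M, mem M → le M M
  trans : ∀ M₀ M₁ M₂, le M₀ M₁ → le M₁ M₂ → le M₀ M₂
  le_union : ∀ (δ : Ordinal.{u}) (M : Ordinal.{u} → Model L) (N : Model L), IsSuccLimit δ →
    IncreasingContinuous le M δ → IsUnion M δ N → ∀ α < δ, le (M α) N
  smooth : ∀ (δ : Ordinal.{u}) (M : Ordinal.{u} → Model L) (N N' : Model L), IsSuccLimit δ →
    IncreasingContinuous le M δ → IsUnion M δ N → (∀ α < δ, le (M α) N') → le N N'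
  coherent : ∀ M₀ M₁ M₂, M₀.Sub M₁ → le M₀ M₂ → le M₁ M₂ → le M₀ M₁
  exists_LST : ∃ κ, LSTBound mem le κ

namespace AEC

variable (K : AEC L)

/-- The Löwenheim-Skolem-Tarski number. -/
noncomputable def LST : Cardinal.{u} := sInf {κ | LSTBound K.mem K.le κ}

/-- `M ≺ N`. -/
def lt (M N : Model L) : Prop := K.le M N ∧ M.carrier ≠ N.carrier

/-- `M ∈ K_μ`. -/
def memCard (μ : Cardinal.{u}) (M : Model L) : Prop := K.mem M ∧ M.card = μ

/-- `f` is an embedding in the sense of the class: `f[M] ⪯ N`. -/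
def IsStrong {M N : Model L} (f : M.carrier ↪[L] N.carrier) : Prop :=
  ∃ M' : Model L, K.le M' N ∧
    ∀ y : N.carrier, (y : ZFSet.{u}) ∈ M'.carrier ↔ ∃ x, f x = y

/-- `f` is an embedding in the sense of the class that fixes the elements of `M₀`. -/
def IsStrongOver (M₀ : Model L) {M N : Model L} (f : M.carrier ↪[L] N.carrier) : Prop :=
  K.IsStrong f ∧ ∀ x : M.carrier, (x : ZFSet.{u}) ∈ M₀.carrier → (f x : ZFSet.{u}) = x

/-- The amalgamation property in `μ`. -/
def Amalgamation (μ : Cardinal.{u}) : Prop :=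
  ∀ M₀ M₁ M₂, K.memCard μ M₀ → K.memCard μ M₁ → K.memCard μ M₂ → K.le M₀ M₁ → K.le M₀ M₂ →
    ∃ M₃, K.memCard μ M₃ ∧
      ∃ (f₁ : M₁.carrier ↪[L] M₃.carrier) (f₂ : M₂.carrier ↪[L] M₃.carrier),
        K.IsStrongOver M₀ f₁ ∧ K.IsStrongOver M₀ f₂

/-- The joint embedding property in `μ`. -/
def JointEmbedding (μ : Cardinal.{u}) : Prop :=
  ∀ M₁ M₂, K.memCard μ M₁ → K.memCard μ M₂ → ∃ M₃, K.memCard μ M₃ ∧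
    ∃ (f₁ : M₁.carrier ↪[L] M₃.carrier) (f₂ : M₂.carrier ↪[L] M₃.carrier),
      K.IsStrong f₁ ∧ K.IsStrong f₂

/-- There is no `⪯`-maximal model in `K_μ`. -/
def NoMaximal (μ : Cardinal.{u}) : Prop :=
  ∀ M, K.memCard μ M → ∃ N, K.memCard μ N ∧ K.lt M N

/-! ### Galois types -/

/-- The pairs `(N, a)` with `M ⪯ N` and `a ∈ N`. -/
structure Pointed (M : Model L) where
  N : Model L
  le : K.le M N
  a : ZFSet.{u}
  ha : a ∈ N.carrier

/-- Some amalgam of `N₁` and `N₂` over `M` identifies `a₁` with `a₂`. -/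
def AtomicEq (M : Model L) (p q : K.Pointed M) : Prop :=
  ∃ (N : Model L) (f : p.N.carrier ↪[L] N.carrier) (g : q.N.carrier ↪[L] N.carrier),
    K.IsStrongOver M f ∧ K.IsStrongOver M g ∧ f ⟨p.a, p.ha⟩ = g ⟨q.a, q.ha⟩

/-- `S(M)`: the classes of the equivalence relation generated by `AtomicEq`. -/
def GType (M : Model L) : Type (u + 1) := Quot (K.AtomicEq M)

variable {K}

/-- `tp(a, M, N)`. -/
def tp {M N : Model L} (h : K.le M N) (a : ZFSet.{u}) (ha : a ∈ N.carrier) : K.GType M :=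
  Quot.mk _ ⟨N, h, a, ha⟩

/-- The restriction `p ↾ M₀`, for `p ∈ S(M)` and `M₀ ⪯ M`. -/
def GType.restrict {M₀ M : Model L} (h : K.le M₀ M) (p : K.GType M) : K.GType M₀ :=
  Quot.map (fun t => ⟨t.N, K.trans _ _ _ h t.le, t.a, t.ha⟩)
    (by
      rintro s t ⟨N, f, g, hf, hg, hfg⟩
      obtain ⟨i, hi⟩ := K.sub_of_le _ _ h
      have hsub : ∀ x, x ∈ M₀.carrier → x ∈ M.carrier := fun x hx => by
        have := (i ⟨x, hx⟩).2
        rwa [hi ⟨x, hx⟩] at this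
      exact ⟨N, f, g, ⟨hf.1, fun x hx => hf.2 x (hsub _ hx)⟩,
        ⟨hg.1, fun x hx => hg.2 x (hsub _ hx)⟩, hfg⟩) p

variable (K)

/-- `(lam, μ)`-tameness: types over models in `K_μ` are determined by their restrictions to the
`⪯`-smaller models in `K_lam`. -/
def Tame (lam μ : Cardinal.{u}) : Prop :=
  ∀ M, K.memCard μ M → ∀ p q : K.GType M,
    (∀ (N : Model L) (h : K.le N M), K.memCard lam N → p.restrict h = q.restrict h) → p = q

end AEC

/-! ### Frames -/

variable (L) in
/-- The data `(K, ⪯, S^bs, dnf)` of a frame, without axioms. Only the values of `Sbs` and `dnf` at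
models of the cardinality under consideration matter; `dnf M₀ M₁ a M₃` says that `a` is independent
from `M₁` over `M₀` in `M₃`. -/
structure PreFrame where
  K : AEC L
  Sbs : ∀ M : Model L, Set (K.GType M)
  dnf : Model L → Model L → ZFSet.{u} → Model L → Prop

namespace PreFrame

variable (s : PreFrame L)

/-- The type `p ∈ S(M₁)` does not fork over `M₀`. -/
def NonFork (M₀ : Model L) {M₁ : Model L} (p : s.K.GType M₁) : Prop :=
  ∃ (N : Model L) (h : s.K.le M₁ N) (a : ZFSet.{u}) (ha : a ∈ N.carrier),
    p = AEC.tp h a ha ∧ s.dnf M₀ M₁ a N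

/-- Symmetry, for models in `K_lam`. -/
def Symmetry (lam : Cardinal.{u}) : Prop :=
  ∀ (M₀ M₁ M₃ : Model L) (a₁ a₂ : ZFSet.{u}) (h₀₁ : s.K.le M₀ M₁) (h₁₃ : s.K.le M₁ M₃)
    (h₁ : a₁ ∈ M₃.carrier) (h₂ : a₂ ∈ M₃.carrier),
    s.K.memCard lam M₀ → s.K.memCard lam M₁ → s.K.memCard lam M₃ → a₁ ∈ M₁.carrier →
    AEC.tp (s.K.trans _ _ _ h₀₁ h₁₃) a₁ h₁ ∈ s.Sbs M₀ → s.NonFork M₀ (AEC.tp h₁₃ a₂ h₂) →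
    ∃ (M₂ M₃' : Model L) (h₂₃ : s.K.le M₂ M₃') (h₁' : a₁ ∈ M₃'.carrier),
      s.K.memCard lam M₂ ∧ s.K.memCard lam M₃' ∧ a₂ ∈ M₂.carrier ∧ s.K.le M₀ M₂ ∧
      s.K.le M₃ M₃' ∧ s.NonFork M₀ (AEC.tp h₂₃ a₁ h₁')

/-- The axioms of a non-forking `lam`-frame, with at most `κ` basic types over each model. -/
structure IsFrame (lam κ : Cardinal.{u}) : Prop where
  infinite : ℵ₀ ≤ lam
  LST_le : s.K.LST ≤ lam
  jointEmbedding : s.K.JointEmbedding lam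
  amalgamation : s.K.Amalgamation lam
  noMaximal : s.K.NoMaximal lam
  /-- basic types are non-algebraic -/
  basic_nonalgebraic : ∀ M, s.K.memCard lam M → ∀ p ∈ s.Sbs M,
    ∃ (N : Model L) (h : s.K.le M N) (a : ZFSet.{u}) (ha : a ∈ N.carrier),
      s.K.memCard lam N ∧ a ∉ M.carrier ∧ p = AEC.tp h a ha
  basic_iso : ∀ (M N M' N' : Model L) (f : N.carrier ≃[L] N'.carrier)
    (h : s.K.le M N) (h' : s.K.le M' N') (a : N.carrier),
    s.K.memCard lam M → s.K.memCard lam N → IsImage f M M' →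
    AEC.tp h a a.2 ∈ s.Sbs M → AEC.tp h' (f a) (f a).2 ∈ s.Sbs M'
  density : ∀ (M N : Model L) (h : s.K.le M N), s.K.memCard lam M → s.K.memCard lam N →
    s.K.lt M N → ∃ (a : ZFSet.{u}) (ha : a ∈ N.carrier), a ∉ M.carrier ∧ AEC.tp h a ha ∈ s.Sbs M
  stability : ∀ M, s.K.memCard lam M → #(s.Sbs M) ≤ Cardinal.lift.{u + 1} κ
  dnf_basic : ∀ (M₀ M₁ : Model L) (a : ZFSet.{u}) (M₃ : Model L), s.dnf M₀ M₁ a M₃ →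
    s.K.memCard lam M₀ ∧ s.K.memCard lam M₁ ∧ s.K.memCard lam M₃ ∧ s.K.le M₀ M₁ ∧
    a ∉ M₁.carrier ∧
    ∃ (ha : a ∈ M₃.carrier) (h₀ : s.K.le M₀ M₃) (h₁ : s.K.le M₁ M₃),
      AEC.tp h₀ a ha ∈ s.Sbs M₀ ∧ AEC.tp h₁ a ha ∈ s.Sbs M₁
  dnf_iso : ∀ (M₀ M₁ M₃ M₀' M₁' M₃' : Model L) (f : M₃.carrier ≃[L] M₃'.carrier)
    (a : M₃.carrier), IsImage f M₀ M₀' → IsImage f M₁ M₁' →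
    s.dnf M₀ M₁ a M₃ → s.dnf M₀' M₁' (f a) M₃'
  monotonicity : ∀ (M₀ N₀ N₁ M₁ M₃ M₃' N₃ : Model L) (a : ZFSet.{u}),
    (∀ M ∈ [M₀, N₀, N₁, M₁, M₃, M₃', N₃], s.K.memCard lam M) →
    s.K.le M₀ N₀ → s.K.le N₀ N₁ → s.K.le N₁ M₁ → s.K.le M₁ M₃ → s.K.le M₃ M₃' →
    N₁.carrier ⊆ N₃.carrier → a ∈ N₃.carrier → s.K.le N₃ M₃' →
    s.dnf M₀ M₁ a M₃ → s.dnf N₀ N₁ a N₃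
  localCharacter : ∀ (δ : Ordinal.{u}) (M : Ordinal.{u} → Model L), IsSuccLimit δ →
    δ < (succ lam).ord → (∀ α ≤ δ + 1, s.K.memCard lam (M α)) →
    IncreasingContinuous s.K.le M (δ + 2) →
    ∀ (h : s.K.le (M δ) (M (δ + 1))) (a : ZFSet.{u}) (ha : a ∈ (M (δ + 1)).carrier),
      AEC.tp h a ha ∈ s.Sbs (M δ) → ∃ α < δ, s.NonFork (M α) (AEC.tp h a ha)
  uniqueness : ∀ (M N : Model L) (h : s.K.le M N), s.K.memCard lam M → s.K.memCard lam N →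
    ∀ p ∈ s.Sbs N, ∀ q ∈ s.Sbs N, s.NonFork M p → s.NonFork M q →
      p.restrict h = q.restrict h → p = q
  symmetry : s.Symmetry lam
  extension : ∀ (M N : Model L) (h : s.K.le M N), s.K.memCard lam M → s.K.memCard lam N →
    s.K.lt M N → ∀ p ∈ s.Sbs M, ∃ q ∈ s.Sbs N, s.NonFork M q ∧ q.restrict h = p
  continuity : ∀ (δ : Ordinal.{u}) (M : Ordinal.{u} → Model L), IsSuccLimit δ →
    δ < (succ lam).ord → (∀ α ≤ δ, s.K.memCard lam (M α)) →
    IncreasingContinuous s.K.le M (δ + 1) →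
    ∀ p : s.K.GType (M δ),
      (∀ α < δ, ∀ h : s.K.le (M α) (M δ), s.NonFork (M 0) (p.restrict h)) →
      p ∈ s.Sbs (M δ) ∧ s.NonFork (M 0) p

/-- `s` is a good non-forking `lam`-frame. -/
def IsGood (lam : Cardinal.{u}) : Prop := s.IsFrame lam lam

/-- `s` is a semi-good non-forking `lam`-frame: basic stability is weakened to basic almost
stability. -/
def IsSemiGood (lam : Cardinal.{u}) : Prop := s.IsFrame lam (succ lam)

/-! ### Non-forking for larger models -/

/-- The relation `dnf^{≥ lam}` on models of cardinality at least `lam`. -/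
def dnfGE (lam : Cardinal.{u}) (M₀ M₁ : Model L) (a : ZFSet.{u}) (M₂ : Model L) : Prop :=
  lam ≤ M₀.card ∧ lam ≤ M₁.card ∧ lam ≤ M₂.card ∧ s.K.le M₀ M₁ ∧ a ∉ M₁.carrier ∧
  ∃ (h₁₂ : s.K.le M₁ M₂) (ha : a ∈ M₂.carrier) (N₀ : Model L),
    s.K.memCard lam N₀ ∧ s.K.le N₀ M₀ ∧
    ∀ (N : Model L) (hN : s.K.le N M₁), s.K.memCard lam N → N₀.carrier ⊆ N.carrier →
      s.NonFork N₀ (AEC.tp (s.K.trans _ _ _ hN h₁₂) a ha)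

/-- The type `p ∈ S(M₁)` does not fork over `M₀`, for models of cardinality at least `lam`. -/
def NonForkGE (lam : Cardinal.{u}) (M₀ : Model L) {M₁ : Model L} (p : s.K.GType M₁) : Prop :=
  ∃ (N : Model L) (h : s.K.le M₁ N) (a : ZFSet.{u}) (ha : a ∈ N.carrier),
    p = AEC.tp h a ha ∧ s.dnfGE lam M₀ M₁ a N

/-- The basic types over a model of cardinality greater than `lam`. -/
def SbsGT (lam : Cardinal.{u}) (M : Model L) : Set (s.K.GType M) :=
  {p | ∃ N, s.K.memCard lam N ∧ s.K.le N M ∧ s.NonForkGE lam N p}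

/-- The lifted frame `s⁺` of a frame `s` in the cardinality `lam`; `s⁺` is a frame, in the cardinality `succ lam`. -/
def plus (lam : Cardinal.{u}) : PreFrame L where
  K := s.K
  Sbs M := {p | s.K.memCard (succ lam) M ∧ p ∈ s.SbsGT lam M}
  dnf M₀ M₁ a M₃ := s.K.memCard (succ lam) M₀ ∧ s.K.memCard (succ lam) M₁ ∧
    s.K.memCard (succ lam) M₃ ∧ s.dnfGE lam M₀ M₁ a M₃

end PreFrame

end NonForking

/-!
Write `p` *does not fork over `N₀`* (`PreFrame.NonForkSmall`) when `N₀ ∈ K_lam` lies in the domain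
`M` of `p`, `M` possibly large, and every restriction of `p` to a model of `K_lam` between `N₀` and
`M` does not fork over `N₀` in the given frame. The basic types of the lifted frame are the types
that do not fork over some `N₀` (`mem_plus_Sbs_iff`), and non-forking over `M₀ ∈ K_{lam⁺}` means not
forking over some `N₀ ⪯ M₀` (`plus_nonFork_iff`). The calculus of non-forking in `K_lam`
(monotonicity, uniqueness, extension, and transitivity, which follows from the latter two) passes to
this notion, because any `lam` elements of a large model lie in a submodel from `K_lam`. Since
amalgamation and symmetry of the lifted frame are assumed, the substance is in four points.

* *Uniqueness* (`NonForkSmall.unique`). Two types over `M ∈ K_{lam⁺}` that do not fork over `N₀` and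
  agree on `N₀` agree on all small submodels, by uniqueness in `K_lam`; tameness makes them equal.
  Basic stability follows (`mk_plus_Sbs_le`): a basic type over `M` is determined by a member of a
  fixed filtration of `M` and one of at most `lam⁺` basic types over that member.

* *Extension* (`exists_nonForkSmall_extension`). Along a filtration `F` of `M` the non-forking
  extensions of a basic type over `F 0` are unique, hence coherent. A coherent sequence of types
  need not have an upper bound in general; here one is built as a direct limit: models `S i ∈
  K_lam` and embeddings of `F i` into `S i` through which one fixed element realizes the type over
  `F i`. At limit stages, continuity and uniqueness in `K_lam` identify the type realized through
  the union of the embeddings. The same construction with two filtrations gives joint embedding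
  (`jointEmbedding_succ`), and extension and density in `K_lam` give the absence of maximal models.

* *Density* (`exists_nonForkSmall_of_lt`). If every element of `N \ M` forked over every small
  submodel of `M`, then closing off `ω` times would give `P ⪯ M` and `Q ⪯ N` in `K_lam` with
  `Q ∩ M = P`, such that every element of `Q \ P` forks over every member of a chain with union `P`.
  Density and local character in `K_lam` forbid this.

* *Local character and continuity* (`plus_localCharacter`, `plus_continuity`). A small submodel `N`
  of the top `M δ` of a chain of models of `K_{lam⁺}` either lies inside some `M α`, or it is
  cofinal in the chain, and is then contained in the union of a continuous chain of models of
  `K_lam` of length below `lam⁺`, each member of which lies inside some `M α`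
  (`exists_small_chain`). In the second case the corresponding axiom in `K_lam` applies to that
  chain.

Models are sets, so an embedding is treated as a function on the universe of sets that happens to
restrict to an embedding (`Model.Emb`, `AEC.SEmb`). Compositions, unions of coherent embeddings and
extensions of embeddings to isomorphisms (`SEmb.exists_rename`) are then literal.
-/

namespace NonForking

variable {L : FirstOrder.Language.{u, u}}

/-! ### Embeddings given by functions on sets -/

namespace Model

/-- The function `φ` restricts to an embedding of the structure `M` into `N`. Since models are sets,
embeddings are handled as restrictions of functions `ZFSet → ZFSet`; this makes compositions,
extensions and unions of embeddings literal. -/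
def Emb (φ : ZFSet.{u} → ZFSet.{u}) (M N : Model L) : Prop :=
  ∃ f : M.carrier ↪[L] N.carrier, ∀ x, (f x : ZFSet.{u}) = φ x

/-- The function `φ` restricts to an isomorphism from `M` onto `N`. -/
def Iso (φ : ZFSet.{u} → ZFSet.{u}) (M N : Model L) : Prop :=
  ∃ f : M.carrier ≃[L] N.carrier, ∀ x, (f x : ZFSet.{u}) = φ x

variable {M N P : Model L} {φ ψ : ZFSet.{u} → ZFSet.{u}}

theorem Sub.emb (h : M.Sub N) : Emb id M N := h

theorem Emb.mapsTo (h : Emb φ M N) {x : ZFSet.{u}} (hx : x ∈ M.carrier) : φ x ∈ N.carrier := by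
  obtain ⟨f, hf⟩ := h
  rw [← hf ⟨x, hx⟩]
  exact (f ⟨x, hx⟩).2

theorem Emb.inj (h : Emb φ M N) {x y : ZFSet.{u}} (hx : x ∈ M.carrier) (hy : y ∈ M.carrier)
    (hxy : φ x = φ y) : x = y := by
  obtain ⟨f, hf⟩ := h
  have : f ⟨x, hx⟩ = f ⟨y, hy⟩ := Subtype.ext (by rw [hf, hf]; exact hxy)
  exact congrArg Subtype.val (f.injective this)

theorem Emb.congr (h : Emb φ M N) (hc : ∀ x ∈ M.carrier, φ x = ψ x) : Emb ψ M N := by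
  obtain ⟨f, hf⟩ := h
  exact ⟨f, fun x => (hf x).trans (hc x x.2)⟩

theorem Emb.comp (h : Emb φ M N) (h' : Emb ψ N P) : Emb (ψ ∘ φ) M P := by
  obtain ⟨f, hf⟩ := h
  obtain ⟨g, hg⟩ := h'
  exact ⟨g.comp f, fun x => by simp [hg, hf]⟩

/-- If `φ` followed by an embedding of `N` is an embedding, so is `φ`. -/
theorem Emb.cancel (h : Emb (ψ ∘ φ) M P) (h' : Emb ψ N P)
    (hm : ∀ x ∈ M.carrier, φ x ∈ N.carrier) : Emb φ M N := by
  have hinj : ∀ x ∈ M.carrier, ∀ y ∈ M.carrier, φ x = φ y → x = y := fun x hx y hy e =>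
    h.inj hx hy (congrArg ψ e)
  obtain ⟨f, hf⟩ := h
  obtain ⟨g, hg⟩ := h'
  let k : M.carrier → N.carrier := fun x => ⟨φ x, hm x x.2⟩
  have hk : ∀ x, g (k x) = f x := fun x => Subtype.ext (by rw [hg, hf]; rfl)
  have hk' : ∀ {n} (x : Fin n → M.carrier), g ∘ k ∘ x = f ∘ x := fun x => funext fun i => hk (x i)
  refine ⟨⟨⟨k, fun x y e => Subtype.ext (hinj _ x.2 _ y.2 (congrArg Subtype.val e))⟩,
    fun {n} F x => ?_, fun {n} R x => ?_⟩, fun x => rfl⟩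
  · apply g.injective
    change g (k _) = g (Language.Structure.funMap F (k ∘ x))
    rw [hk, f.map_fun, g.map_fun, hk']
  · change Language.Structure.RelMap R (k ∘ x) ↔ _
    rw [← g.map_rel, hk', f.map_rel]

theorem Sub.subset (h : M.Sub N) {x : ZFSet.{u}} (hx : x ∈ M.carrier) : x ∈ N.carrier :=
  h.emb.mapsTo hx

theorem Sub.trans (h : M.Sub N) (h' : N.Sub P) : M.Sub P := h.emb.comp h'.emb

theorem Sub.of_subset (h : M.Sub P) (h' : N.Sub P) (hs : ∀ x ∈ M.carrier, x ∈ N.carrier) :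
    M.Sub N := Emb.cancel (ψ := id) h.emb h'.emb hs

/-- Two structures on the same type are equal if the identity is an embedding between them. -/
theorem structure_eq_of_embedding {c : Type*} (s t : L.Structure c)
    (f : @Language.Embedding L c c s t)
    (hid : ∀ x, @Language.Embedding.toEmbedding L c c s t f x = x) : s = t := by
  have hid' : ∀ {n} (x : Fin n → c), @Language.Embedding.toEmbedding L c c s t f ∘ x = x :=
    fun x => funext fun i => hid _
  refine Language.Structure.ext ?_ ?_
  · funext n F x
    have := @Language.Embedding.map_fun' L c c s t f n F x
    exact (hid _).symm.trans (this.trans (congrArg _ (hid' x)))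
  · funext n R x
    have := @Language.Embedding.map_rel' L c c s t f n R x
    exact propext (this.symm.trans (iff_of_eq (congrArg _ (hid' x))))

/-- A substructure is determined by its underlying set. -/
theorem Sub.antisymm (h : M.Sub N) (hs : ∀ x ∈ N.carrier, x ∈ M.carrier) : M = N := by
  have hc : M.carrier = N.carrier := ZFSet.ext fun x => ⟨h.subset, hs x⟩
  obtain ⟨c, sM⟩ := M
  obtain ⟨d, sN⟩ := N
  dsimp only at hc
  subst hc
  obtain ⟨f, hf⟩ := h
  congr 1
  exact structure_eq_of_embedding _ _ f fun x => Subtype.ext (hf x)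

theorem Iso.emb (h : Iso φ M N) : Emb φ M N := by
  obtain ⟨f, hf⟩ := h
  exact ⟨f.toEmbedding, hf⟩

theorem Iso.surj (h : Iso φ M N) {y : ZFSet.{u}} (hy : y ∈ N.carrier) :
    ∃ x ∈ M.carrier, φ x = y := by
  obtain ⟨f, hf⟩ := h
  obtain ⟨x, hx⟩ := f.surjective ⟨y, hy⟩
  exact ⟨x, x.2, by rw [← hf, hx]⟩

theorem Emb.iso (h : Emb φ M N) (hs : ∀ y ∈ N.carrier, ∃ x ∈ M.carrier, φ x = y) : Iso φ M N := by
  obtain ⟨f, hf⟩ := h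
  have hb : Function.Bijective f := ⟨f.injective, fun y => by
    obtain ⟨x, hx, e⟩ := hs y y.2
    exact ⟨⟨x, hx⟩, Subtype.ext ((hf _).trans e)⟩⟩
  exact ⟨⟨Equiv.ofBijective f hb, fun F x => f.map_fun F x, fun R x => f.map_rel R x⟩, hf⟩

theorem Iso.congr (h : Iso φ M N) (hc : ∀ x ∈ M.carrier, φ x = ψ x) : Iso ψ M N := by
  obtain ⟨f, hf⟩ := h
  exact ⟨f, fun x => (hf x).trans (hc x x.2)⟩

theorem Iso.comp (h : Iso φ M N) (h' : Iso ψ N P) : Iso (ψ ∘ φ) M P := by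
  obtain ⟨f, hf⟩ := h
  obtain ⟨g, hg⟩ := h'
  exact ⟨g.comp f, fun x => by simp [hg, hf]⟩

theorem Iso.refl (M : Model L) : Iso id M M := ⟨Language.Equiv.refl L _, fun _ => rfl⟩

/-- The inverse of an isomorphism, again as a function on all sets. -/
theorem Iso.symm (h : Iso φ M N) : ∃ ψ, Iso ψ N M ∧ (∀ x ∈ M.carrier, ψ (φ x) = x) ∧
    ∀ y ∈ N.carrier, φ (ψ y) = y := by
  classical
  obtain ⟨f, hf⟩ := h
  let ψ : ZFSet.{u} → ZFSet.{u} := fun y => if hy : y ∈ N.carrier then f.symm ⟨y, hy⟩ else y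
  have hψ : ∀ y : N.carrier, ψ y = f.symm y := fun y => dif_pos y.2
  refine ⟨ψ, ⟨f.symm, fun y => (hψ y).symm⟩, fun x hx => ?_, fun y hy => ?_⟩
  · rw [← hf ⟨x, hx⟩, hψ, Language.Equiv.symm_apply_apply]
  · rw [hψ ⟨y, hy⟩, ← hf, Language.Equiv.apply_symm_apply]

theorem Iso.card_eq (h : Iso φ M N) : M.card = N.card := by
  obtain ⟨f, -⟩ := h
  apply Cardinal.lift_injective.{u + 1}
  unfold Model.card
  rw [← ZFSet.cardinalMk_coe_sort, ← ZFSet.cardinalMk_coe_sort]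
  exact Cardinal.mk_congr f.toEquiv

theorem Emb.card_le (h : Emb φ M N) : M.card ≤ N.card := by
  obtain ⟨f, -⟩ := h
  rw [← Cardinal.lift_le.{u + 1}]
  unfold Model.card
  rw [← ZFSet.cardinalMk_coe_sort, ← ZFSet.cardinalMk_coe_sort]
  exact Cardinal.mk_le_of_injective f.injective

/-- Every function that is injective on `M` carries the structure of `M` over to its image. -/
theorem exists_iso (M : Model L) (φ : ZFSet.{u} → ZFSet.{u})
    (h : ∀ x ∈ M.carrier, ∀ y ∈ M.carrier, φ x = φ y → x = y) : ∃ N : Model L, Iso φ M N := by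
  let g : M.carrier → ZFSet.{u} := fun x => φ x
  let c : ZFSet.{u} := ZFSet.range g
  let k : M.carrier → c := fun x => ⟨φ x, ZFSet.mem_range.2 ⟨x, rfl⟩⟩
  have hk : Function.Bijective k := by
    refine ⟨fun x y e => Subtype.ext (h _ x.2 _ y.2 (congrArg Subtype.val e)), fun y => ?_⟩
    obtain ⟨x, hx⟩ := ZFSet.mem_range.1 y.2
    exact ⟨x, Subtype.ext hx⟩
  let _ := Equiv.inducedStructure (L := L) (Equiv.ofBijective k hk)
  exact ⟨⟨c⟩, Equiv.inducedStructureEquiv (Equiv.ofBijective k hk), fun x => rfl⟩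

/-- The image of a substructure under an isomorphism. -/
theorem Iso.exists_image (h : Iso φ N P) (hs : M.Sub N) : ∃ M', Iso φ M M' ∧ M'.Sub P := by
  obtain ⟨M', hM'⟩ := exists_iso M φ fun x hx y hy e => h.emb.inj (hs.subset hx) (hs.subset hy) e
  refine ⟨M', hM', ?_⟩
  obtain ⟨ψ, hψ, h1, h2⟩ := hM'.symm
  exact ((hψ.emb.comp hs.emb).comp h.emb).congr fun x hx => h2 x hx

theorem Iso.exists_preimage (h : Iso φ N P) (hs : M.Sub P) :
    ∃ M', Iso φ M' M ∧ M'.Sub N := by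
  obtain ⟨ψ, hψ, h1, h2⟩ := h.symm
  obtain ⟨M', hM', hs'⟩ := hψ.exists_image hs
  obtain ⟨χ, hχ, h3, h4⟩ := hM'.symm
  refine ⟨M', hχ.congr fun x hx => ?_, hs'⟩
  obtain ⟨y, hy, rfl⟩ := hM'.surj hx
  rw [h3 y hy, h2 y (hs.subset hy)]

theorem Iso.isImage {M' N' : Model L} {f : N.carrier ≃[L] N'.carrier}
    (hf : ∀ x, (f x : ZFSet.{u}) = φ x) (hM : Iso φ M M') (hs : M.Sub N) (hs' : M'.Sub N') :
    IsImage f M M' := by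
  refine ⟨hs', fun y => ⟨fun hy => ?_, ?_⟩⟩
  · obtain ⟨x, hx, e⟩ := hM.surj hy
    exact ⟨⟨x, hs.subset hx⟩, hx, Subtype.ext ((hf _).trans e)⟩
  · rintro ⟨x, hx, rfl⟩
    rw [hf]
    exact hM.emb.mapsTo hx

theorem iso_of_isImage {M' N' : Model L} {f : N.carrier ≃[L] N'.carrier}
    (hf : ∀ x, (f x : ZFSet.{u}) = φ x) (hs : M.Sub N) (h : IsImage f M M') : Iso φ M M' := by
  have hN : Iso φ N N' := ⟨f, hf⟩
  refine Emb.iso (Emb.cancel (ψ := id) (hs.emb.comp hN.emb) h.1.emb fun x hx => ?_) fun y hy => ?_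
  · have := (h.2 (f ⟨x, hs.subset hx⟩)).2 ⟨_, hx, rfl⟩
    rwa [hf] at this
  · obtain ⟨x, hx, e⟩ := (h.2 ⟨y, h.1.subset hy⟩).1 hy
    exact ⟨x, hx, by rw [← hf, e]⟩

end Model

open Model

namespace AEC

variable {K : AEC L} {M N P M₀ M₁ : Model L} {φ ψ : ZFSet.{u} → ZFSet.{u}}

theorem le.sub (h : K.le M N) : M.Sub N := K.sub_of_le _ _ h

theorem le.mem_left (h : K.le M N) : K.mem M := (K.mem_of_le _ _ h).1

theorem le.mem_right (h : K.le M N) : K.mem N := (K.mem_of_le _ _ h).2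

theorem le.of_subset (h : K.le M P) (h' : K.le N P) (hs : ∀ x ∈ M.carrier, x ∈ N.carrier) :
    K.le M N :=
  K.coherent _ _ _ (Sub.of_subset h.sub h'.sub hs) h h'

theorem mem_of_iso (h : Iso φ M N) (hM : K.mem M) : K.mem N :=
  K.mem_iso _ _ hM ⟨h.choose⟩

theorem memCard_of_iso {μ : Cardinal.{u}} (h : Iso φ M N) (hM : K.memCard μ M) : K.memCard μ N :=
  ⟨mem_of_iso h hM.1, h.card_eq ▸ hM.2⟩

theorem le_of_iso {M' N' : Model L} (hN : Iso φ N N') (hM : Iso φ M M') (hs : M'.Sub N')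
    (h : K.le M N) : K.le M' N' := by
  obtain ⟨f, hf⟩ := hN
  exact K.le_iso _ _ _ _ f h (Iso.isImage hf hM h.sub hs)

/-- The function `φ` restricts to an embedding of `M` into `N` in the sense of the class. -/
def SEmb (K : AEC L) (φ : ZFSet.{u} → ZFSet.{u}) (M N : Model L) : Prop :=
  ∃ M', K.le M' N ∧ Iso φ M M'

theorem SEmb.emb (h : K.SEmb φ M N) : Emb φ M N := by
  obtain ⟨M', h, hi⟩ := h
  exact hi.emb.comp h.sub.emb

theorem SEmb.mem_right (h : K.SEmb φ M N) : K.mem N := by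
  obtain ⟨M', h, hi⟩ := h
  exact h.mem_right

theorem SEmb.congr (h : K.SEmb φ M N) (hc : ∀ x ∈ M.carrier, φ x = ψ x) : K.SEmb ψ M N := by
  obtain ⟨M', h, hi⟩ := h
  exact ⟨M', h, hi.congr hc⟩

theorem le.sEmb (h : K.le M N) : K.SEmb id M N := ⟨M, h, Iso.refl M⟩

theorem sEmb_of_iso (h : Iso φ M N) (hM : K.mem M) : K.SEmb φ M N :=
  ⟨N, K.refl _ (mem_of_iso h hM), h⟩

theorem SEmb.comp (h : K.SEmb φ M N) (h' : K.SEmb ψ N P) : K.SEmb (ψ ∘ φ) M P := by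
  obtain ⟨M', h, hi⟩ := h
  obtain ⟨N', h', hi'⟩ := h'
  obtain ⟨M'', hi'', hs⟩ := hi'.exists_image h.sub
  exact ⟨M'', K.trans _ _ _ (le_of_iso hi' hi'' hs h) h', hi.comp hi''⟩

theorem SEmb.of_le (h : K.SEmb φ N P) (hM : K.le M N) : K.SEmb φ M P :=
  hM.sEmb.comp h

theorem SEmb.trans_le (h : K.SEmb φ M N) (hN : K.le N P) : K.SEmb φ M P :=
  h.comp hN.sEmb

theorem le_of_sEmb_id (h : K.SEmb id M N) : K.le M N := by
  obtain ⟨M', h, hi⟩ := h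
  have : M = M' := Sub.antisymm hi.emb fun x hx => by
    obtain ⟨y, hy, rfl⟩ := hi.surj hx
    exact hy
  rwa [this]

theorem isStrong_iff {f : M.carrier ↪[L] N.carrier} (hf : ∀ x, (f x : ZFSet.{u}) = φ x) :
    K.IsStrong f ↔ K.SEmb φ M N := by
  constructor
  · rintro ⟨M', h, hM'⟩
    refine ⟨M', h, Emb.iso (Emb.cancel (ψ := id) ⟨f, hf⟩ h.sub.emb fun x hx => ?_) fun y hy => ?_⟩
    · have := (hM' (f ⟨x, hx⟩)).2 ⟨_, rfl⟩
      rwa [hf] at this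
    · obtain ⟨x, hx⟩ := (hM' ⟨y, h.sub.subset hy⟩).1 hy
      exact ⟨x, x.2, by rw [← hf, hx]⟩
  · rintro ⟨M', h, hi⟩
    refine ⟨M', h, fun y => ⟨fun hy => ?_, ?_⟩⟩
    · obtain ⟨x, hx, e⟩ := hi.surj hy
      exact ⟨⟨x, hx⟩, Subtype.ext ((hf _).trans e)⟩
    · rintro ⟨x, rfl⟩
      rw [hf]
      exact hi.emb.mapsTo x.2

theorem SEmb.exists_isStrong (h : K.SEmb φ M N) :
    ∃ f : M.carrier ↪[L] N.carrier, K.IsStrong f ∧ ∀ x, (f x : ZFSet.{u}) = φ x := by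
  obtain ⟨f, hf⟩ := h.emb
  exact ⟨f, (isStrong_iff hf).2 h, hf⟩

/-- An embedding of structures as the restriction of a function on sets. -/
theorem exists_fun (f : M.carrier ↪[L] N.carrier) :
    ∃ φ : ZFSet.{u} → ZFSet.{u}, ∀ x, (f x : ZFSet.{u}) = φ x := by
  classical
  refine ⟨fun x => if hx : x ∈ M.carrier then f ⟨x, hx⟩ else x, fun x => ?_⟩
  simp

/-- Renaming: an embedding of `M` into `N` extends to an isomorphism from some `N' ⪰ M` onto `N`,
with inverse `k`. The elements of `N` outside the range are replaced by pairs that cannot lie in `M`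
for reasons of rank. -/
theorem SEmb.exists_rename (h : K.SEmb φ M N) : ∃ (N' : Model L) (g k : ZFSet.{u} → ZFSet.{u}),
    K.le M N' ∧ Iso g N' N ∧ Iso k N N' ∧ (∀ x ∈ M.carrier, g x = φ x) ∧
    (∀ x ∈ M.carrier, k (φ x) = x) ∧ (∀ x ∈ N'.carrier, k (g x) = x) ∧
    ∀ y ∈ N.carrier, g (k y) = y := by
  classical
  have hE := h.emb
  obtain ⟨M', hle, hi⟩ := h
  obtain ⟨ψ, hψ, h1, h2⟩ := hi.symm
  let k : ZFSet.{u} → ZFSet.{u} := fun y =>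
    if y ∈ M'.carrier then ψ y else ZFSet.pair M.carrier y
  -- `{M.carrier}` is an element of the Kuratowski pair, so the pair has larger rank than
  -- `M.carrier`
  have hpair : ∀ y, ZFSet.pair M.carrier y ∉ M.carrier := fun y hy => by
    have h1 := ZFSet.rank_lt_of_mem hy
    have h2 : M.carrier ∈ ({M.carrier} : ZFSet.{u}) := by simp
    have h3 : ({M.carrier} : ZFSet.{u}) ∈ ZFSet.pair M.carrier y := by simp [ZFSet.pair]
    exact lt_irrefl _ (((ZFSet.rank_lt_of_mem h2).trans (ZFSet.rank_lt_of_mem h3)).trans h1)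
  have hk : ∀ x ∈ M.carrier, k (φ x) = x := fun x hx => by
    change ite _ _ _ = _
    rw [if_pos (hi.emb.mapsTo hx), h1 x hx]
  have hinj : ∀ x ∈ N.carrier, ∀ y ∈ N.carrier, k x = k y → x = y := by
    intro x _ y _ e
    by_cases hx : x ∈ M'.carrier <;> by_cases hy : y ∈ M'.carrier <;>
      simp only [k, hx, hy, if_true, if_false] at e
    · exact hψ.emb.inj hx hy e
    · exact absurd (e ▸ hψ.emb.mapsTo hx) (hpair y)
    · exact absurd (e ▸ hψ.emb.mapsTo hy) (hpair x)
    · exact (ZFSet.pair_inj.1 e).2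
  obtain ⟨N', hN'⟩ := exists_iso N k hinj
  obtain ⟨g, hg, hgk, hkg⟩ := hN'.symm
  refine ⟨N', g, k, ?_, hg, hN', fun x hx => ?_, hk, hkg, hgk⟩
  · exact le_of_sEmb_id (SEmb.congr
      (SEmb.comp ⟨M', hle, hi⟩ (sEmb_of_iso hN' hle.mem_right)) hk)
  · have := hgk _ (hE.mapsTo hx)
    rwa [hk x hx] at this

end AEC

/-! ### Unions of chains of models -/

/-- Finitely many elements of the union of an increasing family of sets lie in one member. -/
theorem exists_lt_forall_mem {δ : Ordinal.{u}} (hδ : 0 < δ) {S : Ordinal.{u} → ZFSet.{u}}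
    (hS : ∀ α β, α ≤ β → β < δ → ∀ x ∈ S α, x ∈ S β) {n : ℕ} (x : Fin n → ZFSet.{u})
    (hx : ∀ k, ∃ α < δ, x k ∈ S α) : ∃ α < δ, ∀ k, x k ∈ S α := by
  choose a ha hxa using hx
  have hlt : Finset.univ.sup a < δ := (Finset.sup_lt_iff hδ).2 fun k _ => ha k
  exact ⟨_, hlt, fun k => hS _ _ (Finset.le_sup (Finset.mem_univ k)) hlt _ (hxa k)⟩

theorem Model.Sub.funMap_eq {M N : Model L} (h : M.Sub N) {n : ℕ} (F : L.Functions n)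
    (x : Fin n → M.carrier) (y : Fin n → N.carrier) (hxy : ∀ k, (x k : ZFSet.{u}) = y k) :
    ((Language.Structure.funMap F x : M.carrier) : ZFSet.{u}) =
      (Language.Structure.funMap F y : N.carrier) := by
  obtain ⟨f, hf⟩ := h
  have : f ∘ x = y := funext fun k => Subtype.ext ((hf _).trans (hxy k))
  rw [← hf, f.map_fun, this]

theorem Model.Sub.relMap_iff {M N : Model L} (h : M.Sub N) {n : ℕ} (R : L.Relations n)
    (x : Fin n → M.carrier) (y : Fin n → N.carrier) (hxy : ∀ k, (x k : ZFSet.{u}) = y k) :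
    Language.Structure.RelMap R x ↔ Language.Structure.RelMap R y := by
  obtain ⟨f, hf⟩ := h
  have : f ∘ x = y := funext fun k => Subtype.ext ((hf _).trans (hxy k))
  rw [← this, f.map_rel]

/-- The union of an increasing chain of structures exists as a structure: functions and relations
are evaluated in any member of the chain that contains the arguments. -/
theorem exists_isUnion {δ : Ordinal.{u}} (hδ : 0 < δ) (M : Ordinal.{u} → Model L)
    (hM : ∀ α β, α ≤ β → β < δ → (M α).Sub (M β)) : ∃ N, IsUnion M δ N := by
  let c : ZFSet.{u} := ZFSet.iUnion fun α : Set.Iio δ => (M α).carrier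
  have hc : ∀ x, x ∈ c ↔ ∃ α < δ, x ∈ (M α).carrier := fun x =>
    ZFSet.mem_iUnion.trans ⟨fun ⟨α, h⟩ => ⟨α, α.2, h⟩, fun ⟨α, h, hx⟩ => ⟨⟨α, h⟩, hx⟩⟩
  have hex : ∀ {n : ℕ} (x : Fin n → c), ∃ α < δ, ∀ k, (x k : ZFSet.{u}) ∈ (M α).carrier := fun x =>
    exists_lt_forall_mem hδ (fun α β h h' _ hx => (hM α β h h').subset hx) _
      fun k => (hc _).1 (x k).2
  choose a ha hxa using @hex
  let str : L.Structure c :=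
    { funMap := fun F x => ⟨(Language.Structure.funMap F fun k =>
          (⟨x k, hxa x k⟩ : (M (a x)).carrier) : (M (a x)).carrier),
          (hc _).2 ⟨_, ha x, Subtype.coe_prop _⟩⟩
      RelMap := fun R x => Language.Structure.RelMap R fun k =>
          (⟨x k, hxa x k⟩ : (M (a x)).carrier) }
  refine ⟨⟨c⟩, fun α hα => ?_, fun x hx => (hc x).1 hx⟩
  refine ⟨⟨⟨fun x => ⟨x, (hc _).2 ⟨α, hα, x.2⟩⟩, fun x y e =>
    Subtype.ext (Subtype.mk.inj e)⟩, fun {n} F x => ?_, fun {n} R x => ?_⟩, fun x => rfl⟩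
  · let y : Fin n → c := fun k => ⟨x k, (hc _).2 ⟨α, hα, (x k).2⟩⟩
    have hm : max α (a y) < δ := max_lt hα (ha y)
    have s1 := hM _ _ (le_max_left α (a y)) hm
    have s2 := hM _ _ (le_max_right α (a y)) hm
    refine Subtype.ext ?_
    exact (s1.funMap_eq F x (fun k => ⟨x k, s1.subset (x k).2⟩) fun k => rfl).trans
      (s2.funMap_eq F (fun k => ⟨y k, hxa y k⟩) _ fun k => rfl).symm
  · let y : Fin n → c := fun k => ⟨x k, (hc _).2 ⟨α, hα, (x k).2⟩⟩
    have hm : max α (a y) < δ := max_lt hα (ha y)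
    have s1 := hM _ _ (le_max_left α (a y)) hm
    have s2 := hM _ _ (le_max_right α (a y)) hm
    exact ((s1.relMap_iff R x (fun k => ⟨x k, s1.subset (x k).2⟩) fun k => rfl).trans
      (s2.relMap_iff R (fun k => ⟨y k, hxa y k⟩) _ fun k => rfl).symm).symm

theorem Model.Emb.union {δ : Ordinal.{u}} (hδ : 0 < δ) {P : Ordinal.{u} → Model L}
    {P' N : Model L} {φ : ZFSet.{u} → ZFSet.{u}}
    (hP : ∀ α β, α ≤ β → β < δ → (P α).Sub (P β)) (hP' : IsUnion P δ P')
    (h : ∀ α < δ, Emb φ (P α) N) : Emb φ P' N := by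
  have hex : ∀ {n : ℕ} (x : Fin n → P'.carrier), ∃ α < δ, ∀ k, (x k : ZFSet.{u}) ∈ (P α).carrier :=
    fun x => exists_lt_forall_mem hδ (fun α β h h' _ hx => (hP α β h h').subset hx) _
      fun k => hP'.2 _ (x k).2
  have hmaps : ∀ x ∈ P'.carrier, φ x ∈ N.carrier := fun x hx => by
    obtain ⟨α, hα, hx⟩ := hP'.2 x hx
    exact (h α hα).mapsTo hx
  let f : P'.carrier → N.carrier := fun x => ⟨φ x, hmaps x x.2⟩
  have hf : Function.Injective f := fun x y e => by
    obtain ⟨α, hα, hm⟩ := hex ![x, y]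
    exact Subtype.ext ((h α hα).inj (hm 0) (hm 1) (congrArg Subtype.val e))
  refine ⟨⟨⟨f, hf⟩, fun {n} F x => ?_, fun {n} R x => ?_⟩, fun x => rfl⟩
  · obtain ⟨α, hα, hm⟩ := hex x
    obtain ⟨g, hg⟩ := h α hα
    have e := (hP'.1 α hα).funMap_eq F (fun k => ⟨x k, hm k⟩) x fun k => rfl
    have e2 := g.map_fun F (fun k => ⟨x k, hm k⟩)
    refine Subtype.ext ?_
    change φ _ = _
    rw [← e, ← hg, e2]
    congr 2
    exact funext fun k => Subtype.ext (hg _)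
  · obtain ⟨α, hα, hm⟩ := hex x
    obtain ⟨g, hg⟩ := h α hα
    rw [← (hP'.1 α hα).relMap_iff R (fun k => ⟨x k, hm k⟩) x fun k => rfl, ← g.map_rel]
    apply iff_of_eq
    congr 1
    exact funext fun k => Subtype.ext (hg ⟨x k, hm k⟩).symm

theorem IsUnion.congr {M M' : Ordinal.{u} → Model L} {δ : Ordinal.{u}} {N : Model L}
    (h : IsUnion M δ N) (hM : ∀ i < δ, M i = M' i) : IsUnion M' δ N := by
  refine ⟨fun i hi => hM i hi ▸ h.1 i hi, fun x hx => ?_⟩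
  obtain ⟨i, hi, hx⟩ := h.2 x hx
  exact ⟨i, hi, hM i hi ▸ hx⟩

theorem IncreasingContinuous.mono {le : Model L → Model L → Prop} {M : Ordinal.{u} → Model L}
    {θ θ' : Ordinal.{u}} (h : IncreasingContinuous le M θ) (hθ : θ' ≤ θ) :
    IncreasingContinuous le M θ' :=
  ⟨fun α β h1 h2 => h.1 α β h1 (h2.trans_le hθ), fun γ h1 h2 => h.2 γ (h1.trans_le hθ) h2⟩

namespace AEC

variable {K : AEC L}

/-- The union of embeddings between the members of two continuous chains is an embedding between the
unions of the chains. The images of the members form a chain, to which smoothness applies. -/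
theorem SEmb.union {δ : Ordinal.{u}} (hδ : IsSuccLimit δ) {P N : Ordinal.{u} → Model L}
    {P' N' : Model L} {φ : ZFSet.{u} → ZFSet.{u}}
    (hP : IncreasingContinuous K.le P δ) (hP' : IsUnion P δ P')
    (hN : IncreasingContinuous K.le N δ) (hN' : IsUnion N δ N')
    (h : ∀ α < δ, K.SEmb φ (P α) (N α)) : K.SEmb φ P' N' := by
  have hpos : 0 < δ := hδ.bot_lt
  have h' : ∀ α < δ, K.SEmb φ (P α) N' := fun α hα =>
    (h α hα).trans_le (K.le_union δ N N' hδ hN hN' α hα)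
  have hE : Emb φ P' N' := Emb.union hpos (fun α β h1 h2 => (hP.1 α β h1 h2).sub) hP'
    fun α hα => (h' α hα).emb
  have : Nonempty (Model L) := ⟨P'⟩
  choose! Q hQle hQ using h'
  obtain ⟨P'', hP''⟩ := exists_iso P' φ fun x hx y hy e => hE.inj hx hy e
  have hsub : P''.Sub N' := by
    obtain ⟨ψ, hψ, h1, h2⟩ := hP''.symm
    exact (hψ.emb.comp hE).congr fun x hx => h2 x hx
  refine ⟨P'', ?_, hP''⟩
  refine K.smooth δ Q P'' N' hδ ⟨fun α β h1 h2 => ?_, fun γ h1 h2 => ⟨fun α hα => ?_, ?_⟩⟩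
    ⟨fun α hα => ?_, ?_⟩ hQle
  · refine le.of_subset (hQle α (h1.trans_lt h2)) (hQle β h2) fun y hy => ?_
    obtain ⟨x, hx, rfl⟩ := (hQ α (h1.trans_lt h2)).surj hy
    exact (hQ β h2).emb.mapsTo ((hP.1 α β h1 h2).sub.subset hx)
  · refine (hQle α (hα.trans h1)).sub.of_subset (hQle γ h1).sub fun y hy => ?_
    obtain ⟨x, hx, rfl⟩ := (hQ α (hα.trans h1)).surj hy
    exact (hQ γ h1).emb.mapsTo ((hP.1 α γ hα.le h1).sub.subset hx)
  · intro y hy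
    obtain ⟨x, hx, rfl⟩ := (hQ γ h1).surj hy
    obtain ⟨α, hα, hx⟩ := (hP.2 γ h1 h2).2 x hx
    exact ⟨α, hα, (hQ α (hα.trans h1)).emb.mapsTo hx⟩
  · refine (hQle α hα).sub.of_subset hsub fun y hy => ?_
    obtain ⟨x, hx, rfl⟩ := (hQ α hα).surj hy
    exact hP''.emb.mapsTo ((hP'.1 α hα).subset hx)
  · intro y hy
    obtain ⟨x, hx, rfl⟩ := hP''.surj hy
    obtain ⟨α, hα, hx⟩ := hP'.2 x hx
    exact ⟨α, hα, (hQ α hα).emb.mapsTo hx⟩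

end AEC

/-! ### Transfinite constructions of chains -/

/-- A sequence `S` of length `δ` of states: the state `S i` is admissible for stage `i`, later
states extend earlier ones (`R i s t`: the state `t` extends the stage-`i` state `s`), and states
at limit stages are limits of the preceding ones (`Lim γ S t`: the state `t` is a limit of the
sequence `S` restricted to `γ`). -/
structure IsChain {σ : Type*} (Good : Ordinal.{u} → σ → Prop) (R : Ordinal.{u} → σ → σ → Prop)
    (Lim : Ordinal.{u} → (Ordinal.{u} → σ) → σ → Prop) (S : Ordinal.{u} → σ) (δ : Ordinal.{u}) :
    Prop where
  good : ∀ i < δ, Good i (S i)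
  rel : ∀ i j, i ≤ j → j < δ → R i (S i) (S j)
  lim : ∀ γ < δ, IsSuccLimit γ → Lim γ S (S γ)

/-- Construction of chains of states by transfinite recursion. Unlike plain recursion, it allows the
existence of an admissible state at a limit stage to be proved from the fact that the preceding
states form a chain. -/
theorem exists_isChain {σ : Type*} (Good : Ordinal.{u} → σ → Prop)
    (R : Ordinal.{u} → σ → σ → Prop) (Lim : Ordinal.{u} → (Ordinal.{u} → σ) → σ → Prop)
    (θ : Ordinal.{u}) (hrefl : ∀ i s, Good i s → R i s s)
    (htrans : ∀ i j s t w, i ≤ j → j < θ → R i s t → R j t w → R i s w)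
    (hcongr : ∀ δ S S' t, (∀ i < δ, S i = S' i) → Lim δ S t → Lim δ S' t)
    (hzero : ∃ s, Good 0 s)
    (hsucc : ∀ i s, i + 1 < θ → Good i s → ∃ t, Good (i + 1) t ∧ R i s t)
    (hlim : ∀ δ S, δ < θ → IsSuccLimit δ → IsChain Good R Lim S δ →
      ∃ t, Good δ t ∧ Lim δ S t ∧ ∀ i < δ, R i (S i) t) :
    ∃ S, IsChain Good R Lim S θ := by
  classical
  obtain ⟨s₀, hs₀⟩ := hzero
  have : Nonempty σ := ⟨s₀⟩
  let Next : Ordinal.{u} → (Ordinal.{u} → σ) → σ → Prop := fun i S t =>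
    Good i t ∧ (∀ j < i, R j (S j) t) ∧ (IsSuccLimit i → Lim i S t)
  -- choose each state according to the sequence of the preceding ones, padded by `s₀`
  let pad : ∀ i : Ordinal.{u}, (∀ j, j < i → σ) → Ordinal.{u} → σ := fun i f j =>
    if h : j < i then f j h else s₀
  let S : Ordinal.{u} → σ := WellFounded.fix (r := (· < ·)) Ordinal.lt_wf
    fun i f => Classical.epsilon (Next i (pad i f))
  have hS : ∀ i, S i = Classical.epsilon (Next i (pad i fun j _ => S j)) := fun i =>
    WellFounded.fix_eq (r := (· < ·)) Ordinal.lt_wf _ i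
  have hpad : ∀ i, ∀ j < i, pad i (fun j _ => S j) j = S j := fun i j h => dif_pos h
  have hNext : ∀ i t, Next i (pad i fun j _ => S j) t ↔ Next i S t := fun i t => by
    refine ⟨fun ⟨h1, h2, h3⟩ => ⟨h1, fun j hj => ?_, fun hi => ?_⟩,
      fun ⟨h1, h2, h3⟩ => ⟨h1, fun j hj => ?_, fun hi => ?_⟩⟩
    · rw [← hpad i j hj]
      exact h2 j hj
    · exact hcongr _ _ _ _ (hpad i) (h3 hi)
    · rw [hpad i j hj]
      exact h2 j hj
    · exact hcongr _ _ _ _ (fun j hj => (hpad i j hj).symm) (h3 hi)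
  have key : ∀ i, i < θ → Next i S (S i) := by
    intro i
    induction i using WellFoundedLT.induction with
    | ind i ih =>
      intro hi
      rw [← hNext, hS]
      apply Classical.epsilon_spec (p := Next i (pad i fun j _ => S j))
      simp only [hNext]
      have ih' : ∀ j < i, Next j S (S j) := fun j hj => ih j hj (hj.trans hi)
      rcases Ordinal.zero_or_succ_or_isSuccLimit i with rfl | ⟨j, rfl⟩ | hl
      · exact ⟨s₀, hs₀, fun j hj => absurd hj (not_lt_bot), fun h => absurd h not_isSuccLimit_bot⟩
      · have hj : j < j + 1 := lt_add_one j
        obtain ⟨t, ht, hR⟩ := hsucc j (S j) hi (ih' j hj).1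
        refine ⟨t, ht, fun k hk => ?_, fun h => absurd h (Order.not_isSuccLimit_succ j)⟩
        rcases (Order.lt_add_one_iff.1 hk).lt_or_eq with hk | rfl
        · exact htrans _ _ _ _ _ hk.le (hj.trans hi) ((ih' j hj).2.1 k hk) hR
        · exact hR
      · have hch : IsChain Good R Lim S i := by
          refine ⟨fun j hj => (ih' j hj).1, fun j k hjk hk => ?_, fun γ hγ hl => (ih' γ hγ).2.2 hl⟩
          rcases hjk.lt_or_eq with hjk | rfl
          · exact (ih' k hk).2.1 j hjk
          · exact hrefl _ _ (ih' j hk).1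
        obtain ⟨t, h1, h2, h3⟩ := hlim i S hi hl hch
        exact ⟨t, h1, h3, fun _ => h2⟩
  refine ⟨S, fun i hi => (key i hi).1, fun i j hij hj => ?_, fun γ hγ hl => (key γ hγ).2.2 hl⟩
  rcases hij.lt_or_eq with hij | rfl
  · exact (key j hj).2.1 i hij
  · exact hrefl _ _ (key i hj).1

/-! ### Cardinalities -/

/-- The set `A` of sets has at most `κ` elements. -/
def CardLE (κ : Cardinal.{u}) (A : Set ZFSet.{u}) : Prop := #A ≤ Cardinal.lift.{u + 1} κ

theorem cardLE_coe {κ : Cardinal.{u}} {A : ZFSet.{u}} :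
    CardLE κ {x | x ∈ A} ↔ A.card ≤ κ := by
  unfold CardLE
  rw [← Cardinal.lift_le.{u + 1} (a := A.card), ← ZFSet.cardinalMk_coe_sort]
  rfl

theorem cardLE_carrier {κ : Cardinal.{u}} {M : Model L} :
    CardLE κ {x | x ∈ M.carrier} ↔ M.card ≤ κ := cardLE_coe

theorem CardLE.mono {κ : Cardinal.{u}} {A B : Set ZFSet.{u}} (h : CardLE κ B) (hAB : A ⊆ B) :
    CardLE κ A := (Cardinal.mk_le_mk_of_subset hAB).trans h

theorem CardLE.union {κ : Cardinal.{u}} (hκ : ℵ₀ ≤ κ) {A B : Set ZFSet.{u}} (hA : CardLE κ A)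
    (hB : CardLE κ B) : CardLE κ (A ∪ B) :=
  (Cardinal.mk_union_le A B).trans (Cardinal.add_le_of_le (by simpa using hκ) hA hB)

theorem CardLE.insert {κ : Cardinal.{u}} (hκ : ℵ₀ ≤ κ) {A : Set ZFSet.{u}} (hA : CardLE κ A)
    (a : ZFSet.{u}) : CardLE κ (insert a A) := by
  refine Cardinal.mk_insert_le.trans (Cardinal.add_le_of_le (by simpa using hκ) hA ?_)
  exact Cardinal.one_le_aleph0.trans (by simpa using hκ)

theorem CardLE.iUnion {κ : Cardinal.{u}} (hκ : ℵ₀ ≤ κ) {ι : Type (u + 1)}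
    (hι : #ι ≤ Cardinal.lift.{u + 1} κ) {A : ι → Set ZFSet.{u}} (hA : ∀ i, CardLE κ (A i)) :
    CardLE κ (⋃ i, A i) := by
  refine (Cardinal.mk_iUnion_le A).trans ?_
  exact Cardinal.mul_le_of_le (by simpa using hκ) hι (ciSup_le' hA)

theorem mk_Iio_le {κ : Cardinal.{u}} {δ : Ordinal.{u}} (hδ : δ < (succ κ).ord) :
    #(Set.Iio δ) ≤ Cardinal.lift.{u + 1} κ := by
  rw [Cardinal.mk_Iio_ordinal, Cardinal.lift_le]
  exact Cardinal.card_le_iff.2 hδ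

theorem IsUnion.card_le {κ : Cardinal.{u}} (hκ : ℵ₀ ≤ κ) {δ : Ordinal.{u}}
    (hδ : #(Set.Iio δ) ≤ Cardinal.lift.{u + 1} κ)
    {M : Ordinal.{u} → Model L} {N : Model L} (h : IsUnion M δ N) (hM : ∀ α < δ, (M α).card ≤ κ) :
    N.card ≤ κ := by
  rw [← cardLE_carrier]
  refine (CardLE.iUnion hκ hδ (A := fun α => {x | x ∈ (M α).carrier})
    fun α => cardLE_carrier.2 (hM α α.2)).mono fun x hx => ?_
  obtain ⟨α, hα, hx⟩ := h.2 x hx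
  exact Set.mem_iUnion.2 ⟨⟨α, hα⟩, hx⟩

theorem isSuccLimit_ord_succ {κ : Cardinal.{u}} (hκ : ℵ₀ ≤ κ) : IsSuccLimit (succ κ).ord :=
  Cardinal.isSuccLimit_ord (hκ.trans (le_succ κ))

/-- A function from a set of size at most `κ` to `κ⁺` is bounded. -/
theorem CardLE.exists_bound {κ : Cardinal.{u}} (hκ : ℵ₀ ≤ κ) {A : Set ZFSet.{u}} (hA : CardLE κ A)
    (g : ZFSet.{u} → Ordinal.{u}) (hg : ∀ x ∈ A, g x < (succ κ).ord) :
    ∃ β < (succ κ).ord, ∀ x ∈ A, g x ≤ β := by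
  have hs : Small.{u} A := by
    rw [small_iff_lift_mk_lt_univ]
    exact (Cardinal.lift_le.2 hA).trans_lt (by
      rw [Cardinal.lift_lift]; exact Cardinal.lift_lt_univ' κ)
  refine ⟨⨆ x : A, g x, Ordinal.lift_iSup_lt_of_lt_cof ?_ fun x => hg x x.2, fun x hx =>
    Ordinal.le_iSup (fun x : A => g x) ⟨x, hx⟩⟩
  rw [← Ordinal.lift_cof, (isRegular_succ hκ).cof_ord]
  have h1 : Cardinal.lift.{u, u + 1} #A = #A := Cardinal.lift_id'.{u, u + 1} _
  rw [h1]
  exact hA.trans_lt (Cardinal.lift_lt.2 (lt_succ κ))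

/-! ### Submodels of prescribed cardinality -/

namespace AEC

variable {K : AEC L} {κ : Cardinal.{u}} {M N P : Model L}

theorem lstBound_of_le (h : K.LST ≤ κ) : LSTBound K.mem K.le κ := by
  have h0 : LSTBound K.mem K.le K.LST := csInf_mem (s := {κ | LSTBound K.mem K.le κ}) K.exists_LST
  intro N hN A hA
  obtain ⟨M, h1, h2, h3⟩ := h0 N hN A hA
  exact ⟨M, h1, h2, h3.trans (by gcongr)⟩

theorem le.card_le (h : K.le M N) : M.card ≤ N.card := h.sub.emb.card_le

/-- Löwenheim-Skolem in exactly the cardinality `κ`. -/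
theorem exists_hull (hκ : ℵ₀ ≤ κ) (hL : K.LST ≤ κ) (hN : K.mem N) (hc : κ ≤ N.card)
    {A : Set ZFSet.{u}} (hA : ∀ x ∈ A, x ∈ N.carrier) (hAc : CardLE κ A) :
    ∃ M, K.le M N ∧ K.memCard κ M ∧ ∀ x ∈ A, x ∈ M.carrier := by
  have hc' : Cardinal.lift.{u + 1} κ ≤ #({x | x ∈ N.carrier} : Set ZFSet.{u}) := by
    have := Cardinal.lift_le.{u + 1}.2 hc
    rwa [Model.card, ← ZFSet.cardinalMk_coe_sort] at this
  obtain ⟨p, hpN, hp⟩ := Cardinal.le_mk_iff_exists_subset.1 hc'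
  let B : ZFSet.{u} := ZFSet.sep (fun x => x ∈ p ∪ A) N.carrier
  have hB : ∀ x, x ∈ B ↔ x ∈ p ∪ A := fun x => by
    refine ZFSet.mem_sep.trans ⟨fun h => h.2, fun h => ⟨?_, h⟩⟩
    exact h.elim (fun h => hpN h) (hA x)
  have hBset : ({x | x ∈ B} : Set ZFSet.{u}) = p ∪ A := Set.ext hB
  have hB1 : B.card ≤ κ := by
    rw [← cardLE_coe, hBset]
    exact CardLE.union hκ hp.le hAc
  have hB2 : κ ≤ B.card := by
    rw [← Cardinal.lift_le.{u + 1} (b := B.card), ← ZFSet.cardinalMk_coe_sort, ← hp]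
    exact Cardinal.mk_le_mk_of_subset fun x hx => (hB x).2 (Or.inl hx)
  obtain ⟨M, hM, hBM, hMc⟩ := lstBound_of_le hL N hN B ZFSet.sep_subset
  refine ⟨M, hM, ⟨hM.mem_left, le_antisymm ?_ (hB2.trans (ZFSet.card_mono hBM))⟩, fun x hx =>
    hBM ((hB x).2 (Or.inr hx))⟩
  exact hMc.trans (Cardinal.add_le_of_le hκ le_rfl hB1)

theorem IsUnion.memCard (hκ : ℵ₀ ≤ κ) {δ : Ordinal.{u}} (hδ : IsSuccLimit δ)
    (hδκ : #(Set.Iio δ) ≤ Cardinal.lift.{u + 1} κ) {M : Ordinal.{u} → Model L}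
    (hM : IncreasingContinuous K.le M δ) (h : IsUnion M δ N) (hc : ∀ α < δ, K.memCard κ (M α)) :
    K.memCard κ N := by
  have h0 := K.le_union δ M N hδ hM h 0 hδ.bot_lt
  exact ⟨h0.mem_right, le_antisymm (h.card_le hκ hδκ fun α hα => (hc α hα).2.le)
    ((hc 0 hδ.bot_lt).2.ge.trans h0.card_le)⟩

/-- An increasing continuous chain of models of cardinality `κ` swallowing given sets `A i`, with
its `i`-th member inside a given model `E i`. At limit stages the union has to contain `A i`, hence
the continuity assumption `hA`. -/
theorem exists_hull_chain (hκ : ℵ₀ ≤ κ) (hL : K.LST ≤ κ) {θ : Ordinal.{u}} (hθ : θ ≤ (succ κ).ord)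
    (E : Ordinal.{u} → Model L) (hE : ∀ i j, i ≤ j → j < θ → K.le (E i) (E j))
    (A : Ordinal.{u} → Set ZFSet.{u}) (hAE : ∀ i < θ, ∀ x ∈ A i, x ∈ (E i).carrier)
    (hAκ : ∀ i < θ, CardLE κ (A i))
    (hA : ∀ i < θ, IsSuccLimit i → ∀ x ∈ A i, ∃ j < i, x ∈ A j)
    {N₀ : Model L} (hN₀ : K.memCard κ N₀) (hN₀E : K.le N₀ (E 0))
    (hA0 : ∀ x ∈ A 0, x ∈ N₀.carrier) :
    ∃ F : Ordinal.{u} → Model L, F 0 = N₀ ∧ IncreasingContinuous K.le F θ ∧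
      ∀ i < θ, K.memCard κ (F i) ∧ K.le (F i) (E i) ∧ ∀ x ∈ A i, x ∈ (F i).carrier := by
  rcases eq_or_ne θ 0 with rfl | hθ0
  · exact ⟨fun _ => N₀, rfl, ⟨fun _ _ _ h => absurd h not_lt_bot, fun _ h => absurd h not_lt_bot⟩,
      fun _ h => absurd h not_lt_bot⟩
  have hθ0 : 0 < θ := bot_lt_iff_ne_bot.2 hθ0
  obtain ⟨F, hF⟩ : ∃ F, IsChain (fun i (N : Model L) => K.memCard κ N ∧ K.le N (E i) ∧
      (∀ x ∈ A i, x ∈ N.carrier) ∧ (i = 0 → N = N₀)) (fun _ N N' => K.le N N')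
      (fun i S N => IsUnion S i N) F θ := by
    refine exists_isChain _ _ _ θ (fun i N h => K.refl _ h.1.1)
      (fun i j N N' N'' _ _ h h' => K.trans _ _ _ h h') (fun δ S S' t h ht => ht.congr h)
      ⟨N₀, hN₀, hN₀E, hA0, fun _ => rfl⟩ (fun i N hi h => ?_) (fun δ S hδ hl hS => ?_)
    · obtain ⟨h1, h2, h3, h4⟩ := h
      have hle := K.trans _ _ _ h2 (hE i (i + 1) (lt_add_one i).le hi)
      obtain ⟨N', hN', hN'c, hN'A⟩ := exists_hull hκ hL hle.mem_right (h1.2.ge.trans hle.card_le)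
        (A := {x | x ∈ N.carrier} ∪ A (i + 1)) (fun x hx => hx.elim hle.sub.subset (hAE _ hi x))
        ((cardLE_carrier.2 h1.2.le).union hκ (hAκ _ hi))
      refine ⟨N', ⟨hN'c, hN', fun x hx => hN'A x (Or.inr hx), fun h => ?_⟩,
        le.of_subset hle hN' fun x hx => hN'A x (Or.inl hx)⟩
      exact absurd h (add_pos_of_right zero_lt_one i).ne'
    · have hinc : IncreasingContinuous K.le S δ := ⟨hS.rel, hS.lim⟩
      obtain ⟨N, hN⟩ := exists_isUnion hl.bot_lt S fun i j h h' => (hinc.1 i j h h').sub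
      have hle := K.le_union δ S N hl hinc hN
      refine ⟨N, ⟨IsUnion.memCard hκ hl (mk_Iio_le (hδ.trans_le hθ)) hinc hN fun α hα =>
        (hS.good α hα).1, K.smooth δ S N _ hl hinc hN fun α hα =>
        K.trans _ _ _ (hS.good α hα).2.1 (hE α δ hα.le hδ), fun x hx => ?_,
        fun h => absurd h hl.ne_bot⟩, hN, hle⟩
      obtain ⟨j, hj, hx⟩ := hA δ hδ hl x hx
      exact (hle j hj).sub.subset ((hS.good j hj).2.2.1 x hx)
  exact ⟨F, (hF.good 0 hθ0).2.2.2 rfl, ⟨hF.rel, hF.lim⟩,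
    fun i hi => ⟨(hF.good i hi).1, (hF.good i hi).2.1, (hF.good i hi).2.2.1⟩⟩

/-- A model of cardinality `κ⁺` is the union of an increasing continuous chain of models of
cardinality `κ`. -/
theorem exists_filtration (hκ : ℵ₀ ≤ κ) (hL : K.LST ≤ κ) (hM : K.memCard (succ κ) M)
    {N₀ : Model L} (hN₀ : K.memCard κ N₀) (hN₀M : K.le N₀ M) :
    ∃ F : Ordinal.{u} → Model L, F 0 = N₀ ∧ IncreasingContinuous K.le F (succ κ).ord ∧
      IsUnion F (succ κ).ord M ∧ ∀ i < (succ κ).ord, K.memCard κ (F i) ∧ K.le (F i) M := by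
  classical
  have hcard : #M.carrier = #(Set.Iio (succ κ).ord) := by
    rw [ZFSet.cardinalMk_coe_sort, Cardinal.mk_Iio_ordinal, Cardinal.card_ord]
    exact congrArg _ hM.2
  obtain ⟨e⟩ := Cardinal.eq.1 hcard
  -- the elements of `M` with index below `i` in an enumeration of order type `κ⁺`
  let A : Ordinal.{u} → Set ZFSet.{u} := fun i => {x | ∃ h : x ∈ M.carrier, (e ⟨x, h⟩).1 < i}
  have hAκ : ∀ i < (succ κ).ord, CardLE κ (A i) := fun i hi => by
    refine le_trans ?_ (mk_Iio_le hi)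
    refine Cardinal.mk_le_of_injective (f := fun x : A i => (⟨_, x.2.choose_spec⟩ : Set.Iio i)) ?_
    intro x y hxy
    have := e.injective (Subtype.ext (Subtype.mk.inj hxy))
    exact Subtype.ext (Subtype.mk.inj this)
  have hlim := isSuccLimit_ord_succ hκ
  obtain ⟨F, h0, h1, h2⟩ := exists_hull_chain hκ hL le_rfl (fun _ => M)
    (fun _ _ _ _ => K.refl _ hM.1) A (fun i _ x hx => hx.1) hAκ
    (fun i _ hl x hx => by
      obtain ⟨h, hx⟩ := hx
      exact ⟨_, hl.succ_lt hx, h, lt_succ _⟩) hN₀ hN₀M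
    (fun x hx => absurd hx.2 not_lt_bot)
  refine ⟨F, h0, h1, ⟨fun i hi => (h2 i hi).2.1.sub, fun x hx => ?_⟩, fun i hi =>
    ⟨(h2 i hi).1, (h2 i hi).2.1⟩⟩
  have hi := hlim.succ_lt (e ⟨x, hx⟩).2
  exact ⟨_, hi, (h2 _ hi).2.2 x ⟨hx, lt_succ _⟩⟩

/-- Subsets of size `κ` are bounded in every chain of length `κ⁺`, as `κ⁺` is regular. -/
theorem exists_subset_of_isUnion (hκ : ℵ₀ ≤ κ) {F : Ordinal.{u} → Model L}
    (hF : IncreasingContinuous K.le F (succ κ).ord) (hM : IsUnion F (succ κ).ord M)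
    {A : Set ZFSet.{u}} (hA : CardLE κ A) (hAM : ∀ x ∈ A, x ∈ M.carrier) :
    ∃ i < (succ κ).ord, ∀ x ∈ A, x ∈ (F i).carrier := by
  have hex : ∀ x, ∃ i, x ∈ A → i < (succ κ).ord ∧ x ∈ (F i).carrier := fun x => by
    by_cases hx : x ∈ A
    · obtain ⟨i, hi, hxi⟩ := hM.2 x (hAM x hx)
      exact ⟨i, fun _ => ⟨hi, hxi⟩⟩
    · exact ⟨0, fun h => absurd h hx⟩
  choose g hg using hex
  obtain ⟨β, hβ, hb⟩ := hA.exists_bound hκ g fun x hx => (hg x hx).1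
  exact ⟨β, hβ, fun x hx => (hF.1 _ _ (hb x hx) hβ).sub.subset (hg x hx).2⟩

/-- Let `M δ` be the union of an increasing chain of models of arbitrary size, and let the set `A`
of size at most `κ` be contained in `M δ` but in no `M α`, `α < δ`. Then `A` is contained in the
union `F θ` of a continuous chain `F` of models of cardinality `κ`, of limit length `θ < κ⁺`, each
member of which lies inside some `M α`, `α < δ`; the chain starts from a given `N₀ ⪯ M 0` and is
followed by a submodel `F (θ + 1)` of a given `P ⪰ M δ` that contains a given element `a` of `P`.

Elements of `A` are ordered by the least `α` at which they appear in the chain `M`; the length `θ`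
is the height of this well-founded order, and `F i` contains the elements of rank below `i`. -/
theorem exists_small_chain (hκ : ℵ₀ ≤ κ) (hL : K.LST ≤ κ) {δ : Ordinal.{u}}
    (hδ : IsSuccLimit δ) {M : Ordinal.{u} → Model L} (hM : ∀ α β, α ≤ β → β ≤ δ → K.le (M α) (M β))
    (hMδ : ∀ x ∈ (M δ).carrier, ∃ α < δ, x ∈ (M α).carrier)
    {N₀ : Model L} (hN₀ : K.memCard κ N₀) (hN₀M : K.le N₀ (M 0)) (hP : K.le (M δ) P)
    {A : ZFSet.{u}} (hA : A.card ≤ κ) (hAM : ∀ x ∈ A, x ∈ (M δ).carrier)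
    (hAn : ∀ α < δ, ∃ x ∈ A, x ∉ (M α).carrier) {a : ZFSet.{u}} (ha : a ∈ P.carrier) :
    ∃ (θ : Ordinal.{u}) (F : Ordinal.{u} → Model L), IsSuccLimit θ ∧ θ < (succ κ).ord ∧
      F 0 = N₀ ∧ IncreasingContinuous K.le F (θ + 2) ∧ (∀ i ≤ θ + 1, K.memCard κ (F i)) ∧
      (∀ i < θ, ∃ α < δ, K.le (F i) (M α)) ∧ K.le (F θ) (M δ) ∧ K.le (F (θ + 1)) P ∧
      (∀ x ∈ A, x ∈ (F θ).carrier) ∧ a ∈ (F (θ + 1)).carrier := by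
  classical
  -- `ρ x` is the stage of the chain `M` at which `x ∈ A` appears
  have hex : ∀ x, ∃ α, x ∈ A → α < δ ∧ x ∈ (M α).carrier ∧ ∀ β < α, x ∉ (M β).carrier := fun x => by
    by_cases hx : x ∈ A
    · obtain ⟨α, hα, hxα⟩ := hMδ x (hAM x hx)
      have hne : {α : Ordinal.{u} | x ∈ (M α).carrier}.Nonempty := ⟨α, hxα⟩
      exact ⟨sInf {α : Ordinal.{u} | x ∈ (M α).carrier},
        fun _ => ⟨(csInf_le' (a := α) hxα).trans_lt hα, csInf_mem hne,
        fun β hβ => notMem_of_lt_csInf' (s := {α : Ordinal.{u} | x ∈ (M α).carrier}) hβ⟩⟩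
    · exact ⟨0, fun h => absurd h hx⟩
  choose ρ hρ using hex
  -- `g x` is the rank of `x` in the order of `A` by `ρ`; `Shrink` puts the rank in universe `u`
  let r : Shrink A → Shrink A → Prop :=
    InvImage (· < ·) fun t => ρ ((equivShrink A).symm t)
  have hr : IsWellFounded _ r := ⟨InvImage.wf _ Ordinal.lt_wf⟩
  let g : ZFSet.{u} → Ordinal.{u} := fun x =>
    if h : x ∈ A then IsWellFounded.rank r (equivShrink A ⟨x, h⟩) else 0
  have hg : ∀ x (h : x ∈ A), g x = IsWellFounded.rank r (equivShrink A ⟨x, h⟩) :=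
    fun x h => dif_pos h
  have hlt : ∀ x ∈ A, ∀ y ∈ A, ρ x < ρ y → g x < g y := fun x hx y hy h => by
    rw [hg x hx, hg y hy]
    apply IsWellFounded.rank_lt_of_rel
    simpa [r, InvImage] using h
  let θ : Ordinal.{u} := ⨆ t : Shrink A, IsWellFounded.rank r t + 1
  have hgθ : ∀ x ∈ A, g x < θ := fun x hx => by
    rw [hg x hx]
    exact Ordinal.lt_iSup_add_one _ _
  have hsurj : ∀ i < θ, ∃ y ∈ A, g y = i := fun i hi => by
    obtain ⟨t, ht⟩ := Ordinal.lt_iSup_iff.1 hi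
    obtain ⟨s, rfl⟩ := IsWellFounded.mem_range_rank_of_le (Order.lt_add_one_iff.1 ht)
    refine ⟨(equivShrink A).symm s, Subtype.coe_prop _, ?_⟩
    rw [hg _ (Subtype.coe_prop _)]
    simp
  have hθκ : θ < (succ κ).ord := by
    rw [← Cardinal.card_le_iff]
    refine le_trans ?_ hA
    have h1 : #(Set.Iio θ) ≤ #A := by
      choose y hyA hy using fun i : Set.Iio θ => hsurj i i.2
      refine Cardinal.mk_le_of_injective (f := fun i => (⟨y i, hyA i⟩ : A)) fun i j h => ?_
      have := congrArg g (Subtype.mk.inj h)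
      rw [hy, hy] at this
      exact Subtype.ext this
    rw [Cardinal.mk_Iio_ordinal, ZFSet.cardinalMk_coe_sort] at h1
    exact Cardinal.lift_le.1 h1
  -- no element of `A` has maximal rank, because `A` is contained in no `M α`
  have hθ : IsSuccLimit θ := by
    obtain ⟨x₀, hx₀, -⟩ := hAn 0 hδ.bot_lt
    refine isSuccLimit_iff_of_orderBot.2 ⟨(zero_le.trans_lt (hgθ x₀ hx₀)).ne',
      isSuccPrelimit_of_succ_lt fun i hi => ?_⟩
    obtain ⟨y, hy, rfl⟩ := hsurj i hi
    obtain ⟨x, hx, hxy⟩ := hAn _ (hρ y hy).1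
    refine (succ_le_of_lt (hlt y hy x hx ?_)).trans_lt (hgθ x hx)
    by_contra! hle
    exact hxy ((hM _ _ hle (hρ y hy).1.le).sub.subset (hρ x hx).2.1)
  -- an element `y i` of `A` of rank `i`; all elements of rank at most `i` lie in `M (ρ (y i))`
  have hsurj' : ∀ i, ∃ y, i < θ → y ∈ A ∧ g y = i := fun i => by
    by_cases hi : i < θ
    · obtain ⟨y, hy⟩ := hsurj i hi
      exact ⟨y, fun _ => hy⟩
    · exact ⟨∅, fun h => absurd h hi⟩
  choose y hy using hsurj'
  have hyρ : ∀ i < θ, ρ (y i) < δ := fun i hi => (hρ _ (hy i hi).1).1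
  have hρle : ∀ x ∈ A, ∀ i < θ, g x ≤ i → ρ x ≤ ρ (y i) := fun x hx i hi h => by
    by_contra! hlt'
    have := hlt _ (hy i hi).1 x hx hlt'
    rw [(hy i hi).2] at this
    exact this.not_ge h
  let E : Ordinal.{u} → Model L := fun i =>
    if i < θ then M (ρ (y i)) else if i = θ then M δ else P
  have hE1 : ∀ i < θ, E i = M (ρ (y i)) := fun i hi => if_pos hi
  have hE2 : E θ = M δ := by simp [E]
  have hE3 : ∀ i, θ < i → E i = P := fun i hi => by simp [E, hi.not_gt, hi.ne']
  let B : Ordinal.{u} → Set ZFSet.{u} := fun i => {x | x ∈ A ∧ g x < i} ∪ {x | x = a ∧ i = θ + 1}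
  have hθ1 : θ < θ + 1 := lt_add_one θ
  have hθ2 : θ + 1 < θ + 2 := by
    rw [← one_add_one_eq_two, ← add_assoc]
    exact lt_add_one _
  have hlt2 : ∀ i, i < θ + 2 ↔ i ≤ θ + 1 := fun i => by
    rw [← one_add_one_eq_two, ← add_assoc, Order.lt_add_one_iff]
  have hlim := isSuccLimit_ord_succ hκ
  have hθ2κ : θ + 2 ≤ (succ κ).ord := by
    rw [← one_add_one_eq_two, ← add_assoc]
    exact (hlim.succ_lt (hlim.succ_lt hθκ)).le
  have h0E : K.le N₀ (E 0) := by
    rw [hE1 0 hθ.bot_lt]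
    exact K.trans _ _ _ hN₀M (hM _ _ zero_le (hyρ 0 hθ.bot_lt).le)
  obtain ⟨F, h0, h1, h2⟩ : ∃ F : Ordinal.{u} → Model L, F 0 = N₀ ∧
      IncreasingContinuous K.le F (θ + 2) ∧ ∀ i < θ + 2,
        K.memCard κ (F i) ∧ K.le (F i) (E i) ∧ ∀ x ∈ B i, x ∈ (F i).carrier := by
    refine exists_hull_chain hκ hL hθ2κ E (fun i j hij hj => ?_) B
      (fun i hi x hx => ?_) (fun i hi => ?_) (fun i hi hl x hx => ?_) hN₀ h0E (fun x hx => ?_)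
    · rcases lt_trichotomy i θ with hi | rfl | hi
      · rw [hE1 i hi]
        rcases lt_trichotomy j θ with hj | rfl | hj
        · rw [hE1 j hj]
          exact hM _ _ (hρle _ (hy i hi).1 j hj ((hy i hi).2.le.trans hij)) (hyρ j hj).le
        · rw [hE2]
          exact hM _ _ (hyρ i hi).le le_rfl
        · rw [hE3 j hj]
          exact K.trans _ _ _ (hM _ _ (hyρ i hi).le le_rfl) hP
      · rw [hE2]
        rcases hij.lt_or_eq with hj | rfl
        · rw [hE3 j hj]
          exact hP
        · rw [hE2]
          exact K.refl _ hP.mem_left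
      · rw [hE3 i hi, hE3 j (hi.trans_le hij)]
        exact K.refl _ hP.mem_right
    · rcases hx with ⟨hx, hxi⟩ | ⟨rfl, rfl⟩
      · rcases lt_trichotomy i θ with hi | rfl | hi
        · rw [hE1 i hi]
          exact (hM _ _ (hρle x hx i hi hxi.le) (hyρ i hi).le).sub.subset (hρ x hx).2.1
        · rw [hE2]
          exact hAM x hx
        · rw [hE3 i hi]
          exact hP.sub.subset (hAM x hx)
      · rw [hE3 _ hθ1]
        exact ha
    · refine ((cardLE_coe.2 hA).insert hκ a).mono fun x hx => ?_
      rcases hx with ⟨hx, -⟩ | ⟨rfl, -⟩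
      · exact Or.inr hx
      · exact Or.inl rfl
    · rcases hx with ⟨hx, hxi⟩ | ⟨rfl, rfl⟩
      · exact ⟨_, hl.succ_lt hxi, Or.inl ⟨hx, lt_succ _⟩⟩
      · exact absurd hl (Order.not_isSuccLimit_succ θ)
    · rcases hx with ⟨-, hx⟩ | ⟨-, hx⟩
      · exact absurd hx not_lt_bot
      · exact absurd hx.symm (add_pos_of_right zero_lt_one θ).ne'
  have hmem := fun i (hi : i ≤ θ + 1) => h2 i ((hlt2 i).2 hi)
  refine ⟨θ, F, hθ, hθκ, h0, h1, fun i hi => (hmem i hi).1,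
    fun i hi => ⟨_, hyρ i hi, hE1 i hi ▸ (hmem i (hi.trans hθ1).le).2.1⟩,
    hE2 ▸ (hmem θ hθ1.le).2.1, hE3 _ hθ1 ▸ (hmem _ le_rfl).2.1,
    fun x hx => (hmem θ hθ1.le).2.2 x (Or.inl ⟨hx, hgθ x hx⟩),
    (hmem _ le_rfl).2.2 a (Or.inr ⟨rfl, rfl⟩)⟩

end AEC

/-! ### Galois types -/

namespace AEC

variable {K : AEC L} {κ : Cardinal.{u}} {M M₀ N N' N₁ N₂ : Model L}

theorem isStrongOver_iff {f : M.carrier ↪[L] N.carrier} {φ : ZFSet.{u} → ZFSet.{u}}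
    (hf : ∀ x, (f x : ZFSet.{u}) = φ x) (h₀ : M₀.Sub M) :
    K.IsStrongOver M₀ f ↔ K.SEmb φ M N ∧ ∀ x ∈ M₀.carrier, φ x = x := by
  unfold IsStrongOver
  rw [isStrong_iff hf]
  refine and_congr_right fun _ => ⟨fun h x hx => ?_, fun h x hx => ?_⟩
  · have := h ⟨x, h₀.subset hx⟩ hx
    rwa [hf] at this
  · rw [hf]
    exact h x hx

theorem atomicEq_iff {p q : K.Pointed M} : K.AtomicEq M p q ↔
    ∃ (N : Model L) (f g : ZFSet.{u} → ZFSet.{u}), K.SEmb f p.N N ∧ K.SEmb g q.N N ∧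
      (∀ x ∈ M.carrier, f x = x) ∧ (∀ x ∈ M.carrier, g x = x) ∧ f p.a = g q.a := by
  constructor
  · rintro ⟨N, f, g, hf, hg, e⟩
    obtain ⟨φ, hφ⟩ := exists_fun f
    obtain ⟨ψ, hψ⟩ := exists_fun g
    rw [isStrongOver_iff hφ p.le.sub] at hf
    rw [isStrongOver_iff hψ q.le.sub] at hg
    refine ⟨N, φ, ψ, hf.1, hg.1, hf.2, hg.2, ?_⟩
    have := congrArg Subtype.val e
    rwa [hφ, hψ] at this
  · rintro ⟨N, φ, ψ, hf, hg, hf', hg', e⟩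
    obtain ⟨f, -, hφ⟩ := hf.exists_isStrong
    obtain ⟨g, -, hψ⟩ := hg.exists_isStrong
    refine ⟨N, f, g, (isStrongOver_iff hφ p.le.sub).2 ⟨hf, hf'⟩,
      (isStrongOver_iff hψ q.le.sub).2 ⟨hg, hg'⟩, Subtype.ext ?_⟩
    rw [hφ, hψ]
    exact e

theorem exists_rep (p : K.GType M) : ∃ (N : Model L) (h : K.le M N) (a : ZFSet.{u})
    (ha : a ∈ N.carrier), p = tp h a ha := by
  induction p using Quot.ind with
  | mk t => exact ⟨t.N, t.le, t.a, t.ha, rfl⟩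

theorem tp_eq_of_sEmb (h₁ : K.le M N₁) (h₂ : K.le M N₂) {f : ZFSet.{u} → ZFSet.{u}}
    (hf : K.SEmb f N₁ N₂) (hfM : ∀ x ∈ M.carrier, f x = x) {a : ZFSet.{u}} (ha : a ∈ N₁.carrier)
    (ha' : f a ∈ N₂.carrier) : tp h₁ a ha = tp h₂ (f a) ha' :=
  Quot.sound (atomicEq_iff.2 ⟨N₂, f, id, hf, (K.refl _ h₂.mem_right).sEmb, hfM,
    fun _ _ => rfl, rfl⟩)

theorem tp_eq_of_le (h₁ : K.le M N₁) (h₂ : K.le M N₂) (h : K.le N₁ N₂) {a : ZFSet.{u}}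
    (ha : a ∈ N₁.carrier) (ha' : a ∈ N₂.carrier) : tp h₁ a ha = tp h₂ a ha' :=
  tp_eq_of_sEmb h₁ h₂ h.sEmb (fun _ _ => rfl) ha ha'

theorem restrict_tp (h : K.le M₀ M) (h' : K.le M N) {a : ZFSet.{u}} (ha : a ∈ N.carrier) :
    (tp h' a ha).restrict h = tp (K.trans _ _ _ h h') a ha := rfl

theorem restrict_restrict (h : K.le M₀ M) (h' : K.le M N) (p : K.GType N) :
    (p.restrict h').restrict h = p.restrict (K.trans _ _ _ h h') := by
  induction p using Quot.ind with
  | mk t => rfl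

theorem restrict_self (h : K.le M M) (p : K.GType M) : p.restrict h = p := by
  induction p using Quot.ind with
  | mk t => rfl

/-- Whether a type is realized by an element of its domain does not depend on the realization. -/
theorem mem_iff_of_tp_eq {h₁ : K.le M N₁} {h₂ : K.le M N₂} {a b : ZFSet.{u}} {ha : a ∈ N₁.carrier}
    {hb : b ∈ N₂.carrier} (h : tp h₁ a ha = tp h₂ b hb) : a ∈ M.carrier ↔ b ∈ M.carrier := by
  have key : ∀ p q : K.Pointed M, K.AtomicEq M p q → (p.a ∈ M.carrier ↔ q.a ∈ M.carrier) := by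
    intro p q hpq
    obtain ⟨N, f, g, hf, hg, hfM, hgM, e⟩ := atomicEq_iff.1 hpq
    constructor
    · intro hp
      have h1 : g q.a = g p.a := by rw [← e, hfM _ hp, hgM _ hp]
      rwa [hg.emb.inj q.ha (q.le.sub.subset hp) h1]
    · intro hq
      have h1 : f p.a = f q.a := by rw [e, hfM _ hq, hgM _ hq]
      rwa [hf.emb.inj p.ha (p.le.sub.subset hq) h1]
  let F : K.GType M → Prop := Quot.lift (fun t => t.a ∈ M.carrier) fun p q h => propext (key p q h)
  exact iff_of_eq (congrArg F h)

/-- A type over a model of cardinality `κ` is realized in a model of cardinality `κ`. -/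
theorem exists_rep_memCard (hκ : ℵ₀ ≤ κ) (hL : K.LST ≤ κ) (hM : K.memCard κ M) (p : K.GType M) :
    ∃ (N : Model L) (h : K.le M N) (a : ZFSet.{u}) (ha : a ∈ N.carrier), K.memCard κ N ∧
      p = tp h a ha := by
  obtain ⟨N, h, a, ha, rfl⟩ := exists_rep p
  obtain ⟨N', h1, h2, h3⟩ := exists_hull hκ hL h.mem_right (hM.2.ge.trans h.card_le)
    (A := insert a {x | x ∈ M.carrier})
    (fun x hx => hx.elim (fun e => e ▸ ha) h.sub.subset)
    ((cardLE_carrier.2 hM.2.le).insert hκ a)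
  have h4 : K.le M N' := le.of_subset h h1 fun x hx => h3 x (Or.inr hx)
  exact ⟨N', h4, a, h3 a (Or.inl rfl), h2, (tp_eq_of_le _ _ h1 _ _).symm⟩

/-! ### Amalgamation -/

/-- Amalgamation over a base that is embedded, rather than included, in the two models. -/
theorem Amalgamation.exists_amalgam (hA : K.Amalgamation κ) {f₁ f₂ : ZFSet.{u} → ZFSet.{u}}
    (hM : K.memCard κ M) (h₁ : K.memCard κ N₁) (h₂ : K.memCard κ N₂) (hf₁ : K.SEmb f₁ M N₁)
    (hf₂ : K.SEmb f₂ M N₂) : ∃ (P : Model L) (g₁ g₂ : ZFSet.{u} → ZFSet.{u}), K.memCard κ P ∧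
      K.SEmb g₁ N₁ P ∧ K.SEmb g₂ N₂ P ∧ ∀ x ∈ M.carrier, g₁ (f₁ x) = g₂ (f₂ x) := by
  obtain ⟨N₁', i₁, k₁, hle₁, hi₁, hk₁, -, hkf₁, -, -⟩ := hf₁.exists_rename
  obtain ⟨N₂', i₂, k₂, hle₂, hi₂, hk₂, -, hkf₂, -, -⟩ := hf₂.exists_rename
  obtain ⟨P, hP, g₁, g₂, hg₁, hg₂⟩ := hA M N₁' N₂' hM (memCard_of_iso hk₁ h₁)
    (memCard_of_iso hk₂ h₂) hle₁ hle₂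
  obtain ⟨φ₁, hφ₁⟩ := exists_fun g₁
  obtain ⟨φ₂, hφ₂⟩ := exists_fun g₂
  rw [isStrongOver_iff hφ₁ hle₁.sub] at hg₁
  rw [isStrongOver_iff hφ₂ hle₂.sub] at hg₂
  refine ⟨P, φ₁ ∘ k₁, φ₂ ∘ k₂, hP, (sEmb_of_iso hk₁ h₁.1).comp hg₁.1,
    (sEmb_of_iso hk₂ h₂.1).comp hg₂.1, fun x hx => ?_⟩
  simp only [Function.comp_apply]
  rw [hkf₁ x hx, hkf₂ x hx, hg₁.2 x hx, hg₂.2 x hx]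

/-- Amalgamation in the form used in transfinite constructions: an embedding of `M` into `N` extends
to an embedding of a given `M' ⪰ M` into some `N' ⪰ N`. -/
theorem Amalgamation.exists_extend (hA : K.Amalgamation κ) {M' : Model L}
    {f : ZFSet.{u} → ZFSet.{u}} (hM : K.memCard κ M) (hM' : K.memCard κ M') (hN : K.memCard κ N)
    (hle : K.le M M') (hf : K.SEmb f M N) : ∃ (P : Model L) (g : ZFSet.{u} → ZFSet.{u}),
      K.memCard κ P ∧ K.le N P ∧ K.SEmb g M' P ∧ ∀ x ∈ M.carrier, g x = f x := by
  obtain ⟨P, g₁, g₂, hP, h₁, h₂, e⟩ := hA.exists_amalgam hM hM' hN hle.sEmb hf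
  obtain ⟨P', i, k, hle', hi, hk, -, hkg, -, -⟩ := h₂.exists_rename
  refine ⟨P', k ∘ g₁, memCard_of_iso hk hP, hle', h₁.comp (sEmb_of_iso hk hP.1), fun x hx => ?_⟩
  have := e x hx
  simp only [id, Function.comp_apply] at this ⊢
  rw [this, hkg _ (hf.emb.mapsTo hx)]

/-- In a cardinality with amalgamation, equality of types is witnessed by a single amalgam. -/
theorem Amalgamation.exists_of_tp_eq (hA : K.Amalgamation κ) (hκ : ℵ₀ ≤ κ) (hL : K.LST ≤ κ)
    (hM : K.memCard κ M) (hN₁ : K.memCard κ N₁) (hN₂ : K.memCard κ N₂) {h₁ : K.le M N₁}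
    {h₂ : K.le M N₂} {a₁ a₂ : ZFSet.{u}} {ha₁ : a₁ ∈ N₁.carrier} {ha₂ : a₂ ∈ N₂.carrier}
    (h : tp h₁ a₁ ha₁ = tp h₂ a₂ ha₂) : ∃ (P : Model L) (f g : ZFSet.{u} → ZFSet.{u}),
      K.memCard κ P ∧ K.SEmb f N₁ P ∧ K.SEmb g N₂ P ∧ (∀ x ∈ M.carrier, f x = x) ∧
      (∀ x ∈ M.carrier, g x = x) ∧ f a₁ = g a₂ := by
  -- the models realizing a type may be large: compare their submodels of cardinality `κ`
  let E : K.Pointed M → K.Pointed M → Prop := fun p q => ∀ P Q : Model L, K.memCard κ P →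
    K.memCard κ Q → K.le M P → K.le M Q → K.le P p.N → K.le Q q.N → p.a ∈ P.carrier →
    q.a ∈ Q.carrier → ∃ (R : Model L) (f g : ZFSet.{u} → ZFSet.{u}), K.memCard κ R ∧
      K.SEmb f P R ∧ K.SEmb g Q R ∧ (∀ x ∈ M.carrier, f x = x) ∧ (∀ x ∈ M.carrier, g x = x) ∧
      f p.a = g q.a
  have hatom : ∀ p q, K.AtomicEq M p q → E p q := by
    intro p q hpq P Q hP hQ hMP hMQ hPp hQq hpP hqQ
    obtain ⟨N, f, g, hf, hg, hfM, hgM, e⟩ := atomicEq_iff.1 hpq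
    obtain ⟨P', hP', hiP⟩ := hf.of_le hPp
    obtain ⟨Q', hQ', hiQ⟩ := hg.of_le hQq
    obtain ⟨R, hR, hRc, hRA⟩ := exists_hull hκ hL hf.mem_right
      (hP.2.ge.trans ((hiP.card_eq).le.trans hP'.card_le))
      (A := {x | x ∈ P'.carrier} ∪ {x | x ∈ Q'.carrier})
      (fun x hx => hx.elim hP'.sub.subset hQ'.sub.subset)
      ((cardLE_carrier.2 (hiP.card_eq ▸ hP.2.le)).union hκ
        (cardLE_carrier.2 (hiQ.card_eq ▸ hQ.2.le)))
    exact ⟨R, f, g, hRc, ⟨P', le.of_subset hP' hR fun x hx => hRA x (Or.inl hx), hiP⟩,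
      ⟨Q', le.of_subset hQ' hR fun x hx => hRA x (Or.inr hx), hiQ⟩, hfM, hgM, e⟩
  have hE : ∀ p q, Relation.EqvGen (K.AtomicEq M) p q → E p q := by
    intro p q hpq
    induction hpq with
    | rel p q h => exact hatom p q h
    | refl p =>
      exact hatom p p (atomicEq_iff.2 ⟨p.N, id, id, (K.refl _ p.le.mem_right).sEmb,
        (K.refl _ p.le.mem_right).sEmb, fun _ _ => rfl, fun _ _ => rfl, rfl⟩)
    | symm p q _ ih =>
      intro P Q hP hQ hMP hMQ hPp hQq hpP hqQ
      obtain ⟨R, f, g, hR, hf, hg, hfM, hgM, e⟩ := ih Q P hQ hP hMQ hMP hQq hPp hqQ hpP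
      exact ⟨R, g, f, hR, hg, hf, hgM, hfM, e.symm⟩
    | trans p q r _ _ ih₁ ih₂ =>
      intro P R hP hR hMP hMR hPp hRr hpP hrR
      obtain ⟨Q, hQ, hQc, hQA⟩ := exists_hull hκ hL q.le.mem_right (hM.2.ge.trans q.le.card_le)
        (A := insert q.a {x | x ∈ M.carrier})
        (fun x hx => hx.elim (fun e => e ▸ q.ha) q.le.sub.subset)
        ((cardLE_carrier.2 hM.2.le).insert hκ _)
      have hMQ : K.le M Q := le.of_subset q.le hQ fun x hx => hQA x (Or.inr hx)
      have hqQ : q.a ∈ Q.carrier := hQA _ (Or.inl rfl)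
      obtain ⟨S, f, g, hS, hf, hg, hfM, hgM, e⟩ := ih₁ P Q hP hQc hMP hMQ hPp hQ hpP hqQ
      obtain ⟨T, f', g', hT, hf', hg', hfM', hgM', e'⟩ := ih₂ Q R hQc hR hMQ hMR hQ hRr hqQ hrR
      -- amalgamate the two amalgams over `Q`, and rename the result so that `M` is fixed pointwise
      obtain ⟨U, k₁, k₂, hU, hk₁, hk₂, ek⟩ := hA.exists_amalgam hQc hS hT hg hf'
      have hMU : K.SEmb (k₁ ∘ f) M U := (hf.of_le hMP).comp hk₁
      obtain ⟨V, -, k, -, -, hk, -, hkM, -, -⟩ := hMU.exists_rename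
      have hk' := sEmb_of_iso hk hU.1
      refine ⟨V, k ∘ k₁ ∘ f, k ∘ k₂ ∘ g', memCard_of_iso hk hU, (hf.comp hk₁).comp hk',
        (hg'.comp hk₂).comp hk', hkM, fun x hx => ?_, ?_⟩
      · have h1 := ek x (hMQ.sub.subset hx)
        have h2 := hkM x hx
        simp only [Function.comp_apply] at h2 ⊢
        rw [hgM x hx, hfM' x hx] at h1
        rw [hfM x hx] at h2
        rw [hgM' x hx, ← h1, h2]
      · simp only [Function.comp_apply]
        rw [e, ek _ hqQ, e']
  exact hE _ _ (Quot.eqvGen_exact h) N₁ N₂ hN₁ hN₂ h₁ h₂ (K.refl _ hN₁.1) (K.refl _ hN₂.1) ha₁ ha₂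

/-! ### Transport of types along isomorphisms and embeddings -/

/-- Equality of types is preserved by isomorphisms of the whole situation. -/
theorem tp_eq_of_iso {M' N₁' N₂' : Model L} {g f₁ f₂ : ZFSet.{u} → ZFSet.{u}} (hg : Iso g M M')
    (hf₁ : Iso f₁ N₁ N₁') (hf₂ : Iso f₂ N₂ N₂') (h₁g : ∀ x ∈ M.carrier, f₁ x = g x)
    (h₂g : ∀ x ∈ M.carrier, f₂ x = g x) (h₁ : K.le M N₁) (h₂ : K.le M N₂) (h₁' : K.le M' N₁')
    (h₂' : K.le M' N₂') {a₁ a₂ : ZFSet.{u}} (ha₁ : a₁ ∈ N₁.carrier) (ha₂ : a₂ ∈ N₂.carrier)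
    (ha₁' : f₁ a₁ ∈ N₁'.carrier) (ha₂' : f₂ a₂ ∈ N₂'.carrier) (h : tp h₁ a₁ ha₁ = tp h₂ a₂ ha₂) :
    tp h₁' (f₁ a₁) ha₁' = tp h₂' (f₂ a₂) ha₂' := by
  -- `T p p'` says that an isomorphism extending `g` carries `p` to `p'`
  let T : K.Pointed M → K.Pointed M' → Prop := fun p p' =>
    ∃ f, Iso f p.N p'.N ∧ (∀ x ∈ M.carrier, f x = g x) ∧ f p.a = p'.a
  obtain ⟨g', hg', hgg', hgg''⟩ := hg.symm
  have htot : ∀ p, ∃ p', T p p' := by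
    intro p
    have h1 : K.SEmb g' M' p.N := ⟨M, p.le, hg'⟩
    obtain ⟨N', -, k, hle, -, hk, -, hkM, -, -⟩ := h1.exists_rename
    refine ⟨⟨N', hle, k p.a, hk.emb.mapsTo p.ha⟩, k, hk, fun x hx => ?_, rfl⟩
    have := hkM (g x) (hg.emb.mapsTo hx)
    rwa [hgg' x hx] at this
  have hpres : ∀ p q p' q', T p p' → T q q' → K.AtomicEq M p q → K.AtomicEq M' p' q' := by
    rintro p q p' q' ⟨f, hf, hfM, ef⟩ ⟨f', hf', hfM', ef'⟩ hpq
    obtain ⟨N, φ, ψ, hφ, hψ, hφM, hψM, e⟩ := atomicEq_iff.1 hpq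
    obtain ⟨j, hj, hjf, hfj⟩ := hf.symm
    obtain ⟨j', hj', hjf', hfj'⟩ := hf'.symm
    have h1 : K.SEmb g' M' N :=
      SEmb.congr ((SEmb.comp ⟨M, p.le, hg'⟩ hφ)) fun x hx => hφM _ (hg'.emb.mapsTo hx)
    obtain ⟨N', -, k, hle, -, hk, -, hkM, -, -⟩ := h1.exists_rename
    have hk' := sEmb_of_iso hk hφ.mem_right
    refine atomicEq_iff.2 ⟨N', k ∘ φ ∘ j, k ∘ ψ ∘ j',
      ((sEmb_of_iso hj p'.le.mem_right).comp hφ).comp hk',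
      ((sEmb_of_iso hj' q'.le.mem_right).comp hψ).comp hk', fun x hx => ?_, fun x hx => ?_, ?_⟩
    · have h2 : j x = g' x := by
        have := hjf (g' x) (p.le.sub.subset (hg'.emb.mapsTo hx))
        rwa [hfM _ (hg'.emb.mapsTo hx), hgg'' x hx] at this
      simp only [Function.comp_apply]
      rw [h2, hφM _ (hg'.emb.mapsTo hx), hkM x hx]
    · have h2 : j' x = g' x := by
        have := hjf' (g' x) (q.le.sub.subset (hg'.emb.mapsTo hx))
        rwa [hfM' _ (hg'.emb.mapsTo hx), hgg'' x hx] at this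
      simp only [Function.comp_apply]
      rw [h2, hψM _ (hg'.emb.mapsTo hx), hkM x hx]
    · simp only [Function.comp_apply]
      rw [← ef, ← ef', hjf _ p.ha, hjf' _ q.ha, e]
  choose τ hτ using htot
  let F : K.GType M → K.GType M' := Quot.map τ fun p q hpq => hpres p q _ _ (hτ p) (hτ q) hpq
  have hrefl : ∀ p : K.Pointed M, K.AtomicEq M p p := fun p => atomicEq_iff.2
    ⟨p.N, id, id, (K.refl _ p.le.mem_right).sEmb, (K.refl _ p.le.mem_right).sEmb,
      fun _ _ => rfl, fun _ _ => rfl, rfl⟩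
  have hF : ∀ p p', T p p' → F (Quot.mk _ p) = Quot.mk _ p' := fun p p' h =>
    Quot.sound (hpres p p _ _ (hτ p) h (hrefl p))
  have e₁ := hF ⟨N₁, h₁, a₁, ha₁⟩ ⟨N₁', h₁', f₁ a₁, ha₁'⟩ ⟨f₁, hf₁, h₁g, rfl⟩
  have e₂ := hF ⟨N₂, h₂, a₂, ha₂⟩ ⟨N₂', h₂', f₂ a₂, ha₂'⟩ ⟨f₂, hf₂, h₂g, rfl⟩
  exact e₁.symm.trans ((congrArg F h).trans e₂)

/-- The element `a` of `N` realizes the type `q` over `M`, where `M` is embedded in `N` by `φ`: some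
realization `b` of `q` in an extension `N'` of `M` is sent to `a` by an embedding of `N'` into `N`
that extends `φ`. -/
def RealizesVia (K : AEC L) (φ : ZFSet.{u} → ZFSet.{u}) (M N : Model L) (a : ZFSet.{u})
    (q : K.GType M) : Prop :=
  ∃ (N' : Model L) (g : ZFSet.{u} → ZFSet.{u}) (b : ZFSet.{u}) (h : K.le M N')
    (hb : b ∈ N'.carrier), K.SEmb g N' N ∧ (∀ x ∈ M.carrier, g x = φ x) ∧ g b = a ∧ q = tp h b hb

variable {φ ψ : ZFSet.{u} → ZFSet.{u}} {a : ZFSet.{u}}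

theorem RealizesVia.sEmb {q : K.GType M} (h : K.RealizesVia φ M N a q) : K.SEmb φ M N := by
  obtain ⟨N', g, b, h, hb, hg, hgM, e, rfl⟩ := h
  exact (hg.of_le h).congr hgM

theorem RealizesVia.mem {q : K.GType M} (h : K.RealizesVia φ M N a q) : a ∈ N.carrier := by
  obtain ⟨N', g, b, h, hb, hg, hgM, rfl, rfl⟩ := h
  exact hg.emb.mapsTo hb

theorem RealizesVia.congr {q : K.GType M} (h : K.RealizesVia φ M N a q)
    (hc : ∀ x ∈ M.carrier, φ x = ψ x) : K.RealizesVia ψ M N a q := by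
  obtain ⟨N', g, b, h, hb, hg, hgM, e, rfl⟩ := h
  exact ⟨N', g, b, h, hb, hg, fun x hx => (hgM x hx).trans (hc x hx), e, rfl⟩

theorem RealizesVia.trans_le {q : K.GType M} (h : K.RealizesVia φ M N a q) (hN : K.le N N') :
    K.RealizesVia φ M N' a q := by
  obtain ⟨N'', g, b, h, hb, hg, hgM, e, rfl⟩ := h
  exact ⟨N'', g, b, h, hb, hg.trans_le hN, hgM, e, rfl⟩

theorem RealizesVia.restrict {q : K.GType M} (h : K.RealizesVia φ M N a q) (hM : K.le M₀ M) :
    K.RealizesVia φ M₀ N a (q.restrict hM) := by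
  obtain ⟨N'', g, b, h, hb, hg, hgM, e, rfl⟩ := h
  exact ⟨N'', g, b, K.trans _ _ _ hM h, hb, hg, fun x hx => hgM x (hM.sub.subset hx), e, rfl⟩

theorem realizesVia_id (h : K.le M N) (ha : a ∈ N.carrier) :
    K.RealizesVia id M N a (tp h a ha) :=
  ⟨N, id, a, h, ha, (K.refl _ h.mem_right).sEmb, fun _ _ => rfl, rfl, rfl⟩

/-- The model and the element realizing a type via `φ` can be pulled back along an isomorphism. -/
theorem SEmb.exists_realizesVia (h : K.SEmb φ M N) (ha : a ∈ N.carrier) :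
    ∃ (N' : Model L) (g : ZFSet.{u} → ZFSet.{u}) (b : ZFSet.{u}) (h : K.le M N')
      (hb : b ∈ N'.carrier), Iso g N' N ∧ (∀ x ∈ M.carrier, g x = φ x) ∧ g b = a ∧
      K.RealizesVia φ M N a (tp h b hb) := by
  obtain ⟨N', g, k, hle, hg, hk, hgM, -, -, hgk⟩ := h.exists_rename
  have hkb := hk.emb.mapsTo ha
  exact ⟨N', g, k a, hle, hkb, hg, hgM, hgk a ha, N', g, k a, hle, hkb,
    sEmb_of_iso hg hle.mem_right, hgM, hgk a ha, rfl⟩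

/-- The type realized by an element via an embedding is determined by the element and the
embedding. -/
theorem RealizesVia.unique {q q' : K.GType M} (h : K.RealizesVia φ M N a q)
    (h' : K.RealizesVia φ M N a q') : q = q' := by
  have hφ := h.sEmb
  obtain ⟨N₁, g, b, h, hb, hg, hgM, e, rfl⟩ := h
  obtain ⟨N₂, g', b', h', hb', hg', hgM', e', rfl⟩ := h'
  obtain ⟨P, -, k, hle, -, hk, -, hkM, -, -⟩ := hφ.exists_rename
  have hk' := sEmb_of_iso hk hg.mem_right
  refine Quot.sound (atomicEq_iff.2 ⟨P, k ∘ g, k ∘ g', hg.comp hk', hg'.comp hk', fun x hx => ?_,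
    fun x hx => ?_, ?_⟩)
  · simp only [Function.comp_apply]
    rw [hgM x hx, hkM x hx]
  · simp only [Function.comp_apply]
    rw [hgM' x hx, hkM x hx]
  · simp only [Function.comp_apply]
    rw [e, e']

end AEC

open AEC

/-! ### Non-forking in a frame -/

namespace PreFrame

variable {s : PreFrame L} {lam κ : Cardinal.{u}} {M M₀ M₁ N N₀ N₁ : Model L}

theorem IsFrame.exists_hull (hs : s.IsFrame lam κ) (hN : s.K.mem N) (hc : lam ≤ N.card)
    {A : Set ZFSet.{u}} (hA : ∀ x ∈ A, x ∈ N.carrier) (hAc : CardLE lam A) :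
    ∃ M, s.K.le M N ∧ s.K.memCard lam M ∧ ∀ x ∈ A, x ∈ M.carrier :=
  AEC.exists_hull hs.infinite hs.LST_le hN hc hA hAc

theorem IsFrame.exists_le_memCard (hs : s.IsFrame lam κ) (hM : s.K.memCard (succ lam) M) :
    ∃ N, s.K.le N M ∧ s.K.memCard lam N := by
  obtain ⟨N, h1, h2, -⟩ := hs.exists_hull hM.1 ((le_succ lam).trans hM.2.ge) (A := ∅)
    (fun x hx => absurd hx (Set.notMem_empty x)) (by simp [CardLE])
  exact ⟨N, h1, h2⟩

theorem IsFrame.exists_common_extension (hs : s.IsFrame lam κ) (h₀ : s.K.memCard lam N₀)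
    (h₁ : s.K.memCard lam N₁) (h₀M : s.K.le N₀ M) (h₁M : s.K.le N₁ M) :
    ∃ N, s.K.memCard lam N ∧ s.K.le N M ∧ s.K.le N₀ N ∧ s.K.le N₁ N := by
  obtain ⟨N, hN, hNc, hNA⟩ := hs.exists_hull h₀M.mem_right (h₀.2.ge.trans h₀M.card_le)
    (A := {x | x ∈ N₀.carrier} ∪ {x | x ∈ N₁.carrier})
    (fun x hx => hx.elim h₀M.sub.subset h₁M.sub.subset)
    ((cardLE_carrier.2 h₀.2.le).union hs.infinite (cardLE_carrier.2 h₁.2.le))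
  exact ⟨N, hNc, hN, le.of_subset h₀M hN fun x hx => hNA x (Or.inl hx),
    le.of_subset h₁M hN fun x hx => hNA x (Or.inr hx)⟩

theorem IsFrame.nonFork_basic (hs : s.IsFrame lam κ) {p : s.K.GType M₁} (h : s.NonFork M₀ p) :
    s.K.memCard lam M₀ ∧ s.K.memCard lam M₁ ∧ p ∈ s.Sbs M₁ ∧
      ∃ hle : s.K.le M₀ M₁, p.restrict hle ∈ s.Sbs M₀ := by
  obtain ⟨N, h, a, ha, rfl, hd⟩ := h
  obtain ⟨h0, h1, h3, hle, -, _, _, _, hb0, hb1⟩ := hs.dnf_basic _ _ _ _ hd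
  exact ⟨h0, h1, hb1, hle, hb0⟩

theorem IsFrame.nonFork_restrict (hs : s.IsFrame lam κ) {p : s.K.GType M₁} (h : s.NonFork M₀ p)
    (h₀ : s.K.le M₀ N₀) (h₀₁ : s.K.le N₀ N₁) (h₁ : s.K.le N₁ M₁) (hN₀ : s.K.memCard lam N₀)
    (hN₁ : s.K.memCard lam N₁) : s.NonFork N₀ (p.restrict h₁) := by
  obtain ⟨N, h, a, ha, rfl, hd⟩ := h
  obtain ⟨hM0, hM1, hN, -⟩ := hs.dnf_basic _ _ _ _ hd
  refine ⟨N, s.K.trans _ _ _ h₁ h, a, ha, rfl, ?_⟩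
  refine hs.monotonicity M₀ N₀ N₁ M₁ N N N a ?_ h₀ h₀₁ h₁ h (s.K.refl _ hN.1) ?_ ha
    (s.K.refl _ hN.1) hd
  · simp [hM0, hM1, hN, hN₀, hN₁]
  · exact fun x hx => h.sub.subset (h₁.sub.subset hx)

theorem IsFrame.nonFork_base_mono (hs : s.IsFrame lam κ) {p : s.K.GType M₁} (h : s.NonFork M₀ p)
    (h₀ : s.K.le M₀ N₀) (h₀₁ : s.K.le N₀ M₁) (hN₀ : s.K.memCard lam N₀) : s.NonFork N₀ p := by
  have hM₁ := (hs.nonFork_basic h).2.1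
  have := hs.nonFork_restrict h h₀ h₀₁ (s.K.refl _ hM₁.1) hN₀ hM₁
  rwa [restrict_self] at this

theorem IsFrame.exists_nonFork_extension (hs : s.IsFrame lam κ) (h : s.K.le M N)
    (hM : s.K.memCard lam M) (hN : s.K.memCard lam N) {p : s.K.GType M} (hp : p ∈ s.Sbs M) :
    ∃ q : s.K.GType N, s.NonFork M q ∧ q.restrict h = p := by
  by_cases hlt : s.K.lt M N
  · obtain ⟨q, -, hq⟩ := hs.extension M N h hM hN hlt p hp
    exact ⟨q, hq⟩
  · -- a type over `M` itself: extend it to a proper extension of `M` and restrict it again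
    have hc : M.carrier = N.carrier := by
      by_contra hne
      exact hlt ⟨h, hne⟩
    obtain rfl := Sub.antisymm h.sub fun x hx => hc ▸ hx
    obtain ⟨P, hP, hMP⟩ := hs.noMaximal M hM
    obtain ⟨q, -, hq, rfl⟩ := hs.extension M P hMP.1 hM hP hMP p hp
    exact ⟨_, hs.nonFork_restrict hq h h hMP.1 hM hM, restrict_self _ _⟩

theorem IsFrame.nonFork_unique (hs : s.IsFrame lam κ) (h : s.K.le M N) {p q : s.K.GType N}
    (hp : s.NonFork M p) (hq : s.NonFork M q) (e : p.restrict h = q.restrict h) : p = q := by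
  obtain ⟨hM, hN, hpb, -⟩ := hs.nonFork_basic hp
  exact hs.uniqueness M N h hM hN p hpb q (hs.nonFork_basic hq).2.2.1 hp hq e

/-- Transitivity of non-forking: the non-forking extension of `p ↾ M₀` agrees with `p` over `M₁` by
uniqueness, hence over `M`. -/
theorem IsFrame.nonFork_trans (hs : s.IsFrame lam κ) {p : s.K.GType M} (h : s.NonFork M₁ p)
    (h₁ : s.K.le M₁ M) (h' : s.NonFork M₀ (p.restrict h₁)) : s.NonFork M₀ p := by
  obtain ⟨hM₁, hM, -, -⟩ := hs.nonFork_basic h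
  obtain ⟨hM₀, -, -, h₀, hb⟩ := hs.nonFork_basic h'
  obtain ⟨q, hq, hqp⟩ := hs.exists_nonFork_extension (s.K.trans _ _ _ h₀ h₁) hM₀ hM hb
  have e : q.restrict h₁ = p.restrict h₁ := by
    refine hs.nonFork_unique h₀ (hs.nonFork_restrict hq (s.K.refl _ hM₀.1) h₀ h₁ hM₀ hM₁) h' ?_
    rw [← hqp, restrict_restrict]
  rwa [← hs.nonFork_unique h₁ (hs.nonFork_base_mono hq h₀ h₁ hM₁) h e]

theorem IsFrame.notMem_of_nonFork (hs : s.IsFrame lam κ) {h : s.K.le M₁ N} {a : ZFSet.{u}}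
    {ha : a ∈ N.carrier} (hn : s.NonFork M₀ (AEC.tp h a ha)) : a ∉ M₁.carrier := by
  obtain ⟨N', h', b, hb, e, hd⟩ := hn
  obtain ⟨-, -, -, -, hbM, -⟩ := hs.dnf_basic _ _ _ _ hd
  rwa [mem_iff_of_tp_eq e]

theorem IsFrame.nonFork_iso (hs : s.IsFrame lam κ) {M₀' M₁' N' : Model L}
    {f : ZFSet.{u} → ZFSet.{u}} (hN : Iso f N N') (hM₀ : Iso f M₀ M₀') (hM₁ : Iso f M₁ M₁')
    (h : s.K.le M₁ N) (h' : s.K.le M₁' N') (h₀' : s.K.le M₀' M₁') {a : ZFSet.{u}}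
    {ha : a ∈ N.carrier} (ha' : f a ∈ N'.carrier) (hn : s.NonFork M₀ (AEC.tp h a ha)) :
    s.NonFork M₀' (AEC.tp h' (f a) ha') := by
  obtain ⟨P, hP, b, hb, e, hd⟩ := hn
  obtain ⟨-, -, -, h₀, -⟩ := hs.dnf_basic _ _ _ _ hd
  -- transport `P` to an extension of `M₁'`
  obtain ⟨g, hg, hgf, hfg⟩ := hM₁.symm
  have hE : s.K.SEmb g M₁' P := ⟨M₁, hP, hg⟩
  obtain ⟨P', -, k, hle, -, hk, -, hkM, -, -⟩ := hE.exists_rename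
  have hkf : ∀ x ∈ M₁.carrier, k x = f x := fun x hx => by
    have := hkM (f x) (hM₁.emb.mapsTo hx)
    rwa [hgf x hx] at this
  have hkb := hk.emb.mapsTo hb
  refine ⟨P', hle, k b, hkb,
    tp_eq_of_iso hM₁ hN hk (fun _ _ => rfl) hkf h hP h' hle ha hb ha' hkb e, ?_⟩
  obtain ⟨F, hF⟩ := hk
  have h1 : IsImage F M₁ M₁' :=
    Iso.isImage hF (hM₁.congr fun x hx => (hkf x hx).symm) hP.sub hle.sub
  have h0 : IsImage F M₀ M₀' := Iso.isImage hF
    (hM₀.congr fun x hx => (hkf x (h₀.sub.subset hx)).symm) (h₀.sub.trans hP.sub)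
    (h₀'.sub.trans hle.sub)
  have := hs.dnf_iso M₀ M₁ P M₀' M₁' P' F ⟨b, hb⟩ h0 h1 hd
  rwa [hF] at this

/-! ### Non-forking over small models in large models -/

/-- The type `p` over a model `M` of cardinality at least `lam` does not fork over the submodel
`N₀ ∈ K_lam` of `M`: none of its restrictions to models of cardinality `lam` between `N₀` and `M`
forks over `N₀`. -/
def NonForkSmall (s : PreFrame L) (lam : Cardinal.{u}) (N₀ : Model L) {M : Model L}
    (p : s.K.GType M) : Prop :=
  s.K.memCard lam N₀ ∧ s.K.le N₀ M ∧ ∀ (N : Model L) (hN : s.K.le N M), s.K.memCard lam N →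
    s.K.le N₀ N → s.NonFork N₀ (p.restrict hN)

variable {p q : s.K.GType M}

theorem NonForkSmall.restrict (h : s.NonForkSmall lam N₀ p) (h₀ : s.K.le N₀ N) (hN : s.K.le N M) :
    s.NonForkSmall lam N₀ (p.restrict hN) := by
  refine ⟨h.1, h₀, fun P hP hPc h₀P => ?_⟩
  rw [restrict_restrict]
  exact h.2.2 P _ hPc h₀P

theorem NonForkSmall.self (h : s.NonForkSmall lam N₀ p) : s.NonFork N₀ (p.restrict h.2.1) :=
  h.2.2 N₀ h.2.1 h.1 (s.K.refl _ h.1.1)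

theorem NonForkSmall.base_mono (hs : s.IsFrame lam κ) (h : s.NonForkSmall lam N₀ p)
    (h₀₁ : s.K.le N₀ N₁) (h₁ : s.K.le N₁ M) (hN₁ : s.K.memCard lam N₁) :
    s.NonForkSmall lam N₁ p :=
  ⟨hN₁, h₁, fun P hP hPc h₁P => hs.nonFork_base_mono (h.2.2 P hP hPc (s.K.trans _ _ _ h₀₁ h₁P))
    h₀₁ h₁P hN₁⟩

/-- Not forking over `N₀` may be checked on cofinally many small models. -/
theorem NonForkSmall.of_cofinal (hs : s.IsFrame lam κ) (hN₀ : s.K.memCard lam N₀)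
    (h₀ : s.K.le N₀ M)
    (h : ∀ N, s.K.le N M → s.K.memCard lam N → s.K.le N₀ N →
      ∃ (P : Model L) (hP : s.K.le P M), s.K.le N P ∧ s.NonFork N₀ (p.restrict hP)) :
    s.NonForkSmall lam N₀ p := by
  refine ⟨hN₀, h₀, fun N hN hNc h₀N => ?_⟩
  obtain ⟨P, hP, hNP, hn⟩ := h N hN hNc h₀N
  have := hs.nonFork_restrict hn (s.K.refl _ hN₀.1) h₀N hNP hN₀ hNc
  rwa [restrict_restrict] at this

theorem NonForkSmall.trans (hs : s.IsFrame lam κ) (h : s.NonForkSmall lam N₁ p)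
    (h₁ : s.K.le N₁ M) (h' : s.NonFork N₀ (p.restrict h₁)) : s.NonForkSmall lam N₀ p := by
  obtain ⟨hN₀, -, -, h₀₁, -⟩ := hs.nonFork_basic h'
  refine NonForkSmall.of_cofinal hs hN₀ (s.K.trans _ _ _ h₀₁ h₁) fun N hN hNc h₀N => ?_
  obtain ⟨P, hP, hPM, hNP, h₁P⟩ := hs.exists_common_extension hNc h.1 hN h₁
  refine ⟨P, hPM, hNP, hs.nonFork_trans (h.2.2 P hPM hP h₁P) h₁P ?_⟩
  rwa [restrict_restrict]

theorem NonForkSmall.notMem (hs : s.IsFrame lam κ) {h : s.K.le M N} {a : ZFSet.{u}}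
    {ha : a ∈ N.carrier} (hn : s.NonForkSmall lam N₀ (AEC.tp h a ha)) : a ∉ M.carrier := by
  intro haM
  obtain ⟨P, hP, hPc, hPA⟩ := hs.exists_hull hn.2.1.mem_right (hn.1.2.ge.trans hn.2.1.card_le)
    (A := insert a {x | x ∈ N₀.carrier})
    (fun x hx => hx.elim (fun e => e ▸ haM) hn.2.1.sub.subset)
    ((cardLE_carrier.2 hn.1.2.le).insert hs.infinite a)
  exact hs.notMem_of_nonFork (hn.2.2 P hP hPc
    (le.of_subset hn.2.1 hP fun x hx => hPA x (Or.inr hx))) (hPA a (Or.inl rfl))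

/-- Uniqueness of non-forking extensions to models of cardinality `lam⁺`, by tameness. -/
theorem NonForkSmall.unique (hs : s.IsFrame lam κ) (ht : s.K.Tame lam (succ lam))
    (hM : s.K.memCard (succ lam) M) (hp : s.NonForkSmall lam N₀ p) (hq : s.NonForkSmall lam N₀ q)
    (e : p.restrict hp.2.1 = q.restrict hp.2.1) : p = q := by
  refine ht M hM p q fun N hN hNc => ?_
  obtain ⟨P, hP, hPM, hNP, h₀P⟩ := hs.exists_common_extension hNc hp.1 hN hp.2.1
  have : p.restrict hPM = q.restrict hPM := by
    refine hs.nonFork_unique h₀P (hp.2.2 P hPM hP h₀P) (hq.2.2 P hPM hP h₀P) ?_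
    rw [restrict_restrict, restrict_restrict]
    exact e
  rw [← restrict_restrict hNP hPM, this, restrict_restrict]

theorem NonForkSmall.iso (hs : s.IsFrame lam κ) {M' N' : Model L} {f : ZFSet.{u} → ZFSet.{u}}
    (hN : Iso f N N') (hM : Iso f M M') (h : s.K.le M N) (h' : s.K.le M' N') {a : ZFSet.{u}}
    {ha : a ∈ N.carrier} (ha' : f a ∈ N'.carrier)
    (hn : s.NonForkSmall lam N₀ (AEC.tp h a ha)) {N₀' : Model L} (hN₀ : Iso f N₀ N₀')
    (hs₀ : N₀'.Sub M') : s.NonForkSmall lam N₀' (AEC.tp h' (f a) ha') := by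
  refine ⟨memCard_of_iso hN₀ hn.1, le_of_iso hM hN₀ hs₀ hn.2.1, fun P' hP' hPc' h₀P' => ?_⟩
  obtain ⟨P, hPP', hPM⟩ := hM.exists_preimage hP'.sub
  obtain ⟨g, hg, hgf, hfg⟩ := hM.symm
  have hP : s.K.le P M := by
    obtain ⟨k, hk, hkf, hfk⟩ := hPP'.symm
    refine le_of_iso hg (hk.congr fun x hx => ?_) hPM hP'
    have h1 := hgf (k x) (hPM.subset (hk.emb.mapsTo hx))
    rw [hfk x hx] at h1
    exact h1.symm
  have h₀P : s.K.le N₀ P := le.of_subset hn.2.1 hP fun x hx => by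
    obtain ⟨y, hy, e⟩ := hPP'.surj (h₀P'.sub.subset (hN₀.emb.mapsTo hx))
    rwa [← hM.emb.inj (hPM.subset hy) (hn.2.1.sub.subset hx) e]
  obtain ⟨k, hk, -⟩ := hPP'.symm
  exact hs.nonFork_iso hN hN₀ hPP' _ _ h₀P' ha' (hn.2.2 P hP (memCard_of_iso hk hPc') h₀P)

/-! ### The lifted frame in terms of types -/

theorem dnfGE_iff (hs : s.IsFrame lam κ) {a : ZFSet.{u}} (h₀₁ : s.K.le M₀ M₁)
    (hM₀ : lam ≤ M₀.card) : s.dnfGE lam M₀ M₁ a N ↔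
    ∃ (h : s.K.le M₁ N) (ha : a ∈ N.carrier) (N₀ : Model L), s.K.le N₀ M₀ ∧
      s.NonForkSmall lam N₀ (AEC.tp h a ha) := by
  constructor
  · rintro ⟨-, -, -, -, -, h, ha, N₀, hN₀, h₀, hn⟩
    exact ⟨h, ha, N₀, h₀, hN₀, s.K.trans _ _ _ h₀ h₀₁, fun P hP hPc h₀P =>
      hn P hP hPc fun x hx => h₀P.sub.subset hx⟩
  · rintro ⟨h, ha, N₀, h₀, hn⟩
    refine ⟨hM₀, hM₀.trans h₀₁.card_le, hM₀.trans (h₀₁.card_le.trans h.card_le), h₀₁, hn.notMem hs,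
      h, ha, N₀, hn.1, h₀, fun P hP hPc h₀P => hn.2.2 P hP hPc ?_⟩
    exact le.of_subset hn.2.1 hP h₀P

theorem mem_plus_Sbs_iff (hs : s.IsFrame lam κ) : p ∈ (s.plus lam).Sbs M ↔
    s.K.memCard (succ lam) M ∧ ∃ N₀, s.NonForkSmall lam N₀ p := by
  refine and_congr_right fun hM => ⟨?_, ?_⟩
  · rintro ⟨N, hN, hNM, P, h, a, ha, rfl, hd⟩
    obtain ⟨_, _, N₀, -, hn⟩ := (dnfGE_iff hs hNM hN.2.ge).1 hd
    exact ⟨N₀, hn⟩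
  · rintro ⟨N₀, hn⟩
    obtain ⟨P, h, a, ha, rfl⟩ := exists_rep p
    exact ⟨N₀, hn.1, hn.2.1, P, h, a, ha, rfl,
      (dnfGE_iff hs hn.2.1 hn.1.2.ge).2 ⟨h, ha, N₀, s.K.refl _ hn.1.1, hn⟩⟩

theorem plus_dnf_iff (hs : s.IsFrame lam κ) {a : ZFSet.{u}} : (s.plus lam).dnf M₀ M₁ a N ↔
    s.K.memCard (succ lam) M₀ ∧ s.K.memCard (succ lam) M₁ ∧ s.K.memCard (succ lam) N ∧
      s.K.le M₀ M₁ ∧ ∃ (h : s.K.le M₁ N) (ha : a ∈ N.carrier) (N₀ : Model L), s.K.le N₀ M₀ ∧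
        s.NonForkSmall lam N₀ (AEC.tp h a ha) := by
  refine and_congr_right fun h0 => and_congr_right fun h1 => and_congr_right fun h3 => ?_
  have hc : lam ≤ M₀.card := (le_succ lam).trans h0.2.ge
  exact ⟨fun hd => ⟨hd.2.2.2.1, (dnfGE_iff hs hd.2.2.2.1 hc).1 hd⟩,
    fun ⟨hle, h⟩ => (dnfGE_iff hs hle hc).2 h⟩

theorem plus_nonFork_iff (hs : s.IsFrame lam κ) : (s.plus lam).NonFork M₀ p ↔
    s.K.memCard (succ lam) M₀ ∧ s.K.memCard (succ lam) M ∧ s.K.le M₀ M ∧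
      ∃ N₀, s.K.le N₀ M₀ ∧ s.NonForkSmall lam N₀ p := by
  constructor
  · rintro ⟨N, h, a, ha, rfl, hd⟩
    obtain ⟨h0, h1, -, hle, _, _, N₀, h₀, hn⟩ := (plus_dnf_iff hs).1 hd
    exact ⟨h0, h1, hle, N₀, h₀, hn⟩
  · rintro ⟨h0, h1, hle, N₀, h₀, hn⟩
    obtain ⟨N, h, a, ha, hN, rfl⟩ := exists_rep_memCard (hs.infinite.trans (le_succ lam))
      (hs.LST_le.trans (le_succ lam)) h1 p
    exact ⟨N, h, a, ha, rfl, (plus_dnf_iff hs).2 ⟨h0, h1, hN, hle, h, ha, N₀, h₀, hn⟩⟩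

end PreFrame

/-! ### Direct limits of embeddings -/

namespace AEC

variable {K : AEC L} {κ : Cardinal.{u}} {M M' N : Model L} {φ : ZFSet.{u} → ZFSet.{u}}
  {a : ZFSet.{u}}

/-- A coherent sequence of functions on a chain of models has a common extension. -/
theorem exists_glue {δ : Ordinal.{u}} {F : Ordinal.{u} → Model L}
    (φ : Ordinal.{u} → ZFSet.{u} → ZFSet.{u})
    (hφ : ∀ i j, i ≤ j → j < δ → ∀ x ∈ (F i).carrier, φ j x = φ i x) :
    ∃ ψ : ZFSet.{u} → ZFSet.{u}, ∀ i < δ, ∀ x ∈ (F i).carrier, ψ x = φ i x := by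
  classical
  refine ⟨fun x => if h : ∃ i < δ, x ∈ (F i).carrier then φ h.choose x else x, fun i hi x hx => ?_⟩
  have h : ∃ i < δ, x ∈ (F i).carrier := ⟨i, hi, hx⟩
  refine (dif_pos h).trans ?_
  obtain ⟨hj, hxj⟩ := h.choose_spec
  rcases le_total i h.choose with hij | hij
  · exact hφ _ _ hij hj x hx
  · exact (hφ _ _ hij hi x hxj).symm

/-- Limit stage of a direct system of realizations: the union of the embeddings realizes a type that
extends the types realized so far. -/
theorem RealizesVia.limit {δ : Ordinal.{u}} (hδ : IsSuccLimit δ) {F S : Ordinal.{u} → Model L}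
    (hF : IncreasingContinuous K.le F δ) (hM : IsUnion F δ M)
    (hS : IncreasingContinuous K.le S δ) (hN : IsUnion S δ N)
    {p : ∀ i, i < δ → K.GType (F i)} (h : ∀ i hi, K.RealizesVia φ (F i) (S i) a (p i hi)) :
    ∃ q : K.GType M, K.RealizesVia φ M N a q ∧
      ∀ i hi (hle : K.le (F i) M), q.restrict hle = p i hi := by
  have hE : K.SEmb φ M N := SEmb.union hδ hF hM hS hN fun i hi => (h i hi).sEmb
  have ha : a ∈ N.carrier := (hN.1 0 hδ.bot_lt).subset (h 0 hδ.bot_lt).mem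
  obtain ⟨N', g, b, hle, hb, -, -, -, hq⟩ := hE.exists_realizesVia ha
  refine ⟨_, hq, fun i hi hle => (hq.restrict hle).unique ((h i hi).trans_le ?_)⟩
  exact K.le_union δ S N hδ hS hN i hi

/-- Successor stage of a direct system of realizations: if `a` realizes the restriction of `q` via
an embedding of `M`, it realizes `q` via some extension of that embedding to `M'`, in a larger
model. -/
theorem RealizesVia.exists_extend (hA : K.Amalgamation κ) (hκ : ℵ₀ ≤ κ) (hL : K.LST ≤ κ)
    (hM : K.memCard κ M) (hM' : K.memCard κ M') (hN : K.memCard κ N) (hle : K.le M M')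
    {q : K.GType M'} (h : K.RealizesVia φ M N a (q.restrict hle)) :
    ∃ (P : Model L) (ψ : ZFSet.{u} → ZFSet.{u}), K.memCard κ P ∧ K.le N P ∧
      (∀ x ∈ M.carrier, ψ x = φ x) ∧ K.RealizesVia ψ M' P a q := by
  obtain ⟨N₂, h₂, b, hb, hN₂, rfl⟩ := exists_rep_memCard hκ hL hM' q
  obtain ⟨N₁, g, c, h₁, hc, hg, hgM, rfl, hq⟩ := h.sEmb.exists_realizesVia h.mem
  obtain ⟨g', hg', hgg', hgg''⟩ := hg.symm
  obtain ⟨P, f, k, hP, hf, hk, hfM, hkM, e⟩ := hA.exists_of_tp_eq hκ hL hM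
    (memCard_of_iso hg' hN) hN₂ (hq.unique h)
  obtain ⟨P', -, j, hNP, -, hj, -, hjf, -, -⟩ :=
    ((sEmb_of_iso hg' hN.1).comp hf).exists_rename
  simp only [Function.comp_apply] at hjf
  have hjf' : ∀ x ∈ N₁.carrier, j (f x) = g x := fun x hx => by
    have := hjf (g x) (hg.emb.mapsTo hx)
    rwa [hgg' x hx] at this
  refine ⟨P', j ∘ k, memCard_of_iso hj hP, hNP, fun x hx => ?_, N₂, j ∘ k, b, h₂, hb,
    hk.comp (sEmb_of_iso hj hP.1), fun _ _ => rfl, ?_, rfl⟩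
  · rw [Function.comp_apply, hkM x hx, ← hgM x hx, ← hjf' x (h₁.sub.subset hx), hfM x hx]
  · rw [Function.comp_apply, ← e, hjf' c hc]

end AEC

namespace PreFrame

variable {s : PreFrame L} {lam κ : Cardinal.{u}} {M N N₀ : Model L}

/-! ### Extension to models of cardinality `lam⁺` -/

/-- Existence of non-forking extensions over models of cardinality `lam⁺`. Along a filtration `F`
of `M` with `F 0 = N₀`, the non-forking extensions `p i` of `p` to `F i` are unique, hence
coherent. One element `a` realizes all of them at once, through a direct system of embeddings of
the `F i` into models of cardinality `lam`; continuity of the frame takes care of the limit stages.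
-/
theorem IsFrame.exists_nonForkSmall_extension (hs : s.IsFrame lam κ) (hN₀ : s.K.memCard lam N₀)
    (hM : s.K.memCard (succ lam) M) (h₀ : s.K.le N₀ M) {p : s.K.GType N₀} (hp : p ∈ s.Sbs N₀) :
    ∃ q : s.K.GType M, s.NonForkSmall lam N₀ q ∧ q.restrict h₀ = p := by
  obtain ⟨F, rfl, hF, hFM, hmem⟩ := exists_filtration hs.infinite hs.LST_le hM hN₀ h₀
  have hlim := isSuccLimit_ord_succ hs.infinite
  have h0lt : 0 < (succ lam).ord := hlim.bot_lt
  have h0le : ∀ i < (succ lam).ord, s.K.le (F 0) (F i) := fun i hi => hF.1 0 i zero_le hi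
  choose P hP hPp using fun i (hi : i < (succ lam).ord) =>
    hs.exists_nonFork_extension (h0le i hi) hN₀ (hmem i hi).1 hp
  have hcoh : ∀ i j hi hj (hle : s.K.le (F i) (F j)), (P j hj).restrict hle = P i hi := by
    intro i j hi hj hle
    refine hs.nonFork_unique (h0le i hi) (hs.nonFork_restrict (hP j hj) (s.K.refl _ hN₀.1)
      (h0le i hi) hle hN₀ (hmem i hi).1) (hP i hi) ?_
    rw [restrict_restrict, hPp, hPp]
  obtain ⟨N₁, hN₁, a, ha, hN₁c, hPa⟩ :=
    exists_rep_memCard hs.infinite hs.LST_le hN₀ (P 0 h0lt)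
  -- the states are pairs of a model and an embedding of `F i` via which `a` realizes `P i`
  obtain ⟨S, hS⟩ : ∃ S, IsChain
      (fun i (t : Model L × (ZFSet.{u} → ZFSet.{u})) => s.K.memCard lam t.1 ∧
        ∀ hi : i < (succ lam).ord, s.K.RealizesVia t.2 (F i) t.1 a (P i hi))
      (fun i t t' => s.K.le t.1 t'.1 ∧ ∀ x ∈ (F i).carrier, t'.2 x = t.2 x)
      (fun δ S t => IsUnion (fun i => (S i).1) δ t.1) S (succ lam).ord := by
    refine exists_isChain _ _ _ _ (fun i t h => ⟨s.K.refl _ h.1.1, fun _ _ => rfl⟩)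
      (fun i j t t' t'' hij hj h h' => ⟨s.K.trans _ _ _ h.1 h'.1, fun x hx => ?_⟩)
      (fun δ S S' t h ht => ht.congr fun i hi => congrArg Prod.fst (h i hi))
      ⟨(N₁, id), hN₁c, fun _ => hPa ▸ realizesVia_id hN₁ ha⟩
      (fun i t hi h => ?_) (fun δ S hδ hl hS => ?_)
    · rw [h'.2 x ((hF.1 i j hij hj).sub.subset hx), h.2 x hx]
    · have hi' := (lt_add_one i).trans hi
      have hle := hF.1 i (i + 1) (lt_add_one i).le hi
      have hr := h.2 hi'
      rw [← hcoh i (i + 1) hi' hi hle] at hr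
      obtain ⟨N', ψ, hN', hle', hψ, hψr⟩ := hr.exists_extend hs.amalgamation hs.infinite hs.LST_le
        (hmem i hi').1 (hmem _ hi).1 h.1 hle
      exact ⟨(N', ψ), ⟨hN', fun _ => hψr⟩, hle', hψ⟩
    · have hinc : IncreasingContinuous s.K.le (fun i => (S i).1) δ :=
        ⟨fun i j hij hj => (hS.rel i j hij hj).1, fun γ h h' => hS.lim γ h h'⟩
      obtain ⟨N', hN'⟩ := exists_isUnion hl.bot_lt (fun i => (S i).1)
        fun i j h h' => (hinc.1 i j h h').sub
      obtain ⟨ψ, hψ⟩ := exists_glue (F := F) (fun i => (S i).2)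
        fun i j hij hj x hx => (hS.rel i j hij hj).2 x hx
      refine ⟨(N', ψ), ⟨IsUnion.memCard hs.infinite hl (mk_Iio_le hδ) hinc hN' fun α hα =>
        (hS.good α hα).1, fun _ => ?_⟩, hN', fun i hi =>
        ⟨s.K.le_union δ _ _ hl hinc hN' i hi, hψ i hi⟩⟩
      obtain ⟨q, hq, hqP⟩ := RealizesVia.limit hl (hF.mono hδ.le) (hF.2 δ hδ hl) hinc hN'
        (p := fun i hi => P i (hi.trans hδ)) (φ := ψ) (a := a)
        fun i hi => ((hS.good i hi).2 _).congr fun x hx => (hψ i hi x hx).symm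
      obtain ⟨-, hqn⟩ := hs.continuity δ F hl hδ (fun α hα => (hmem α (hα.trans_lt hδ)).1)
        (hF.mono (Order.add_one_le_of_lt hδ)) q fun α hα hle => by
          rw [hqP α hα hle]
          exact hP α _
      have : q = P δ hδ := by
        refine hs.nonFork_unique (h0le δ hδ) hqn (hP δ hδ) ?_
        rw [hPp, hqP 0 hl.bot_lt, ← hPp 0 h0lt, restrict_self]
      exact this ▸ hq
  have hinc : IncreasingContinuous s.K.le (fun i => (S i).1) (succ lam).ord :=
    ⟨fun i j hij hj => (hS.rel i j hij hj).1, fun γ h h' => hS.lim γ h h'⟩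
  obtain ⟨N', hN'⟩ := exists_isUnion h0lt (fun i => (S i).1) fun i j h h' => (hinc.1 i j h h').sub
  obtain ⟨ψ, hψ⟩ := exists_glue (F := F) (fun i => (S i).2)
    fun i j hij hj x hx => (hS.rel i j hij hj).2 x hx
  obtain ⟨q, hq, hqP⟩ := RealizesVia.limit hlim hF hFM hinc hN' (p := P) (φ := ψ) (a := a)
    fun i hi => ((hS.good i hi).2 _).congr fun x hx => (hψ i hi x hx).symm
  refine ⟨q, NonForkSmall.of_cofinal hs hN₀ h₀ fun N hN hNc _ => ?_, ?_⟩
  · obtain ⟨i, hi, hNi⟩ := exists_subset_of_isUnion hs.infinite hF hFM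
      (cardLE_carrier.2 hNc.2.le) fun x hx => hN.sub.subset hx
    refine ⟨F i, (hmem i hi).2, le.of_subset hN (hmem i hi).2 hNi, ?_⟩
    rw [hqP i hi]
    exact hP i hi
  · rw [hqP 0 h0lt, ← hPp 0 h0lt, restrict_self]

/-! ### Joint embedding -/

/-- Filtrations of the two models are embedded step by step into a common chain of models of
cardinality `lam`, by amalgamation in `lam`. -/
theorem IsFrame.jointEmbedding_succ (hs : s.IsFrame lam κ) : s.K.JointEmbedding (succ lam) := by
  intro M₁ M₂ hM₁ hM₂
  have hlim := isSuccLimit_ord_succ hs.infinite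
  have h0lt : 0 < (succ lam).ord := hlim.bot_lt
  obtain ⟨N₁, h₁, hN₁⟩ := hs.exists_le_memCard hM₁
  obtain ⟨N₂, h₂, hN₂⟩ := hs.exists_le_memCard hM₂
  obtain ⟨F, rfl, hF, hFM, hmem⟩ := exists_filtration hs.infinite hs.LST_le hM₁ hN₁ h₁
  obtain ⟨G, rfl, hG, hGM, hmem'⟩ := exists_filtration hs.infinite hs.LST_le hM₂ hN₂ h₂
  obtain ⟨P, hP, f, g, hf, hg⟩ := hs.jointEmbedding _ _ hN₁ hN₂
  obtain ⟨φ, hφ⟩ := exists_fun f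
  obtain ⟨ψ, hψ⟩ := exists_fun g
  rw [isStrong_iff hφ] at hf
  rw [isStrong_iff hψ] at hg
  obtain ⟨S, hS⟩ : ∃ S, IsChain
      (fun i (t : Model L × (ZFSet.{u} → ZFSet.{u}) × (ZFSet.{u} → ZFSet.{u})) =>
        s.K.memCard lam t.1 ∧ s.K.SEmb t.2.1 (F i) t.1 ∧ s.K.SEmb t.2.2 (G i) t.1)
      (fun i t t' => s.K.le t.1 t'.1 ∧ (∀ x ∈ (F i).carrier, t'.2.1 x = t.2.1 x) ∧
        ∀ x ∈ (G i).carrier, t'.2.2 x = t.2.2 x)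
      (fun δ S t => IsUnion (fun i => (S i).1) δ t.1) S (succ lam).ord := by
    refine exists_isChain _ _ _ _
      (fun i t h => ⟨s.K.refl _ h.1.1, fun _ _ => rfl, fun _ _ => rfl⟩)
      (fun i j t t' t'' hij hj h h' => ⟨s.K.trans _ _ _ h.1 h'.1, fun x hx => ?_, fun x hx => ?_⟩)
      (fun δ S S' t h ht => ht.congr fun i hi => congrArg Prod.fst (h i hi))
      ⟨(P, φ, ψ), hP, hf, hg⟩
      (fun i t hi h => ?_) (fun δ S hδ hl hS => ?_)
    · rw [h'.2.1 x ((hF.1 i j hij hj).sub.subset hx), h.2.1 x hx]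
    · rw [h'.2.2 x ((hG.1 i j hij hj).sub.subset hx), h.2.2 x hx]
    · have hi' := (lt_add_one i).trans hi
      obtain ⟨Q, φ', hQ, hle, hφ', e⟩ := hs.amalgamation.exists_extend (hmem i hi').1
        (hmem _ hi).1 h.1 (hF.1 i (i + 1) (lt_add_one i).le hi) h.2.1
      obtain ⟨Q', ψ', hQ', hle', hψ', e'⟩ := hs.amalgamation.exists_extend (hmem' i hi').1
        (hmem' _ hi).1 hQ (hG.1 i (i + 1) (lt_add_one i).le hi) (h.2.2.trans_le hle)
      exact ⟨(Q', φ', ψ'), ⟨hQ', hφ'.trans_le hle', hψ'⟩, s.K.trans _ _ _ hle hle', e, e'⟩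
    · have hinc : IncreasingContinuous s.K.le (fun i => (S i).1) δ :=
        ⟨fun i j hij hj => (hS.rel i j hij hj).1, fun γ h h' => hS.lim γ h h'⟩
      obtain ⟨N', hN'⟩ := exists_isUnion hl.bot_lt (fun i => (S i).1)
        fun i j h h' => (hinc.1 i j h h').sub
      obtain ⟨α, hα⟩ := exists_glue (F := F) (fun i => (S i).2.1)
        fun i j hij hj x hx => (hS.rel i j hij hj).2.1 x hx
      obtain ⟨β, hβ⟩ := exists_glue (F := G) (fun i => (S i).2.2)
        fun i j hij hj x hx => (hS.rel i j hij hj).2.2 x hx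
      refine ⟨(N', α, β), ⟨IsUnion.memCard hs.infinite hl (mk_Iio_le hδ) hinc hN' fun α hα =>
        (hS.good α hα).1, ?_, ?_⟩, hN', fun i hi =>
        ⟨s.K.le_union δ _ _ hl hinc hN' i hi, hα i hi, hβ i hi⟩⟩
      · exact SEmb.union hl (hF.mono hδ.le) (hF.2 δ hδ hl) hinc hN' fun i hi =>
          (hS.good i hi).2.1.congr fun x hx => (hα i hi x hx).symm
      · exact SEmb.union hl (hG.mono hδ.le) (hG.2 δ hδ hl) hinc hN' fun i hi =>
          (hS.good i hi).2.2.congr fun x hx => (hβ i hi x hx).symm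
  have hinc : IncreasingContinuous s.K.le (fun i => (S i).1) (succ lam).ord :=
    ⟨fun i j hij hj => (hS.rel i j hij hj).1, fun γ h h' => hS.lim γ h h'⟩
  obtain ⟨N', hN'⟩ := exists_isUnion h0lt (fun i => (S i).1) fun i j h h' => (hinc.1 i j h h').sub
  obtain ⟨α, hα⟩ := exists_glue (F := F) (fun i => (S i).2.1)
    fun i j hij hj x hx => (hS.rel i j hij hj).2.1 x hx
  obtain ⟨β, hβ⟩ := exists_glue (F := G) (fun i => (S i).2.2)
    fun i j hij hj x hx => (hS.rel i j hij hj).2.2 x hx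
  have h1 : s.K.SEmb α M₁ N' := SEmb.union hlim hF hFM hinc hN' fun i hi =>
    (hS.good i hi).2.1.congr fun x hx => (hα i hi x hx).symm
  have h2 : s.K.SEmb β M₂ N' := SEmb.union hlim hG hGM hinc hN' fun i hi =>
    (hS.good i hi).2.2.congr fun x hx => (hβ i hi x hx).symm
  have hcard : N'.card ≤ succ lam := by
    refine hN'.card_le (hs.infinite.trans (le_succ lam)) ?_ fun i hi =>
      (hS.good i hi).1.2.le.trans (le_succ lam)
    rw [Cardinal.mk_Iio_ordinal, Cardinal.card_ord]
  obtain ⟨f', hf', -⟩ := h1.exists_isStrong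
  obtain ⟨g', hg', -⟩ := h2.exists_isStrong
  exact ⟨N', ⟨h1.mem_right, le_antisymm hcard (hM₁.2.ge.trans h1.emb.card_le)⟩, f', g', hf', hg'⟩

end PreFrame

/-! ### Density of basic types -/

/-- A continuous chain of limit length `δ` is prolonged by its union, as member `δ`, and by an
extension of the union, as member `δ + 1`. -/
theorem IncreasingContinuous.exists_append {K : AEC L} {δ : Ordinal.{u}} (hδ : IsSuccLimit δ)
    {F : Ordinal.{u} → Model L} {U V : Model L} (hF : IncreasingContinuous K.le F δ)
    (hU : IsUnion F δ U) (hUV : K.le U V) :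
    ∃ F' : Ordinal.{u} → Model L, (∀ i < δ, F' i = F i) ∧ F' δ = U ∧ F' (δ + 1) = V ∧
      IncreasingContinuous K.le F' (δ + 2) := by
  classical
  let F' : Ordinal.{u} → Model L := fun i => if i < δ then F i else if i = δ then U else V
  have h1 : ∀ i < δ, F' i = F i := fun i hi => if_pos hi
  have h2 : F' δ = U := by simp [F']
  have h3 : ∀ i, δ < i → F' i = V := fun i hi => by simp [F', hi.not_gt, hi.ne']
  have hFU := K.le_union δ F U hδ hF hU
  refine ⟨F', h1, h2, h3 _ (lt_add_one δ), fun i j hij _ => ?_, fun γ hγ hl => ?_⟩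
  · rcases lt_trichotomy i δ with hi | rfl | hi
    · rw [h1 i hi]
      rcases lt_trichotomy j δ with hj | rfl | hj
      · rw [h1 j hj]
        exact hF.1 i j hij hj
      · rw [h2]
        exact hFU i hi
      · rw [h3 j hj]
        exact K.trans _ _ _ (hFU i hi) hUV
    · rw [h2]
      rcases hij.lt_or_eq with hj | rfl
      · rw [h3 j hj]
        exact hUV
      · rw [h2]
        exact K.refl _ hUV.mem_left
    · rw [h3 i hi, h3 j (hi.trans_le hij)]
      exact K.refl _ hUV.mem_right
  · rcases lt_trichotomy γ δ with hγ' | rfl | hγ'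
    · rw [h1 γ hγ']
      exact (hF.2 γ hγ' hl).congr fun i hi => (h1 i (hi.trans hγ')).symm
    · rw [h2]
      exact hU.congr fun i hi => (h1 i hi).symm
    · rw [← one_add_one_eq_two, ← add_assoc, Order.lt_add_one_iff] at hγ
      obtain rfl : γ = δ + 1 := le_antisymm hγ (Order.add_one_le_of_lt hγ')
      exact absurd hl (Order.not_isSuccLimit_succ δ)

theorem AEC.tp_congr {K : AEC L} {M N : Model L} (h : K.le M N) {a b : ZFSet.{u}} (e : a = b)
    (ha : a ∈ N.carrier) (hb : b ∈ N.carrier) : tp h a ha = tp h b hb := by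
  subst e
  rfl

namespace PreFrame

variable {s : PreFrame L} {lam κ : Cardinal.{u}} {M M' N N₀ : Model L}

/-- One step of the closing-off argument for density. If every element of `N \ M` forks over every
small submodel of `M`, then small `P ⪯ M` and `Q ⪯ N` have small extensions `P'` and `Q'` such that
`P'` contains `Q ∩ M` and witnesses all forking over `P` of elements of `Q \ M`. -/
theorem IsFrame.exists_closing_step (hs : s.IsFrame lam κ) (h : s.K.le M N)
    (hbad : ∀ (a : ZFSet.{u}) (ha : a ∈ N.carrier), a ∉ M.carrier → ∀ P,
      ¬s.NonForkSmall lam P (AEC.tp h a ha))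
    {P Q : Model L} (hP : s.K.memCard lam P) (hQ : s.K.memCard lam Q) (hPM : s.K.le P M)
    (hQN : s.K.le Q N) :
    ∃ P' Q', s.K.memCard lam P' ∧ s.K.memCard lam Q' ∧ s.K.le P' M ∧ s.K.le Q' N ∧ s.K.le P' Q' ∧
      s.K.le P P' ∧ s.K.le Q Q' ∧ (∀ x ∈ Q.carrier, x ∈ M.carrier → x ∈ P'.carrier) ∧
      ∀ (a : ZFSet.{u}) (ha : a ∈ N.carrier), a ∈ Q.carrier → a ∉ M.carrier →
        ∃ (W : Model L) (hW : s.K.le W M), s.K.memCard lam W ∧ s.K.le P W ∧ s.K.le W P' ∧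
          ¬s.NonFork P (AEC.tp (s.K.trans _ _ _ hW h) a ha) := by
  have hW : ∀ a : Q.carrier, ∃ W, s.K.memCard lam W ∧ s.K.le W M ∧ s.K.le P W ∧
      (a.1 ∉ M.carrier → ∀ (ha : a.1 ∈ N.carrier) (hW : s.K.le W M),
        ¬s.NonFork P (AEC.tp (s.K.trans _ _ _ hW h) a.1 ha)) := by
    intro a
    by_cases haM : a.1 ∈ M.carrier
    · exact ⟨P, hP, hPM, s.K.refl _ hP.1, fun h => absurd haM h⟩
    · have ha : a.1 ∈ N.carrier := hQN.sub.subset a.2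
      have := hbad a ha haM P
      contrapose! this
      refine ⟨hP, hPM, fun W hW hWc hPW => ?_⟩
      obtain ⟨-, _, _, hn⟩ := this W hWc hW hPW
      exact hn
  choose W hWc hWM hPW hWf using hW
  obtain ⟨P', hP', hPc', hPA'⟩ := hs.exists_hull hPM.mem_right (hP.2.ge.trans hPM.card_le)
    (A := ({x | x ∈ P.carrier} ∪ {x | x ∈ Q.carrier ∧ x ∈ M.carrier}) ∪
      ⋃ a : Q.carrier, {x | x ∈ (W a).carrier})
    (fun x hx => by
      rcases hx with (hx | hx) | hx
      · exact hPM.sub.subset hx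
      · exact hx.2
      · obtain ⟨a, hx⟩ := Set.mem_iUnion.1 hx
        exact (hWM a).sub.subset hx)
    (((cardLE_carrier.2 hP.2.le).union hs.infinite
      ((cardLE_carrier.2 hQ.2.le).mono fun x hx => hx.1)).union hs.infinite
        (CardLE.iUnion hs.infinite (cardLE_carrier.2 hQ.2.le) fun a =>
          cardLE_carrier.2 (hWc a).2.le))
  have hP'N := s.K.trans _ _ _ hP' h
  obtain ⟨Q', hQc', hQ', hP'Q', hQQ'⟩ := hs.exists_common_extension hPc' hQ hP'N hQN
  refine ⟨P', Q', hPc', hQc', hP', hQ', hP'Q',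
    le.of_subset hPM hP' fun x hx => hPA' x (Or.inl (Or.inl hx)), hQQ',
    fun x hx hxM => hPA' x (Or.inl (Or.inr ⟨hx, hxM⟩)), fun a ha haQ haM =>
    ⟨W ⟨a, haQ⟩, hWM _, hWc _, hPW _, le.of_subset (hWM _) hP' fun x hx =>
      hPA' x (Or.inr (Set.mem_iUnion.2 ⟨_, hx⟩)), hWf ⟨a, haQ⟩ haM ha (hWM _)⟩⟩

/-- Density of the types over `M` that do not fork over a small submodel. Otherwise a chain of
length `ω` of closing-off steps yields `P ≺ Q` of cardinality `lam` such that every element of `Q \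
P` lies outside `M` and forks over all members of a chain with union `P`; this contradicts density
and local character in `lam`. -/
theorem IsFrame.exists_nonForkSmall_of_lt (hs : s.IsFrame lam κ) (hM : s.K.memCard (succ lam) M)
    (h : s.K.le M N) (hne : M.carrier ≠ N.carrier) :
    ∃ (a : ZFSet.{u}) (ha : a ∈ N.carrier), a ∉ M.carrier ∧
      ∃ P, s.NonForkSmall lam P (AEC.tp h a ha) := by
  by_contra! hbad
  obtain ⟨b, hbN, hbM⟩ : ∃ b ∈ N.carrier, b ∉ M.carrier := by
    by_contra! hsub
    exact hne (ZFSet.ext fun x => ⟨h.sub.subset, hsub x⟩)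
  obtain ⟨P₀, hP₀, hP₀c⟩ := hs.exists_le_memCard hM
  obtain ⟨Q₀, hQ₀, hQ₀c, hQ₀A⟩ := hs.exists_hull h.mem_right
    (hP₀c.2.ge.trans (hP₀.card_le.trans h.card_le)) (A := insert b {x | x ∈ P₀.carrier})
    (fun x hx => hx.elim (fun e => e ▸ hbN) fun hx => h.sub.subset (hP₀.sub.subset hx))
    ((cardLE_carrier.2 hP₀c.2.le).insert hs.infinite b)
  let Good : Model L × Model L → Prop := fun t => s.K.memCard lam t.1 ∧ s.K.memCard lam t.2 ∧
    s.K.le t.1 M ∧ s.K.le t.2 N ∧ s.K.le t.1 t.2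
  have hG₀ : Good (P₀, Q₀) := ⟨hP₀c, hQ₀c, hP₀, hQ₀,
    le.of_subset (s.K.trans _ _ _ hP₀ h) hQ₀ fun x hx => hQ₀A x (Or.inr hx)⟩
  have hstep : ∀ t : {t // Good t}, ∃ t' : {t // Good t}, s.K.le t.1.1 t'.1.1 ∧
      s.K.le t.1.2 t'.1.2 ∧ (∀ x ∈ t.1.2.carrier, x ∈ M.carrier → x ∈ t'.1.1.carrier) ∧
      ∀ (a : ZFSet.{u}) (ha : a ∈ N.carrier), a ∈ t.1.2.carrier → a ∉ M.carrier →
        ∃ (W : Model L) (hW : s.K.le W M), s.K.memCard lam W ∧ s.K.le t.1.1 W ∧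
          s.K.le W t'.1.1 ∧ ¬s.NonFork t.1.1 (AEC.tp (s.K.trans _ _ _ hW h) a ha) := by
    rintro ⟨⟨P, Q⟩, hP, hQ, hPM, hQN, hPQ⟩
    obtain ⟨P', Q', h1, h2, h3, h4, h5, h6, h7, h8, h9⟩ :=
      hs.exists_closing_step h hbad hP hQ hPM hQN
    exact ⟨⟨(P', Q'), h1, h2, h3, h4, h5⟩, h6, h7, h8, h9⟩
  choose next hn1 hn2 hn3 hn4 using hstep
  let t : ℕ → {t // Good t} := fun n => Nat.rec ⟨_, hG₀⟩ (fun _ t => next t) n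
  have hPmono : ∀ m n, m ≤ n → s.K.le (t m).1.1 (t n).1.1 := fun m n hmn =>
    Nat.le_induction (s.K.refl _ (t m).2.1.1) (fun n _ ih => s.K.trans _ _ _ ih (hn1 (t n))) n hmn
  have hQmono : ∀ m n, m ≤ n → s.K.le (t m).1.2 (t n).1.2 := fun m n hmn =>
    Nat.le_induction (s.K.refl _ (t m).2.2.1.1) (fun n _ ih => s.K.trans _ _ _ ih (hn2 (t n))) n hmn
  -- the chains, indexed by ordinals below `ω`
  have hidx : ∀ i : Ordinal.{u}, ∃ n : ℕ, i < Ordinal.omega0 → i = n := fun i => by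
    by_cases hi : i < Ordinal.omega0
    · obtain ⟨n, hn⟩ := Ordinal.lt_omega0.1 hi
      exact ⟨n, fun _ => hn⟩
    · exact ⟨0, fun h => absurd h hi⟩
  choose ν hν using hidx
  have hνmono : ∀ i j, i ≤ j → j < Ordinal.omega0 → ν i ≤ ν j := fun i j hij hj => by
    have h1 := hν i (hij.trans_lt hj)
    have h2 := hν j hj
    rw [h1, h2] at hij
    exact_mod_cast hij
  have hνnat : ∀ n : ℕ, ν n = n := fun n => by
    exact_mod_cast (hν n (Ordinal.natCast_lt_omega0 n)).symm
  have hω : IsSuccLimit (Ordinal.omega0 : Ordinal.{u}) := Ordinal.isSuccLimit_omega0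
  have hωlam : (Ordinal.omega0 : Ordinal.{u}) < (succ lam).ord := by
    rw [← Cardinal.card_le_iff, Ordinal.card_omega0]
    exact hs.infinite
  have hlimω : ∀ γ < Ordinal.omega0, ¬IsSuccLimit (γ : Ordinal.{u}) := fun γ hγ hl =>
    (Ordinal.omega0_le_of_isSuccLimit hl).not_gt hγ
  have hPinc : IncreasingContinuous s.K.le (fun i => (t (ν i)).1.1) Ordinal.omega0 :=
    ⟨fun i j hij hj => hPmono _ _ (hνmono i j hij hj), fun γ hγ hl => absurd hl (hlimω γ hγ)⟩
  have hQinc : IncreasingContinuous s.K.le (fun i => (t (ν i)).1.2) Ordinal.omega0 :=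
    ⟨fun i j hij hj => hQmono _ _ (hνmono i j hij hj), fun γ hγ hl => absurd hl (hlimω γ hγ)⟩
  obtain ⟨P, hP⟩ := exists_isUnion hω.bot_lt _ fun i j h h' => (hPinc.1 i j h h').sub
  obtain ⟨Q, hQ⟩ := exists_isUnion hω.bot_lt _ fun i j h h' => (hQinc.1 i j h h').sub
  have hPc : s.K.memCard lam P := IsUnion.memCard hs.infinite hω (mk_Iio_le hωlam) hPinc hP
    fun i _ => (t (ν i)).2.1
  have hQc : s.K.memCard lam Q := IsUnion.memCard hs.infinite hω (mk_Iio_le hωlam) hQinc hQ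
    fun i _ => (t (ν i)).2.2.1
  have hPM : s.K.le P M := s.K.smooth _ _ _ _ hω hPinc hP fun i _ => (t (ν i)).2.2.2.1
  have hQN : s.K.le Q N := s.K.smooth _ _ _ _ hω hQinc hQ fun i _ => (t (ν i)).2.2.2.2.1
  have hQle := s.K.le_union _ _ _ hω hQinc hQ
  have hPQ : s.K.le P Q := s.K.smooth _ _ _ _ hω hPinc hP fun i hi =>
    s.K.trans _ _ _ (t (ν i)).2.2.2.2.2 (hQle i hi)
  have hbQ : b ∈ Q.carrier := by
    refine (hQle 0 hω.bot_lt).sub.subset ?_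
    have : ν 0 = 0 := by exact_mod_cast hνnat 0
    rw [this]
    exact hQ₀A b (Or.inl rfl)
  have hlt : s.K.lt P Q := ⟨hPQ, fun e => hbM (hPM.sub.subset (e ▸ hbQ))⟩
  -- `a ∈ Q \ P` has a basic type over `P`, which does not fork over some member `F j` of the chain
  obtain ⟨a, haQ, haP, hab⟩ := hs.density P Q hPQ hPc hQc hlt
  have haN : a ∈ N.carrier := hQN.sub.subset haQ
  obtain ⟨i, hi, hai⟩ := hQ.2 a haQ
  have hPle : ∀ n : ℕ, s.K.le (t n).1.1 P := fun n => by
    have := s.K.le_union _ _ _ hω hPinc hP n (Ordinal.natCast_lt_omega0 n)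
    simp only [hνnat] at this
    exact this
  have haM : a ∉ M.carrier := fun haM =>
    haP ((hPle (ν i + 1)).sub.subset (hn3 (t (ν i)) a hai haM))
  obtain ⟨F, hF1, hF2, hF3, hFinc⟩ := hPinc.exists_append hω hP hPQ
  obtain ⟨j, hj, hnf⟩ : ∃ j < Ordinal.omega0, s.NonFork (F j) (AEC.tp hPQ a haQ) := by
    subst hF2 hF3
    refine hs.localCharacter Ordinal.omega0 F hω hωlam (fun α hα => ?_) hFinc hPQ a haQ hab
    rcases hα.lt_or_eq with hα | rfl
    · rcases (Order.lt_add_one_iff.1 hα).lt_or_eq with hα | rfl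
      · rw [hF1 α hα]
        exact (t (ν α)).2.1
      · exact hPc
    · exact hQc
  rw [hF1 j hj] at hnf
  -- at a stage that follows `j` and the appearance of `a`, the construction provides a witness `W`
  -- of forking over that stage, contrary to monotonicity
  obtain ⟨W, hW, hWc, hmW, hWm, hWf⟩ := hn4 (t (max (ν i) (ν j))) a haN
    ((hQmono _ _ (le_max_left _ _)).sub.subset hai) haM
  have hWP : s.K.le W P := s.K.trans _ _ _ hWm (hPle (max (ν i) (ν j) + 1))
  have := hs.nonFork_restrict hnf (hPmono _ _ (le_max_right (ν i) _)) hmW hWP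
    (t (max (ν i) (ν j))).2.1 hWc
  rw [restrict_tp, tp_eq_of_le _ (s.K.trans _ _ _ hW h) hQN haQ haN] at this
  exact hWf this

end PreFrame

namespace PreFrame

variable {s : PreFrame L} {lam κ : Cardinal.{u}} {M M' N N₀ : Model L}

/-! ### Basic stability -/

/-- A basic type over `M` is determined by a member `F i` of a filtration of `M` over which it does
not fork, and by its restriction to `F i`. -/
theorem IsFrame.mk_plus_Sbs_le (hs : s.IsFrame lam (succ lam)) (ht : s.K.Tame lam (succ lam))
    (hM : s.K.memCard (succ lam) M) :
    #((s.plus lam).Sbs M) ≤ Cardinal.lift.{u + 1} (succ lam) := by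
  obtain ⟨N₀, hN₀M, hN₀⟩ := hs.exists_le_memCard hM
  obtain ⟨F, -, hF, hFM, hmem⟩ := exists_filtration hs.infinite hs.LST_le hM hN₀ hN₀M
  have hex : ∀ p : (s.plus lam).Sbs M, ∃ i : Set.Iio (succ lam).ord,
      s.NonForkSmall lam (F i) (M := M) p.1 := by
    rintro ⟨p, hp⟩
    obtain ⟨-, N, hN⟩ := (mem_plus_Sbs_iff hs).1 hp
    obtain ⟨i, hi, hNi⟩ := exists_subset_of_isUnion hs.infinite hF hFM
      (cardLE_carrier.2 hN.1.2.le) fun x hx => hN.2.1.sub.subset hx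
    exact ⟨⟨i, hi⟩, hN.base_mono hs (le.of_subset hN.2.1 (hmem i hi).2 hNi) (hmem i hi).2
      (hmem i hi).1⟩
  choose i hi using hex
  let f : (s.plus lam).Sbs M → Σ i : Set.Iio (succ lam).ord, s.Sbs (F i) := fun p =>
    ⟨i p, _, (hs.nonFork_basic (hi p).self).2.2.1⟩
  have hf : Function.Injective f := by
    intro p q hpq
    have key : ∀ (j : Set.Iio (succ lam).ord) (t : s.Sbs (F j)) (r : (s.plus lam).Sbs M),
        f r = ⟨j, t⟩ → s.NonForkSmall lam (F j) (M := M) r.1 ∧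
          ∀ hle : s.K.le (F j) M, GType.restrict (K := s.K) hle r.1 = t := by
      rintro j t r ⟨⟩
      exact ⟨hi r, fun _ => rfl⟩
    obtain ⟨h1, h2⟩ := key _ _ p rfl
    obtain ⟨h3, h4⟩ := key _ _ q hpq.symm
    exact Subtype.ext (NonForkSmall.unique (s := s) hs ht hM h1 h3 ((h2 _).trans (h4 _).symm))
  -- there are `lam⁺` indices `i`, and at most `lam⁺` basic types over each `F i`
  refine (Cardinal.mk_le_of_injective hf).trans ?_
  rw [Cardinal.mk_sigma]
  refine (Cardinal.sum_le_mk_mul_iSup _).trans ?_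
  refine Cardinal.mul_le_of_le ?_ ?_ (ciSup_le' fun i => hs.stability (F i) (hmem i i.2).1)
  · exact Cardinal.aleph0_le_lift.2 (hs.infinite.trans (le_succ lam))
  · rw [Cardinal.mk_Iio_ordinal, Cardinal.card_ord]

/-! ### Local character and continuity -/

/-- Local character for models of cardinality `lam⁺`. If the type does not fork over `N₀` and `N₀`
is cofinal in the chain, local character in `lam` is applied to a chain of small models whose union
contains `N₀`. -/
theorem IsFrame.plus_localCharacter (hs : s.IsFrame lam κ) {δ : Ordinal.{u}}
    {M : Ordinal.{u} → Model L} (hδ : IsSuccLimit δ)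
    (hM : ∀ α ≤ δ + 1, s.K.memCard (succ lam) (M α))
    (hinc : IncreasingContinuous s.K.le M (δ + 2)) (h : s.K.le (M δ) (M (δ + 1))) {a : ZFSet.{u}}
    (ha : a ∈ (M (δ + 1)).carrier) (hN₀ : s.NonForkSmall lam N₀ (AEC.tp h a ha)) :
    ∃ α < δ, (s.plus lam).NonFork (M α) (AEC.tp h a ha : s.K.GType (M δ)) := by
  have hδ1 : δ < δ + 1 := lt_add_one δ
  have hδ2 : δ < δ + 2 := lt_add_of_pos_right δ two_pos
  have hle : ∀ α β, α ≤ β → β ≤ δ → s.K.le (M α) (M β) := fun α β h h' =>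
    hinc.1 α β h (h'.trans_lt hδ2)
  -- it suffices to find a small model inside some `M α` over which the type does not fork
  suffices hsuff : ∃ α < δ, ∃ N, s.K.le N (M α) ∧ s.NonForkSmall lam N (AEC.tp h a ha) by
    obtain ⟨α, hα, N, hN, hn⟩ := hsuff
    exact ⟨α, hα, (plus_nonFork_iff hs).2
      ⟨hM α (hα.trans hδ1).le, hM δ hδ1.le, hle α δ hα.le le_rfl, N, hN, hn⟩⟩
  by_cases hcase : ∃ α < δ, ∀ x ∈ N₀.carrier, x ∈ (M α).carrier
  · obtain ⟨α, hα, hsub⟩ := hcase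
    exact ⟨α, hα, N₀, le.of_subset hN₀.2.1 (hle α δ hα.le le_rfl) hsub, hN₀⟩
  push Not at hcase
  obtain ⟨P, hP, hPc⟩ := hs.exists_le_memCard (hM 0 zero_le)
  obtain ⟨θ, F, hθ, hθκ, -, hF, hFc, hFM, hFθ, hFθ1, hN₀F, haF⟩ := exists_small_chain hs.infinite
    hs.LST_le hδ hle (hinc.2 δ hδ2 hδ).2 hPc hP h hN₀.1.2.le (fun x hx => hN₀.2.1.sub.subset hx)
    hcase ha
  have hθ1 : θ < θ + 1 := lt_add_one θ
  have hN₀θ : s.K.le N₀ (F θ) := le.of_subset hN₀.2.1 hFθ hN₀F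
  have hstep : s.K.le (F θ) (F (θ + 1)) := by
    refine hF.1 θ (θ + 1) hθ1.le ?_
    rw [← one_add_one_eq_two, ← add_assoc]
    exact lt_add_one _
  have e : AEC.tp hstep a haF = (AEC.tp h a ha).restrict hFθ := tp_eq_of_le _ _ hFθ1 _ _
  obtain ⟨i, hi, hn⟩ := hs.localCharacter θ F hθ hθκ hFc hF hstep a haF (by
    rw [e]
    exact (hs.nonFork_basic (hN₀.2.2 _ hFθ (hFc θ hθ1.le) hN₀θ)).2.2.1)
  obtain ⟨α, hα, hiα⟩ := hFM i hi
  rw [e] at hn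
  exact ⟨α, hα, F i, hiα, (hN₀.base_mono hs hN₀θ hFθ (hFc θ hθ1.le)).trans hs hFθ hn⟩

/-- Continuity for models of cardinality `lam⁺`. If `N` is a small submodel cofinal in the chain,
continuity in `lam` is applied to a chain of small models whose union contains `N`. -/
theorem IsFrame.plus_continuity (hs : s.IsFrame lam κ) {δ : Ordinal.{u}}
    {M : Ordinal.{u} → Model L} (hδ : IsSuccLimit δ) (hM : ∀ α ≤ δ, s.K.memCard (succ lam) (M α))
    (hinc : IncreasingContinuous s.K.le M (δ + 1)) {p : s.K.GType (M δ)}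
    (hp : ∀ α < δ, ∀ h : s.K.le (M α) (M δ),
      (s.plus lam).NonFork (M 0) (GType.restrict (K := s.K) h p)) :
    ∃ N₀, s.K.le N₀ (M 0) ∧ s.NonForkSmall lam N₀ p := by
  have hδ1 : δ < δ + 1 := lt_add_one δ
  have hle : ∀ α β, α ≤ β → β ≤ δ → s.K.le (M α) (M β) := fun α β h h' =>
    hinc.1 α β h (h'.trans_lt hδ1)
  have h0 := hle 0 δ zero_le le_rfl
  obtain ⟨-, -, -, N₀, hN₀, hn₀⟩ := (plus_nonFork_iff hs).1 (hp 0 hδ.bot_lt h0)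
  have hN₀δ := s.K.trans _ _ _ hN₀ h0
  -- by transitivity, the same small model `N₀` works for all `α`
  have hα : ∀ α < δ, ∀ h : s.K.le (M α) (M δ), s.NonForkSmall lam N₀ (p.restrict h) := by
    intro α hα h
    obtain ⟨-, -, h0α, N, hN, hn⟩ := (plus_nonFork_iff hs).1 (hp α hα h)
    obtain ⟨P, hP, hPM, hN₀P, hNP⟩ := hs.exists_common_extension hn₀.1 hn.1 hN₀ hN
    have hPα := s.K.trans _ _ _ hPM h0α
    refine (hn.base_mono hs hNP hPα hP).trans hs hPα ?_
    have := hn₀.2.2 P hPM hP hN₀P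
    rwa [restrict_restrict] at this ⊢
  refine ⟨N₀, hN₀, NonForkSmall.of_cofinal hs hn₀.1 hN₀δ fun N hN hNc hN₀N => ?_⟩
  by_cases hcase : ∃ α < δ, ∀ x ∈ N.carrier, x ∈ (M α).carrier
  · obtain ⟨α, hαδ, hsub⟩ := hcase
    have hαle := hle α δ hαδ.le le_rfl
    have := (hα α hαδ hαle).2.2 N (le.of_subset hN hαle hsub) hNc hN₀N
    rw [restrict_restrict] at this
    exact ⟨N, hN, s.K.refl _ hNc.1, this⟩
  push Not at hcase
  obtain ⟨x, hx, -⟩ := hcase 0 hδ.bot_lt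
  obtain ⟨θ, F, hθ, hθκ, rfl, hF, hFc, hFM, hFθ, -, hNF, -⟩ := exists_small_chain hs.infinite
    hs.LST_le hδ hle (hinc.2 δ hδ1 hδ).2 hn₀.1 hN₀ (s.K.refl _ (hM δ le_rfl).1) hNc.2.le
    (fun x hx => hN.sub.subset hx) hcase (hN.sub.subset hx)
  have hθ1 : θ < θ + 1 := lt_add_one θ
  refine ⟨F θ, hFθ, le.of_subset hN hFθ hNF, ?_⟩
  refine (hs.continuity θ F hθ hθκ (fun i hi => hFc i (hi.trans hθ1.le)) (hF.mono ?_) _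
    fun i hi hiθ => ?_).2
  · exact add_le_add_right one_le_two θ
  · obtain ⟨α, hαδ, hiα⟩ := hFM i hi
    have hαle := hle α δ hαδ.le le_rfl
    have := (hα α hαδ hαle).2.2 (F i) hiα (hFc i (hi.le.trans hθ1.le))
      (hF.1 0 i zero_le (hi.trans (lt_add_of_pos_right θ two_pos)))
    rwa [restrict_restrict] at this ⊢

/-! ### The lifted frame is good -/

theorem IsFrame.noMaximal_succ (hs : s.IsFrame lam κ) : s.K.NoMaximal (succ lam) := by
  intro M hM
  obtain ⟨N, hNM, hN⟩ := hs.exists_le_memCard hM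
  obtain ⟨P, hP, hNP⟩ := hs.noMaximal N hN
  obtain ⟨b, hb, -, hbasic⟩ := hs.density N P hNP.1 hN hP hNP
  obtain ⟨q, hq, -⟩ := hs.exists_nonForkSmall_extension hN hM hNM hbasic
  obtain ⟨Q, hMQ, a, ha, hQ, rfl⟩ := exists_rep_memCard (hs.infinite.trans (le_succ lam))
    (hs.LST_le.trans (le_succ lam)) hM q
  exact ⟨Q, hQ, hMQ, fun e => hq.notMem hs (e ▸ ha)⟩

/-- `NonForkSmall.iso` for a bundled isomorphism. -/
theorem NonForkSmall.exists_image (hs : s.IsFrame lam κ) {N' : Model L}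
    {f : N.carrier ≃[L] N'.carrier}
    (hf : IsImage f M M') (h : s.K.le M N) (h' : s.K.le M' N') {a : N.carrier}
    (hn : s.NonForkSmall lam N₀ (AEC.tp h a a.2)) : ∃ N₀', IsImage f N₀ N₀' ∧
      s.NonForkSmall lam N₀' (AEC.tp h' (f a) (f a).2) := by
  obtain ⟨φ, hφ⟩ : ∃ φ : ZFSet.{u} → ZFSet.{u}, ∀ x, (f x : ZFSet.{u}) = φ x :=
    exists_fun f.toEmbedding
  have hN : Iso φ N N' := ⟨f, hφ⟩
  have hM : Iso φ M M' := iso_of_isImage hφ h.sub hf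
  obtain ⟨N₀', hi, hsub⟩ := hM.exists_image hn.2.1.sub
  refine ⟨N₀', Iso.isImage hφ hi (hn.2.1.sub.trans h.sub) (hsub.trans h'.sub), ?_⟩
  rw [tp_congr h' (hφ a) (f a).2 (hN.emb.mapsTo a.2)]
  exact hn.iso hs hN hM h h' (hN.emb.mapsTo a.2) hi hsub

theorem IsImage.le {K : AEC L} {N' : Model L} {f : N.carrier ≃[L] N'.carrier}
    (hf : IsImage f M M') (h : K.le M N) : K.le M' N' := K.le_iso _ _ _ _ f h hf

theorem IsImage.memCard {K : AEC L} {N' : Model L} {f : N.carrier ≃[L] N'.carrier}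
    (hf : IsImage f M M') (h : M.Sub N) {μ : Cardinal.{u}} (hM : K.memCard μ M) :
    K.memCard μ M' := by
  obtain ⟨φ, hφ⟩ := exists_fun f.toEmbedding
  exact memCard_of_iso (iso_of_isImage hφ h hf) hM

theorem IsImage.le_le {K : AEC L} {M₀ M₀' N' : Model L} {f : N.carrier ≃[L] N'.carrier}
    (h₀ : IsImage f M₀ M₀') (h₁ : IsImage f M M') (hle₀ : K.le M₀ M) (hle : K.le M N) :
    K.le M₀' M' :=
  le.of_subset (IsImage.le h₀ (K.trans _ _ _ hle₀ hle)) (IsImage.le h₁ hle) fun y hy => by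
    obtain ⟨x, hx, e⟩ := (h₀.2 ⟨y, h₀.1.subset hy⟩).1 hy
    exact (h₁.2 ⟨y, h₀.1.subset hy⟩).2 ⟨x, hle₀.sub.subset hx, e⟩

/-- The axioms of a good frame, verified for the lifted frame. -/
theorem IsFrame.plus_isGood (hs : s.IsFrame lam (succ lam)) (hA : s.K.Amalgamation (succ lam))
    (ht : s.K.Tame lam (succ lam)) (hsymm : (s.plus lam).Symmetry (succ lam)) :
    (s.plus lam).IsFrame (succ lam) (succ lam) where
  infinite := hs.infinite.trans (le_succ lam)
  LST_le := hs.LST_le.trans (le_succ lam)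
  jointEmbedding := hs.jointEmbedding_succ
  amalgamation := hA
  noMaximal := hs.noMaximal_succ
  basic_nonalgebraic := by
    intro M hM p hp
    obtain ⟨-, N₀, hn⟩ := (mem_plus_Sbs_iff hs).1 hp
    obtain ⟨N, h, a, ha, hN, rfl⟩ := exists_rep_memCard (hs.infinite.trans (le_succ lam))
      (hs.LST_le.trans (le_succ lam)) hM p
    exact ⟨N, h, a, ha, hN, hn.notMem hs, rfl⟩
  basic_iso := by
    intro M N M' N' f h h' a hM hN hf hp
    obtain ⟨-, N₀, hn⟩ := (mem_plus_Sbs_iff hs).1 hp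
    obtain ⟨N₀', -, hn'⟩ := hn.exists_image hs hf h h'
    exact (mem_plus_Sbs_iff hs).2 ⟨IsImage.memCard hf h.sub hM, N₀', hn'⟩
  density := by
    intro M N h hM hN hlt
    obtain ⟨a, ha, haM, P, hn⟩ := hs.exists_nonForkSmall_of_lt hM h hlt.2
    exact ⟨a, ha, haM, (mem_plus_Sbs_iff hs).2 ⟨hM, P, hn⟩⟩
  stability M hM := hs.mk_plus_Sbs_le ht hM
  dnf_basic := by
    intro M₀ M₁ a M₃ hd
    obtain ⟨h0, h1, h3, hle, h, ha, N₀, hN₀, hn⟩ := (plus_dnf_iff hs).1 hd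
    exact ⟨h0, h1, h3, hle, hn.notMem hs, ha, s.K.trans _ _ _ hle h, h,
      (mem_plus_Sbs_iff hs).2 ⟨h0, N₀, hn.restrict hN₀ hle⟩,
      (mem_plus_Sbs_iff hs).2 ⟨h1, N₀, hn⟩⟩
  dnf_iso := by
    intro M₀ M₁ M₃ M₀' M₁' M₃' f a hf₀ hf₁ hd
    obtain ⟨h0, h1, h3, hle, h, ha, N₀, hN₀, hn⟩ := (plus_dnf_iff hs).1 hd
    have h' := IsImage.le hf₁ h
    obtain ⟨N₀', hf, hn'⟩ := hn.exists_image hs hf₁ h h'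
    have hle₀ := s.K.trans _ _ _ hle h
    exact (plus_dnf_iff hs).2 ⟨IsImage.memCard hf₀ hle₀.sub h0, IsImage.memCard hf₁ h.sub h1,
      ⟨s.K.mem_iso _ _ h3.1 ⟨f⟩, by
        obtain ⟨φ, hφ⟩ := exists_fun f.toEmbedding
        exact (Iso.card_eq ⟨f, hφ⟩).symm.trans h3.2⟩,
      IsImage.le_le hf₀ hf₁ hle h, h', (f a).2, N₀', IsImage.le_le hf hf₀ hN₀ hle₀, hn'⟩
  monotonicity := by
    intro M₀ N₀ N₁ M₁ M₃ M₃' N₃ a hmem h₀ h₀₁ h₁ h₁₃ h₃ hsub ha hN₃ hd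
    obtain ⟨h0, h1, h3, hle, h, ha', P, hP, hn⟩ := (plus_dnf_iff hs).1 hd
    have hN₁₃ : s.K.le N₁ N₃ := le.of_subset
      (s.K.trans _ _ _ h₁ (s.K.trans _ _ _ h₁₃ h₃)) hN₃ fun x hx => hsub hx
    refine (plus_dnf_iff hs).2 ⟨hmem N₀ (by simp), hmem N₁ (by simp), hmem N₃ (by simp), h₀₁, hN₁₃,
      ha, P, s.K.trans _ _ _ hP h₀, ?_⟩
    have e : AEC.tp hN₁₃ a ha = (AEC.tp h a ha').restrict h₁ :=
      (tp_eq_of_le _ (s.K.trans _ _ _ hN₁₃ hN₃) hN₃ _ (hN₃.sub.subset ha)).trans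
        (tp_eq_of_le _ _ h₃ _ _).symm
    rw [e]
    exact hn.restrict (s.K.trans _ _ _ hP (s.K.trans _ _ _ h₀ h₀₁)) h₁
  localCharacter := by
    intro δ M hδ _ hM hinc h a ha hb
    obtain ⟨-, N₀, hn⟩ := (mem_plus_Sbs_iff hs).1 hb
    exact hs.plus_localCharacter hδ hM hinc h ha hn
  uniqueness := by
    intro M N (h : s.K.le M N) hM hN (p : s.K.GType N) _ (q : s.K.GType N) _ hp hq e
    obtain ⟨-, -, -, P, hP, hn⟩ := (plus_nonFork_iff hs).1 hp
    obtain ⟨-, -, -, Q, hQ, hn'⟩ := (plus_nonFork_iff hs).1 hq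
    obtain ⟨R, hR, hRM, hPR, hQR⟩ := hs.exists_common_extension hn.1 hn'.1 hP hQ
    have hRN := s.K.trans _ _ _ hRM h
    refine NonForkSmall.unique (s := s) hs ht hN (hn.base_mono hs hPR hRN hR)
      (hn'.base_mono hs hQR hRN hR) ?_
    rw [← restrict_restrict hRM h, ← restrict_restrict hRM h]
    exact congrArg _ e
  symmetry := hsymm
  extension := by
    intro M N (h : s.K.le M N) hM hN _ (p : s.K.GType M) hp
    obtain ⟨-, N₀, hn⟩ := (mem_plus_Sbs_iff hs).1 hp
    obtain ⟨q, hq, e⟩ := hs.exists_nonForkSmall_extension hn.1 hN (s.K.trans _ _ _ hn.2.1 h)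
      (hs.nonFork_basic hn.self).2.2.1
    refine ⟨q, (mem_plus_Sbs_iff hs).2 ⟨hN, N₀, hq⟩,
      (plus_nonFork_iff hs).2 ⟨hM, hN, h, N₀, hn.2.1, hq⟩, ?_⟩
    refine NonForkSmall.unique (s := s) hs ht hM (hq.restrict hn.2.1 h) hn ?_
    exact (restrict_restrict (K := s.K) hn.2.1 h q).trans e
  continuity := by
    intro δ M hδ _ hM hinc p hp
    obtain ⟨N₀, hN₀, hn⟩ := hs.plus_continuity hδ hM hinc hp
    have h0 : s.K.le (M 0) (M δ) := hinc.1 0 δ zero_le (lt_add_one δ)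
    exact ⟨(mem_plus_Sbs_iff hs).2 ⟨hM δ le_rfl, N₀, hn⟩,
      (plus_nonFork_iff hs).2 ⟨hM 0 zero_le, hM δ le_rfl, h0, N₀, hN₀, hn⟩⟩

end PreFrame

end NonForking

theorem mainTheorem1 (L : FirstOrder.Language.{u, u}) (s : NonForking.PreFrame L)
    (lam : Cardinal.{u}) (hs : s.IsSemiGood lam) (hamalg : s.K.Amalgamation (Order.succ lam))
    (htame : s.K.Tame lam (Order.succ lam))
    (hsymm : (s.plus lam).Symmetry (Order.succ lam)) :
    (s.plus lam).IsGood (Order.succ lam) :=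
  NonForking.PreFrame.IsFrame.plus_isGood hs hamalg htame hsymm
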